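/- Let $M$ be a smooth 3-manifold (Hausdorff, second countable, possibly with boundary) with a contact structure $\xi$, i.e. a plane distribution that is locally the kernel of a smooth 1-form $\alpha$ with $\alpha\wedge d\alpha$ nowhere zero. $\xi$ is not assumed coorientable. Definitions. An embedded curve is a subset homeomorphic to a nonempty connected subset of a circle. The length of a compact curve, for a distance $d$, is the supremum of $\sum_i d(a_i,b_i)$ over all ways to write it as a finite union of compact arcs $\gamma_i$ without common interior points, where $a_i,b_i$ are the endpoints of $\gamma_i$. A curve is Lavrentiev if all its compact subarcs have finite length and, for some constant $C$, any two distinct points $P,Q$ of it are joined by a subarc of length at most $C\,d(P,Q)$. An embedded curve $L\subset M$ is locally Lavrentiev if each of its points has a neighbourhood in which $L$ is a Lavrentiev curve for the distance of some (equivalently, any) smooth Riemannian metric on $M$. A locally Lavrentiev curve $L$ is Legendrian if for each $p\in L$ and some (equivalently, any) $C^1$ Euclidean coordinates near $p$ the following holds: for every $\varepsilon>0$ there is a neighbourhood $V$ of $p$ such that $\angle(p''-p',\xi_p)<\varepsilon$ for all distinct $p',p''\in L\cap V$. A field of line elements $l$ assigns to every point $p$ an unordered pair $l_p=\{v,-v\}$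 of opposite tangent vectors at $p$. It is smooth if locally $l=\{v,-v\}$ for a smooth vector field $v$. It is contact if it is smooth and on every simply connected open subset $l=\{v,-v\}$ for a smooth vector field $v$ whose flow preserves $\xi$. For $A\subset M$ and $0<r\le\infty$ let $B_{rl}(A)=\{c\,v:\ v\in l_p,\ p\in A,\ |c|<r\}\subset TM$. For $v\in l_p$ put $\exp_l(c\,v)=\gamma(c)$, where $\gamma$ is the trajectory of $l$ with $\gamma(0)=p$, $\gamma'(0)=v$, whenever $\gamma$ is defined up to time $c$. Proposition. Let $L$ be a compact Legendrian curve contained in the interior of $M$. Then $L$ has a regular neighbourhood. That is, there exist an open set $U\supset L$, a smooth embedded surface $S\subset U$ without boundary lying in the interior of $M$, a contact field of line elements $l$ on $M$ that is everywhere transverse to $\xi$, and a number $0<r\le+\infty$ such that $\exp_l$ is defined on $B_{rl}(S)$ and is a diffeomorphism from $B_{rl}(S)$ onto $U$, and such that the projection $\mathrm{pr}:U\to S$ along the trajectories of $l$ (sending $\exp_l(w)$ to the base point of $w\in B_{rl}(S)$) is injective on $L$. -/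

import Mathlib

open Set Manifold Bundle
open scoped ContDiff ENNReal NNReal

noncomputable section

namespace RegularNbhd

/-- Euclidean 3-space, the model vector space of all manifolds considered here. -/
abbrev E3 : Type := EuclideanSpace ℝ (Fin 3)

section Curves

variable {X : Type*} [TopologicalSpace X]

/-- An embedded curve: a subset homeomorphic to a (nonempty) connected subset of a circle. -/
def IsEmbeddedCurve (L : Set X) : Prop :=
  ∃ T : Set Circle, IsConnected T ∧ Nonempty (L ≃ₜ T)

/-- `A` is a compact arc with endpoints `a` and `b`: the image of `[0,1]` under a continuous
injective map sending `0` to `a` and `1` to `b` (in a Hausdorff space such a map is an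
embedding). -/
def IsArc (A : Set X) (a b : X) : Prop :=
  ∃ h : ℝ → X, ContinuousOn h (Icc 0 1) ∧ InjOn h (Icc 0 1) ∧ h '' Icc 0 1 = A ∧
    h 0 = a ∧ h 1 = b

/-- The length of a compact curve `L` with respect to the distance function `d`: the supremum,
over all ways to write `L` as a finite union of compact arcs `A i` without common interior points,
of the sum of the distances between the endpoints of the arcs. -/
def curveLength (d : X → X → ℝ≥0∞) (L : Set X) : ℝ≥0∞ :=
  sSup {s | ∃ (n : ℕ) (A : Fin n → Set X) (a b : Fin n → X),
    (∀ i, IsArc (A i) (a i) (b i)) ∧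
    (∀ i j, i ≠ j → Disjoint (A i \ {a i, b i}) (A j \ {a j, b j})) ∧
    (⋃ i, A i) = L ∧ s = ∑ i, d (a i) (b i)}

/-- A curve is rectifiable if all of its compact subarcs have finite length. -/
def IsRectifiable (d : X → X → ℝ≥0∞) (L : Set X) : Prop :=
  ∀ (A : Set X) (a b : X), A ⊆ L → IsArc A a b → curveLength d A < ⊤

/-- A rectifiable embedded curve is Lavrentiev (chord-arc) if, for some constant `C`, any two of
its points `P ≠ Q` are joined by a subarc of length at most `C * d P Q` (equivalently, a shortest
subarc joining them has length at most `C * d P Q`). -/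
def IsLavrentiev (d : X → X → ℝ≥0∞) (L : Set X) : Prop :=
  IsEmbeddedCurve L ∧ IsRectifiable d L ∧
    ∃ C : ℝ≥0, ∀ P ∈ L, ∀ Q ∈ L, P ≠ Q →
      ∃ A : Set X, A ⊆ L ∧ IsArc A P Q ∧ curveLength d A ≤ C * d P Q

/-- An embedded curve is locally Lavrentiev if every point of it has a neighbourhood in which the
curve is Lavrentiev. -/
def IsLocallyLavrentiev (d : X → X → ℝ≥0∞) (L : Set X) : Prop :=
  IsEmbeddedCurve L ∧ ∀ p ∈ L, ∃ U : Set X, IsOpen U ∧ p ∈ U ∧ IsLavrentiev d (L ∩ U)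

end Curves

/-- The angle between a vector `w` and a linear subspace `P` of Euclidean space: the infimum of the
angles between `w` and the nonzero vectors of `P`. -/
def angleToPlane (w : E3) (P : Submodule ℝ E3) : ℝ :=
  sInf {θ | ∃ u ∈ P, u ≠ 0 ∧ θ = InnerProductGeometry.angle w u}

variable {H : Type*} [TopologicalSpace H] (I : ModelWithCorners ℝ E3 H)
  {M : Type*} [TopologicalSpace M] [ChartedSpace H M]

section Lavrentiev

variable [IsManifold I ∞ M]

/-- The distance function of a smooth Riemannian metric `g` on `M`: the infimum of the lengths of
`C^1` paths. -/
def riemDist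
    (g : ContMDiffRiemannianMetric I ∞ E3 (fun p : M => TangentSpace I p)) : M → M → ℝ≥0∞ :=
  letI : RiemannianBundle (fun p : M => TangentSpace I p) := ⟨g.toRiemannianMetric⟩
  fun p q => riemannianEDist I p q

/-- A curve in a manifold is locally Lavrentiev if it is so for the distance of some smooth
Riemannian metric (for a curve in a manifold the choice of the metric is irrelevant). -/
def IsLocallyLavrentievCurve (L : Set M) : Prop :=
  ∃ g : ContMDiffRiemannianMetric I ∞ E3 (fun p : M => TangentSpace I p),
    IsLocallyLavrentiev (riemDist I g) L

end Lavrentiev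

section Forms

/-- The 1-form `α` is smooth on `V`, as a section of the cotangent bundle. -/
def IsSmoothOneFormOn [IsManifold I ∞ M] (α : ∀ p : M, TangentSpace I p →L[ℝ] ℝ) (V : Set M) :
    Prop :=
  ContMDiffOn I (I.prod 𝓘(ℝ, E3 →L[ℝ] ℝ)) ∞
    (fun p => (TotalSpace.mk' (E3 →L[ℝ] ℝ) p (α p) :
      TotalSpace (E3 →L[ℝ] ℝ) (fun p : M => TangentSpace I p →L[ℝ] Trivial M ℝ p))) V

/-- The expression of the 1-form `α` in the preferred chart at `q`: its pullback by the inverse of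
the chart. -/
def formInChart (α : ∀ p : M, TangentSpace I p →L[ℝ] ℝ) (q : M) : E3 → E3 →L[ℝ] ℝ :=
  fun y => (α ((extChartAt I q).symm y)).comp
    (mfderivWithin 𝓘(ℝ, E3) I (extChartAt I q).symm (range I) y)

/-- The value of the exterior derivative `dα` at `q`, computed in the preferred chart at `q`. -/
def extDerivAt (α : ∀ p : M, TangentSpace I p →L[ℝ] ℝ) (q : M) (u v : E3) : ℝ :=
  fderivWithin ℝ (formInChart I α q) (range I) (extChartAt I q q) u v -
    fderivWithin ℝ (formInChart I α q) (range I) (extChartAt I q q) v u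

/-- The value of the 3-form `α ∧ dα` at `q`, computed in the preferred chart at `q`. -/
def wedgeExtDerivAt (α : ∀ p : M, TangentSpace I p →L[ℝ] ℝ) (q : M) (u v w : E3) : ℝ :=
  formInChart I α q (extChartAt I q q) u * extDerivAt I α q v w +
  formInChart I α q (extChartAt I q q) v * extDerivAt I α q w u +
  formInChart I α q (extChartAt I q q) w * extDerivAt I α q u v

/-- A contact structure on a 3-manifold: a plane distribution which is locally the kernel of a
smooth 1-form `α` such that `α ∧ dα` vanishes nowhere. -/
def IsContactStructure [IsManifold I ∞ M] (ξ : ∀ p : M, Submodule ℝ (TangentSpace I p)) : Prop :=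
  ∀ p : M, ∃ V : Set M, IsOpen V ∧ p ∈ V ∧ ∃ α : ∀ p : M, TangentSpace I p →L[ℝ] ℝ,
    IsSmoothOneFormOn I α V ∧
    ∀ q ∈ V, ξ q = (α q).ker ∧ ∃ u v w : E3, wedgeExtDerivAt I α q u v w ≠ 0

end Forms

/-- A locally Lavrentiev curve `L` is Legendrian with respect to the plane distribution `ξ` if for
every `p ∈ L`, in some Euclidean coordinates of class `C^1` near `p`, the angle between `ξ p` and
the chord joining two distinct points of `L` tends to zero as the two points tend to `p`. -/
def IsLegendrian [IsManifold I ∞ M] (ξ : ∀ p : M, Submodule ℝ (TangentSpace I p)) (L : Set M) :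
    Prop :=
  IsLocallyLavrentievCurve I L ∧
  ∀ p ∈ L, ∃ φ ∈ IsManifold.maximalAtlas I 1 M, p ∈ φ.source ∧
    ∀ ε : ℝ, 0 < ε → ∃ U : Set M, IsOpen U ∧ p ∈ U ∧ U ⊆ φ.source ∧
      ∀ p' ∈ L ∩ U, ∀ p'' ∈ L ∩ U, p' ≠ p'' →
        angleToPlane (φ.extend I p'' - φ.extend I p')
          ((ξ p).map (mfderiv I 𝓘(ℝ, E3) (φ.extend I) p).toLinearMap) < ε

section VectorFields

variable [IsManifold I ∞ M]

/-- The vector field `v` is smooth on `V`. -/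
def IsSmoothVectorFieldOn (v : ∀ p : M, TangentSpace I p) (V : Set M) : Prop :=
  ContMDiffOn I I.tangent ∞ (fun p => (⟨p, v p⟩ : TangentBundle I M)) V

/-- `Φ` is a smooth local flow of the vector field `v`, inside `U`, defined on `W` for the times
`|t| < ε`. -/
def IsLocalFlow (v : ∀ p : M, TangentSpace I p) (U W : Set M) (ε : ℝ) (Φ : M → ℝ → M) : Prop :=
  IsOpen W ∧ 0 < ε ∧
  (∀ p ∈ W, ∀ t ∈ Ioo (-ε) ε, Φ p t ∈ U) ∧
  (∀ p ∈ W, Φ p 0 = p) ∧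
  (∀ p ∈ W, IsMIntegralCurveOn (Φ p) v (Ioo (-ε) ε)) ∧
  ContMDiffOn (I.prod 𝓘(ℝ, ℝ)) I ∞ (fun x : M × ℝ => Φ x.1 x.2) (W ×ˢ Ioo (-ε) ε)

/-- A contact vector field on the open set `U`: a smooth vector field whose flow preserves `ξ`. -/
def IsContactVectorFieldOn (ξ : ∀ p : M, Submodule ℝ (TangentSpace I p))
    (v : ∀ p : M, TangentSpace I p) (U : Set M) : Prop :=
  IsSmoothVectorFieldOn I v U ∧
  ∀ (W : Set M) (ε : ℝ) (Φ : M → ℝ → M), IsLocalFlow I v U W ε Φ →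
    ∀ p ∈ W, ∀ t ∈ Ioo (-ε) ε,
      (ξ p).map (mfderiv I I (fun q => Φ q t) p).toLinearMap = ξ (Φ p t)

end VectorFields

variable (M) in
/-- A field of line elements on `M`: an unordered pair of opposite tangent vectors at every
point. -/
structure LineElementField where
  /-- the line element at a point -/
  elem : ∀ p : M, Set (TangentSpace I p)
  exists_eq : ∀ p : M, ∃ v : TangentSpace I p, elem p = {v, -v}

namespace LineElementField

variable {I}

section

variable [IsManifold I ∞ M]

/-- The field is smooth: locally it is `{v, -v}` for a smooth vector field `v`. -/
def IsSmooth (l : LineElementField I M) : Prop :=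
  ∀ p : M, ∃ V : Set M, IsOpen V ∧ p ∈ V ∧ ∃ v : ∀ p : M, TangentSpace I p,
    IsSmoothVectorFieldOn I v V ∧ ∀ q ∈ V, l.elem q = {v q, -v q}

/-- A contact field of line elements: it is smooth, and on any simply connected open subset it is
`{v, -v}` for a contact vector field `v`. -/
def IsContact (l : LineElementField I M) (ξ : ∀ p : M, Submodule ℝ (TangentSpace I p)) : Prop :=
  l.IsSmooth ∧
  ∀ U : Set M, IsOpen U → SimplyConnectedSpace U → ∃ v : ∀ p : M, TangentSpace I p,
    IsContactVectorFieldOn I ξ v U ∧ ∀ q ∈ U, l.elem q = {v q, -v q}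

end

/-- The field is everywhere transverse to the plane distribution `ξ`. -/
def IsTransverse (l : LineElementField I M) (ξ : ∀ p : M, Submodule ℝ (TangentSpace I p)) : Prop :=
  ∀ p : M, ∀ v ∈ l.elem p, v ∉ ξ p

/-- `γ` is a trajectory of the field `l` on the interval `J`: it is of class `C^1` and its velocity
belongs to the line element at every moment. -/
def IsTrajectoryOn (l : LineElementField I M) (γ : ℝ → M) (J : Set ℝ) : Prop :=
  ContMDiffOn 𝓘(ℝ, ℝ) I 1 γ J ∧
  ∀ t ∈ J, (mfderiv 𝓘(ℝ, ℝ) I γ t (1 : ℝ) : TangentSpace I (γ t)) ∈ l.elem (γ t)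

/-- The band `B_{rl}(A)`: the set of all tangent vectors `c • v` where `v` belongs to the line
element at a point of `A` and `|c| < r`. -/
def band (l : LineElementField I M) (r : ℝ≥0∞) (A : Set M) : Set (TangentBundle I M) :=
  {w | w.proj ∈ A ∧ ∃ v ∈ l.elem w.proj, ∃ c : ℝ, ENNReal.ofReal |c| < r ∧ w.snd = c • v}

/-- `q = exp_l(w)`: here `w = c • v` where `v` belongs to the line element at the base point `p` of
`w`, and `q = γ(c)` for a trajectory `γ` of `l` with `γ(0) = p` and `γ'(0) = v`. -/
def IsExp (l : LineElementField I M) (w : TangentBundle I M) (q : M) : Prop :=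
  ∃ (c a b : ℝ) (γ : ℝ → M), 0 ∈ Ioo a b ∧ c ∈ Ioo a b ∧ l.IsTrajectoryOn γ (Ioo a b) ∧
    γ c = q ∧ γ 0 = w.proj ∧
    w = (⟨γ 0, c • (mfderiv 𝓘(ℝ, ℝ) I γ 0 (1 : ℝ) : TangentSpace I (γ 0))⟩ : TangentBundle I M)

/-- `e` is the map `exp_l` on the set `B` of tangent vectors. -/
def IsExpMapOn (l : LineElementField I M) (e : TangentBundle I M → M)
    (B : Set (TangentBundle I M)) : Prop :=
  ∀ w ∈ B, ∀ q : M, l.IsExp w q ↔ q = e w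

end LineElementField

/-- `S` is a smooth embedded surface without boundary in the interior of the 3-manifold `M`:
locally it is the zero set of a smooth function with nonvanishing differential. -/
def IsSmoothSurface (S : Set M) : Prop :=
  S ⊆ I.interior M ∧
  ∀ p ∈ S, ∃ V : Set M, IsOpen V ∧ p ∈ V ∧ ∃ f : M → ℝ,
    ContMDiffOn I 𝓘(ℝ, ℝ) ∞ f V ∧ mfderiv I 𝓘(ℝ, ℝ) f p ≠ 0 ∧ S ∩ V = {q ∈ V | f q = 0}

variable [IsManifold I ∞ M]

/-- `f` restricts to a diffeomorphism from the subset `B` of the tangent bundle of `M` onto the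
subset `U` of `M`: it is a bijection of `B` onto `U`, smooth on `B`, with inverse smooth on `U`. -/
def IsDiffeoOn (f : TangentBundle I M → M) (B : Set (TangentBundle I M)) (U : Set M) : Prop :=
  BijOn f B U ∧ ContMDiffOn I.tangent I ∞ f B ∧
    ∃ g : M → TangentBundle I M, InvOn g f B U ∧ ContMDiffOn I I.tangent ∞ g U

/-- The quadruple `(U, S, l, r)` is a regular neighbourhood of the curve `L`. Here `pr : U → S` is
the projection along the trajectories of `l`, that is, `exp_l(w)` is sent to the base point of
`w`. -/
def IsRegularQuadruple (ξ : ∀ p : M, Submodule ℝ (TangentSpace I p)) (L U S : Set M)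
    (l : LineElementField I M) (r : ℝ≥0∞) : Prop :=
  IsOpen U ∧ L ⊆ U ∧ 0 < r ∧ IsSmoothSurface I S ∧ S ⊆ U ∧ l.IsContact ξ ∧ l.IsTransverse ξ ∧
  ∃ e : TangentBundle I M → M, l.IsExpMapOn e (l.band r S) ∧ IsDiffeoOn I e (l.band r S) U ∧
  ∃ pr : M → M, MapsTo pr U S ∧ (∀ w ∈ l.band r S, pr (e w) = w.proj) ∧ InjOn pr L

/-- `U` is a regular neighbourhood of the curve `L`. -/
def IsRegularNeighborhood (ξ : ∀ p : M, Submodule ℝ (TangentSpace I p)) (L U : Set M) : Prop :=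
  ∃ (S : Set M) (l : LineElementField I M) (r : ℝ≥0∞), IsRegularQuadruple I ξ L U S l r

end RegularNbhd

end

/-!
Near every point the contact structure `ξ` is the kernel of a contact form, and the form is unique up
to multiplication with a nonvanishing function. A partition of unity normalizes these local
forms so that any two of them agree up to sign on overlaps
(`IsContactStructure.exists_compatible_forms`). Their Reeb fields, `a R = 1` and `da (R, ·) = 0`, then
also agree up to sign, so they make up a field of line elements `l` on `M`, which is transverse to
`ξ` (`IsContactStructure.exists_reeb_elements`). The flow of a Reeb field preserves its form, and
over a simply connected open set the signs can be chosen consistently, because a double covering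
of such a set is trivial. Hence `l` is contact (`isContact_of_reeb_directors`).

It remains to find a surface `S` near `L` such that the trajectories of `l` of a small length
through `S` are disjoint, fill up a neighbourhood of `L`, and meet `L` at most once each. The surface
is the zero set of a "height function" `F`, increasing along the trajectories and small
on `L`. As `l` need not be orientable near `L`, the function `F` is only defined up to sign: it changes
its sign together with the vector field representing `l`, and is encoded as a family of functions
indexed by the local vector fields (`IsTransverseFamily`). Such a function exists near each point of
`L` because `L` is Legendrian. Indeed, let `A` be a linear function, in a chart at `p`, with kernel
`ξ p`. The chords of `L` near `p` make small angles with `ξ p`, so `A` restricted to `L` has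
a small Lipschitz constant, and extends to a function with the same property, which can be
smoothed with an arbitrarily small error; subtracting it from `A` yields a function which is
arbitrarily small on `L` and still increases along `l` (`IsLegendrian.hasHeight`). Local height functions
are glued by a partition of unity (`exists_transverseFamily`): where all of them are small, the
derivatives of the partition functions contribute little to the derivative along `l`.

Thus for every `δ > 0` there is a height function `F` which grows at least at unit rate along the
trajectories and satisfies `|F| ≤ δ` on `L`, while the neighbourhood of `L` where `F` is defined, and
hence the time `R` for which the trajectories stay in it, do not depend on `δ`. Fix `F` with
`δ = R / 4`, and let `S` be its zero set. A trajectory of length `R` meets `S` at most once, and each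
point of `L` reaches `S` in time less than `R / 2`. Two points of `L` on the same short trajectory are
at time distance at most `2 δ`, for every `δ > 0`, because one may use other height functions here;
so they are equal, and the projection to `S` is injective on `L`. By the implicit function theorem
the time to reach `S` is smooth, which shows that the exponential map of `l` is a diffeomorphism on a
band over `S` (`exists_band_neighborhood`). The smoothness of flows is derived from the implicit
function theorem in a space of continuous curves (`exists_smooth_local_flow`).
-/
set_option linter.unusedSectionVars false

noncomputable section

namespace RegularNbhd

open Filter Topology BoundedContinuousFunction

/-! ### Smooth dependence of ordinary differential equations on the initial value -/

section Superposition

set_option synthInstance.maxHeartbeats 100000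

variable {K : Type*} [TopologicalSpace K] [CompactSpace K]

/-- The superposition operator `γ ↦ f ∘ γ` between spaces of continuous functions on `K`. -/
def superposition {E F : Type*} [PseudoMetricSpace E] [PseudoMetricSpace F]
    (f : E → F) (hf : Continuous f) : (K →ᵇ E) → (K →ᵇ F) :=
  fun γ => mkOfCompact ⟨fun k => f (γ k), hf.comp γ.continuous⟩

lemma superposition_apply {E F : Type*} [PseudoMetricSpace E] [PseudoMetricSpace F]
    (f : E → F) (hf : Continuous f) (γ : K →ᵇ E) (k : K) : superposition f hf γ k = f (γ k) := rfl

variable {E F : Type*} [NormedAddCommGroup E] [NormedSpace ℝ E]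
  [NormedAddCommGroup F] [NormedSpace ℝ F]

variable (K E F) in
/-- Pointwise application `(A, h) ↦ (k ↦ A k (h k))` of continuous families of operators, as a
continuous bilinear map. -/
def pointwiseApply : (K →ᵇ (E →L[ℝ] F)) →L[ℝ] (K →ᵇ E) →L[ℝ] (K →ᵇ F) :=
  LinearMap.mkContinuous₂
    (LinearMap.mk₂ ℝ (fun (A : K →ᵇ (E →L[ℝ] F)) (h : K →ᵇ E) =>
      (mkOfCompact ⟨fun k => A k (h k), A.continuous.clm_apply h.continuous⟩ : K →ᵇ F))
      (fun _ _ _ => by ext; simp) (fun _ _ _ => by ext; simp)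
      (fun _ _ _ => by ext; simp) (fun _ _ _ => by ext; simp)) 1
    (fun A h => by
      rw [one_mul]
      refine (norm_le (by positivity)).2 fun k => ?_
      exact ((A k).le_opNorm _).trans
        (mul_le_mul (A.norm_coe_le_norm k) (h.norm_coe_le_norm k) (norm_nonneg _) (norm_nonneg A)))

lemma pointwiseApply_apply (A : K →ᵇ (E →L[ℝ] F)) (h : K →ᵇ E) (k : K) :
    pointwiseApply K E F A h k = A k (h k) := rfl

lemma norm_pointwiseApply_le (A : K →ᵇ (E →L[ℝ] F)) : ‖pointwiseApply K E F A‖ ≤ ‖A‖ := by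
  refine ContinuousLinearMap.opNorm_le_bound _ (norm_nonneg A) fun h => ?_
  refine (norm_le (by positivity)).2 fun k => ?_
  exact ((A k).le_opNorm _).trans
    (mul_le_mul (A.norm_coe_le_norm k) (h.norm_coe_le_norm k) (norm_nonneg _) (norm_nonneg A))

/-- The superposition operator of a function with Lipschitz derivative is differentiable, the
derivative being the pointwise application of the derivative. -/
lemma hasFDerivAt_superposition {f : E → F} {f' : E → E →L[ℝ] F} {C : ℝ≥0}
    (hf : ∀ x, HasFDerivAt f (f' x) x) (hC : LipschitzWith C f') (hf0 : Continuous f)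
    (γ : K →ᵇ E) :
    HasFDerivAt (superposition f hf0 : (K →ᵇ E) → (K →ᵇ F))
      (pointwiseApply K E F (superposition f' hC.continuous γ)) γ := by
  have key : ∀ η : K →ᵇ E, ‖superposition f hf0 η - superposition f hf0 γ -
      pointwiseApply K E F (superposition f' hC.continuous γ) (η - γ)‖ ≤ C * ‖η - γ‖ * ‖η - γ‖ := by
    intro η
    refine (norm_le (by positivity)).2 fun k => ?_
    have hk : ‖η k - γ k‖ ≤ ‖η - γ‖ := (η - γ).norm_coe_le_norm k
    have := (convex_closedBall (γ k) ‖η - γ‖).norm_image_sub_le_of_norm_hasFDerivWithin_le'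
      (f := f) (f' := fun x => f' x) (φ := f' (γ k)) (C := C * ‖η - γ‖)
      (x := γ k) (y := η k)
      (fun x _ => (hf x).hasFDerivWithinAt)
      (fun x hx => by
        rw [← dist_eq_norm]
        refine (hC.dist_le_mul x (γ k)).trans ?_
        gcongr
        simpa using hx)
      (by simp) (by simpa [dist_eq_norm] using hk)
    simp only [superposition_apply, BoundedContinuousFunction.sub_apply, pointwiseApply_apply] at this ⊢
    exact this.trans (by gcongr)
  rw [hasFDerivAt_iff_isLittleO]
  refine Asymptotics.isLittleO_iff.2 fun c hc => ?_
  have hball : Metric.ball γ (c / (C + 1)) ∈ 𝓝 γ := Metric.ball_mem_nhds _ (by positivity)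
  filter_upwards [hball] with η hη
  refine (key η).trans ?_
  gcongr
  rw [Metric.mem_ball, dist_eq_norm, lt_div_iff₀ (by positivity)] at hη
  nlinarith [norm_nonneg (η - γ)]

end Superposition

section Flow

set_option synthInstance.maxHeartbeats 100000

universe u

variable {K : Type} [TopologicalSpace K] [CompactSpace K]

/-- The superposition operator of a compactly supported smooth function is smooth. By induction on
the order, as its derivative is given by the superposition operator of the derivative of `f`. -/
lemma contDiff_superposition (n : ℕ) : ∀ {E F : Type u} [NormedAddCommGroup E] [NormedSpace ℝ E]
    [NormedAddCommGroup F] [NormedSpace ℝ F] (f : E → F) (hf : ContDiff ℝ ∞ f),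
    HasCompactSupport f →
    ContDiff ℝ n (superposition f hf.continuous : (K →ᵇ E) → (K →ᵇ F)) := by
  induction n with
  | zero =>
    intro E F _ _ _ _ f hf hc
    obtain ⟨C, hC⟩ := (hf.fderiv_right (m := ∞) (by simp)).lipschitzWith_of_hasCompactSupport
      (hc.fderiv ℝ) (by simp)
    exact contDiff_zero.2 <| continuous_iff_continuousAt.2 fun γ => (hasFDerivAt_superposition
      (fun x => (hf.differentiable (by simp) x).hasFDerivAt) hC hf.continuous γ).continuousAt
  | succ n ih =>
    intro E F _ _ _ _ f hf hc
    have hf' : ContDiff ℝ ∞ (fderiv ℝ f) := hf.fderiv_right (by simp)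
    have hc' : HasCompactSupport (fderiv ℝ f) := hc.fderiv ℝ
    obtain ⟨C, hC⟩ := hf'.lipschitzWith_of_hasCompactSupport hc' (by simp)
    have hd := fun γ : K →ᵇ E => hasFDerivAt_superposition
      (fun x => (hf.differentiable (by simp) x).hasFDerivAt) hC hf.continuous γ
    have hfd : fderiv ℝ (superposition f hf.continuous : (K →ᵇ E) → (K →ᵇ F)) =
        fun γ => pointwiseApply K E F (superposition (fderiv ℝ f) hC.continuous γ) :=
      funext fun γ => (hd γ).fderiv
    push_cast
    rw [contDiff_succ_iff_fderiv]
    refine ⟨fun γ => (hd γ).differentiableAt, by simp, ?_⟩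
    rw [hfd]
    exact (pointwiseApply K E F).contDiff.comp (ih (fderiv ℝ f) hf' hc')

variable {E : Type u} [NormedAddCommGroup E] [NormedSpace ℝ E]

variable (E) in
/-- The Volterra operator `h ↦ (τ ↦ ∫₀^τ h)` on continuous functions on `[0, 1]`. -/
def volterra : (Icc (0 : ℝ) 1 →ᵇ E) →L[ℝ] (Icc (0 : ℝ) 1 →ᵇ E) :=
  LinearMap.mkContinuous
    { toFun := fun h => mkOfCompact ⟨fun τ => ∫ s in (0 : ℝ)..τ, IccExtend zero_le_one h s, by
        exact (intervalIntegral.continuous_primitive (fun a b =>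
          (h.continuous.Icc_extend' (h := zero_le_one)).intervalIntegrable a b) 0).comp
            continuous_subtype_val⟩
      map_add' := fun h k => by
        ext τ
        exact intervalIntegral.integral_add
          ((h.continuous.Icc_extend' (h := zero_le_one)).intervalIntegrable _ _)
          ((k.continuous.Icc_extend' (h := zero_le_one)).intervalIntegrable _ _)
      map_smul' := fun c h => by
        ext τ
        exact intervalIntegral.integral_smul c _ } 1
    (fun h => by
      refine (norm_le (by positivity)).2 fun τ => ?_
      have := intervalIntegral.norm_integral_le_of_norm_le_const (a := (0 : ℝ)) (b := τ)
        (f := IccExtend zero_le_one h) (C := ‖h‖) (fun x _ => h.norm_coe_le_norm _)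
      refine this.trans ?_
      rw [one_mul, sub_zero, abs_of_nonneg τ.2.1]
      exact mul_le_of_le_one_right (norm_nonneg _) τ.2.2)

lemma volterra_apply (h : (Icc (0 : ℝ) 1 →ᵇ E)) (τ : Icc (0 : ℝ) 1) :
    volterra E h τ = ∫ s in (0 : ℝ)..τ, IccExtend zero_le_one h s := rfl

lemma norm_volterra_le : ‖volterra E‖ ≤ 1 := LinearMap.mkContinuous_norm_le _ zero_le_one _

variable (E) in
/-- Constant functions on `[0, 1]`. -/
def constCLM : E →L[ℝ] (Icc (0 : ℝ) 1 →ᵇ E) :=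
  LinearMap.mkContinuous
    { toFun := fun x => const _ x
      map_add' := fun _ _ => rfl
      map_smul' := fun _ _ => rfl } 1
    (fun x => (norm_le (by positivity)).2 fun _ => (one_mul ‖x‖).ge)

lemma constCLM_apply (x : E) (τ : Icc (0 : ℝ) 1) : constCLM E x τ = x := rfl

/-- The operator whose zeros are the solutions, rescaled to the time interval `[0, 1]`, of the
equation `γ' = f γ` with `γ 0 = x` up to the time `s`. -/
def odeOperator (f : E → E) (hf : Continuous f) (p : (E × ℝ) × (Icc (0 : ℝ) 1 →ᵇ E)) : (Icc (0 : ℝ) 1 →ᵇ E) :=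
  p.2 - constCLM E p.1.1 - p.1.2 • volterra E (superposition f hf p.2)

lemma contDiff_odeOperator {f : E → E} (hf : ContDiff ℝ ∞ f) (hc : HasCompactSupport f) :
    ContDiff ℝ ∞ (odeOperator f hf.continuous) := by
  have h : ContDiff ℝ ∞ (superposition f hf.continuous : (Icc (0 : ℝ) 1 →ᵇ E) → (Icc (0 : ℝ) 1 →ᵇ E)) :=
    contDiff_infty.2 fun n => contDiff_superposition n f hf hc
  unfold odeOperator
  have h1 := (volterra E).contDiff (n := ∞)
  have h2 := (constCLM E).contDiff (n := ∞)
  fun_prop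

variable [CompleteSpace E]

/-- A zero of the operator solves the differential equation, hence is the rescaling of any other
solution with the same initial value. -/
lemma eq_of_odeOperator_eq_zero {f : E → E} {C : ℝ≥0} (hC : LipschitzWith C f) {x : E} {s : ℝ}
    {γ : (Icc (0 : ℝ) 1 →ᵇ E)} (h0 : odeOperator f hC.continuous ((x, s), γ) = 0) {α : ℝ → E} (hα0 : α 0 = x)
    (hα : ∀ t ∈ Icc (0 : ℝ) 1, HasDerivAt α (f (α (s * t))) (s * t)) (τ : Icc (0 : ℝ) 1) :
    γ τ = α (s * τ) := by
  have hγ : ∀ τ, γ τ = x + s • ∫ u in (0 : ℝ)..τ, IccExtend zero_le_one (superposition f hC.continuous γ) u := by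
    intro τ
    have := DFunLike.congr_fun h0 τ
    simp only [odeOperator, BoundedContinuousFunction.sub_apply, BoundedContinuousFunction.smul_apply, constCLM_apply,
      volterra_apply, BoundedContinuousFunction.coe_zero, Pi.zero_apply] at this
    rw [sub_sub, sub_eq_zero] at this
    exact this
  set γ' : ℝ → E := fun t =>
    x + s • ∫ u in (0 : ℝ)..t, IccExtend zero_le_one (superposition f hC.continuous γ) u with hγ'
  have hcont : Continuous (IccExtend (zero_le_one (α := ℝ)) (superposition f hC.continuous γ)) :=
    (superposition f hC.continuous γ).continuous.Icc_extend'
  have hd' : ∀ t, HasDerivAt γ' (s • IccExtend zero_le_one (superposition f hC.continuous γ) t) t := fun t =>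
    ((hcont.integral_hasStrictDerivAt 0 t).hasDerivAt.const_smul s).const_add x
  have hd : ∀ t ∈ Icc (0 : ℝ) 1, HasDerivAt γ' (s • f (γ' t)) t := by
    intro t ht
    have := hd' t
    rw [IccExtend_of_mem _ _ ht] at this
    convert! this using 2
    exact congrArg f (hγ ⟨t, ht⟩).symm
  have hβ : ∀ t ∈ Icc (0 : ℝ) 1, HasDerivAt (fun t => α (s * t)) (s • f (α (s * t))) t := by
    intro t ht
    have := (hα t ht).scomp t ((hasDerivAt_id t).const_mul s)
    simpa [Function.comp_def] using this
  have := ODE_solution_unique (v := fun _ y => s • f y) (K := ‖s‖₊ * C) (f := γ')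
    (g := fun t => α (s * t)) (a := 0) (b := 1)
    (fun t => (lipschitzWith_smul s).comp hC)
    (fun t ht => (hd t ht).continuousAt.continuousWithinAt)
    (fun t ht => (hd t (Ico_subset_Icc_self ht)).hasDerivWithinAt)
    (fun t ht => (hβ t ht).continuousAt.continuousWithinAt)
    (fun t ht => (hβ t (Ico_subset_Icc_self ht)).hasDerivWithinAt)
    (by simp [hγ', hα0])
  rw [hγ τ]
  exact this τ.2

/-- A solution gives a zero of the operator. -/
lemma odeOperator_eq_zero {f : E → E} (hf : Continuous f) {x : E} {s : ℝ}
    {α : ℝ → E} (hα0 : α 0 = x)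
    (hα : ∀ t ∈ Icc (0 : ℝ) 1, HasDerivAt α (f (α (s * t))) (s * t)) {γ : (Icc (0 : ℝ) 1 →ᵇ E)}
    (hγ : ∀ τ, γ τ = α (s * τ)) : odeOperator f hf ((x, s), γ) = 0 := by
  have hβ : ∀ t ∈ Icc (0 : ℝ) 1, HasDerivAt (fun t => α (s * t)) (s • f (α (s * t))) t := by
    intro t ht
    have := (hα t ht).scomp t ((hasDerivAt_id t).const_mul s)
    simpa [Function.comp_def] using this
  have hcont : Continuous (IccExtend (zero_le_one (α := ℝ)) (superposition f hf γ)) :=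
    (superposition f hf γ).continuous.Icc_extend'
  ext τ
  have hsub : uIcc (0 : ℝ) τ ⊆ Icc 0 1 := by
    rw [uIcc_of_le τ.2.1]; exact Icc_subset_Icc_right τ.2.2
  have h1 := intervalIntegral.integral_eq_sub_of_hasDerivAt (a := (0 : ℝ)) (b := τ)
    (f := fun t => α (s * t)) (f' := fun t => s • IccExtend zero_le_one (superposition f hf γ) t)
    (fun t ht => by
      rw [IccExtend_of_mem _ _ (hsub ht)]
      have := hβ t (hsub ht)
      rw [← hγ ⟨t, hsub ht⟩] at this
      exact this)
    ((hcont.const_smul s).intervalIntegrable _ _)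
  rw [intervalIntegral.integral_smul] at h1
  simp only [odeOperator, BoundedContinuousFunction.sub_apply, BoundedContinuousFunction.smul_apply, constCLM_apply,
      volterra_apply, BoundedContinuousFunction.coe_zero, Pi.zero_apply]
  rw [h1, hγ τ]
  simp [hα0]

/-- If every solution near `x₀` exists for a uniform time, then the local flow of a compactly
supported smooth vector field is smooth. -/
lemma contDiffAt_flow_of_hasCompactSupport {f : E → E} (hf : ContDiff ℝ ∞ f)
    (hc : HasCompactSupport f) {C : ℝ≥0} (hC : LipschitzWith C f) {W : Set E} (hW : IsOpen W)
    {ε : ℝ} {Φ : E → ℝ → E} (h0 : ∀ x ∈ W, Φ x 0 = x)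
    (hΦ : ∀ x ∈ W, ∀ t ∈ Ioo (-ε) ε, HasDerivAt (Φ x) (f (Φ x t)) t) {x : E} (hx : x ∈ W)
    {s : ℝ} (hs : s ∈ Ioo (-ε) ε) (hsC : |s| * C < 1) :
    ContDiffAt ℝ ∞ (fun p : E × ℝ => Φ p.1 p.2) (x, s) := by
  have hmul : ∀ s ∈ Ioo (-ε) ε, ∀ t ∈ Icc (0 : ℝ) 1, s * t ∈ Ioo (-ε) ε := by
    intro s hs t ht
    have : |s * t| < ε := by
      rw [abs_mul, abs_of_nonneg ht.1]
      exact (mul_le_of_le_one_right (abs_nonneg _) ht.2).trans_lt (abs_lt.2 hs)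
    exact abs_lt.1 this
  let γ : (Icc (0 : ℝ) 1 →ᵇ E) := mkOfCompact ⟨fun τ => Φ x (s * τ), by
    have : ContinuousOn (fun t => Φ x (s * t)) (Icc 0 1) := fun t ht =>
      ((hΦ x hx _ (hmul s hs t ht)).continuousAt.comp
        (f := fun t => s * t) (by fun_prop)).continuousWithinAt
    exact this.comp_continuous continuous_subtype_val fun τ => τ.2⟩
  have hsol : odeOperator f hf.continuous ((x, s), γ) = 0 :=
    odeOperator_eq_zero hf.continuous (h0 x hx) (fun t ht => hΦ x hx _ (hmul s hs t ht)) fun _ => rfl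
  have hG := (contDiff_odeOperator hf hc).contDiffAt (x := ((x, s), γ))
  -- the partial derivative in the direction of the curve is a small perturbation of the identity
  obtain ⟨C', hC'⟩ := (hf.fderiv_right (m := ∞) (by simp)).lipschitzWith_of_hasCompactSupport
    (hc.fderiv ℝ) (by simp)
  let B : (Icc (0 : ℝ) 1 →ᵇ E) →L[ℝ] (Icc (0 : ℝ) 1 →ᵇ E) :=
    s • (volterra E ∘L pointwiseApply _ E E (superposition (fderiv ℝ f) hC'.continuous γ))
  have hpart : fderiv ℝ (odeOperator f hf.continuous) ((x, s), γ) ∘L .inr ℝ (E × ℝ) (Icc (0 : ℝ) 1 →ᵇ E) =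
      1 - B := by
    have h1 := (hG.differentiableAt (by simp)).hasFDerivAt.comp γ
      (hasFDerivAt_prodMk_right (𝕜 := ℝ) (x, s) γ)
    have h2 : HasFDerivAt (fun η => odeOperator f hf.continuous ((x, s), η)) (1 - B) γ := by
      have hsup := hasFDerivAt_superposition
        (fun x => (hf.differentiable (by simp) x).hasFDerivAt) hC' hf.continuous γ
      exact ((hasFDerivAt_id γ).sub_const (constCLM E x)).sub
        (((volterra E).hasFDerivAt.comp γ hsup).const_smul s)
    exact h1.unique h2
  have hB : ‖B‖ < 1 := by
    have hf'C : ‖superposition (fderiv ℝ f) hC'.continuous γ‖ ≤ C :=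
      (norm_le C.2).2 fun k => norm_fderiv_le_of_lipschitz ℝ hC
    calc ‖B‖ ≤ |s| * (1 * C) := by
          refine (ContinuousLinearMap.opNorm_smul_le _ _).trans ?_
          rw [Real.norm_eq_abs]
          gcongr
          exact (ContinuousLinearMap.opNorm_comp_le _ _).trans (mul_le_mul norm_volterra_le
            ((norm_pointwiseApply_le _).trans hf'C) (norm_nonneg _) zero_le_one)
      _ < 1 := by rwa [one_mul]
  have hinv : (fderiv ℝ (odeOperator f hf.continuous) ((x, s), γ) ∘L
      .inr ℝ (E × ℝ) (Icc (0 : ℝ) 1 →ᵇ E)).IsInvertible := by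
    rw [hpart]
    obtain ⟨e, he⟩ := isUnit_one_sub_of_norm_lt_one (R := (Icc (0 : ℝ) 1 →ᵇ E) →L[ℝ] (Icc (0 : ℝ) 1 →ᵇ E)) hB
    exact ⟨ContinuousLinearEquiv.unitsEquiv ℝ _ e, he⟩
  have hψ := hG.contDiffAt_implicitFunction (by simp) hinv
  have hzero := hG.eventually_apply_implicitFunction (by simp) hinv
  set ψ := hG.implicitFunction (by simp) hinv
  have hev : ContDiffAt ℝ ∞ (fun p => ψ p ⟨1, by simp⟩) (x, s) :=
    (evalCLM ℝ (β := E) (⟨1, by simp⟩ : Icc (0 : ℝ) 1)).contDiff.contDiffAt.comp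
      (x, s) hψ
  refine hev.congr_of_eventuallyEq ?_
  have hnear : ∀ᶠ p : E × ℝ in 𝓝 (x, s), p.1 ∈ W ∧ p.2 ∈ Ioo (-ε) ε :=
    (hW.prod isOpen_Ioo).mem_nhds ⟨hx, hs⟩
  filter_upwards [hzero, hnear] with p hp hpW
  rw [hsol] at hp
  have := eq_of_odeOperator_eq_zero hC (γ := ψ p) hp (h0 p.1 hpW.1)
    (fun t ht => hΦ p.1 hpW.1 _ (hmul _ hpW.2 t ht)) ⟨1, by simp⟩
  simpa using this.symm

/-- A smooth vector field on an open subset of a finite-dimensional space has a smooth local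
flow. It is the flow of the product of the field with a bump function, for times so short that
the solutions remain where the bump function is one. -/
theorem exists_smooth_local_flow [FiniteDimensional ℝ E] {f : E → E} {U : Set E} (hU : IsOpen U)
    (hf : ContDiffOn ℝ ∞ f U) {x₀ : E} (hx₀ : x₀ ∈ U) :
    ∃ ε > 0, ∃ Φ : E → ℝ → E,
      ContDiffOn ℝ ∞ (fun p : E × ℝ => Φ p.1 p.2) (Metric.ball x₀ ε ×ˢ Ioo (-ε) ε) ∧
      (∀ x ∈ Metric.ball x₀ ε, Φ x 0 = x) ∧
      ∀ x ∈ Metric.ball x₀ ε, ∀ t ∈ Ioo (-ε) ε,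
        Φ x t ∈ U ∧ HasDerivAt (Φ x) (f (Φ x t)) t := by
  obtain ⟨R, hR, hRU⟩ := Metric.isOpen_iff.1 hU x₀ hx₀
  let φ : ContDiffBump x₀ := ⟨R / 4, R / 2, by positivity, by linarith⟩
  have hφU : tsupport φ ⊆ U := by
    rw [φ.tsupport_eq]
    exact (Metric.closedBall_subset_ball (show R / 2 < R by linarith)).trans hRU
  have hF : ContDiff ℝ ∞ (fun x => φ x • f x) := by
    refine contDiff_iff_contDiffAt.2 fun x => ?_
    by_cases hx : x ∈ tsupport φ
    · exact φ.contDiff.contDiffAt.smul (hf.contDiffAt (hU.mem_nhds (hφU hx)))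
    · have : (fun x => φ x • f x) =ᶠ[𝓝 x] fun _ => 0 := by
        filter_upwards [(isClosed_tsupport _).isOpen_compl.mem_nhds hx] with y hy
        rw [image_eq_zero_of_notMem_tsupport hy, zero_smul]
      exact contDiffAt_const.congr_of_eventuallyEq this
  let F : E → E := fun x => φ x • f x
  have hFc : HasCompactSupport F := φ.hasCompactSupport.smul_right
  obtain ⟨C, hC⟩ := hF.lipschitzWith_of_hasCompactSupport hFc (by simp)
  obtain ⟨r, hr, ε, hε, H⟩ :=
    (hF.contDiffAt (x := x₀)).of_le (m := 1) (by simp)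
      |>.exists_forall_mem_closedBall_exists_eq_forall_mem_Ioo_hasDerivAt 0
  have H' : ∀ x : E, ∃ α : ℝ → E, x ∈ Metric.closedBall x₀ r → α 0 = x ∧
      ∀ t ∈ Ioo (0 - ε) (0 + ε), HasDerivAt α (φ (α t) • f (α t)) t := by
    intro x
    by_cases hx : x ∈ Metric.closedBall x₀ r
    · obtain ⟨α, hα⟩ := H x hx
      exact ⟨α, fun _ => hα⟩
    · exact ⟨fun _ => 0, fun h => absurd h hx⟩
  choose Φ hΦ using H'
  set ε₁ : ℝ := min ε (1 / (C + 1)) with hε₁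
  have hε₁0 : 0 < ε₁ := lt_min hε (by positivity)
  have hsm : ∀ x ∈ Metric.ball x₀ r, ∀ s ∈ Ioo (-ε₁) ε₁,
      ContDiffAt ℝ ∞ (fun p : E × ℝ => Φ p.1 p.2) (x, s) := by
    intro x hx s hs
    refine contDiffAt_flow_of_hasCompactSupport (f := F) hF hFc hC Metric.isOpen_ball (ε := ε)
      (fun x hx => (hΦ x (Metric.ball_subset_closedBall hx)).1)
      (fun x hx t ht => (hΦ x (Metric.ball_subset_closedBall hx)).2 t (by simpa using ht)) hx
      ⟨by linarith [hs.1, min_le_left ε (1 / ((C : ℝ) + 1))],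
        by linarith [hs.2, min_le_left ε (1 / ((C : ℝ) + 1))]⟩ ?_
    have hs1 : |s| < 1 / (C + 1) := (abs_lt.2 hs).trans_le (min_le_right _ _)
    rw [lt_div_iff₀ (by positivity)] at hs1
    nlinarith [abs_nonneg s]
  have hx₀r : x₀ ∈ Metric.ball x₀ r := Metric.mem_ball_self hr
  have hcont := (hsm x₀ hx₀r 0 ⟨by linarith, hε₁0⟩).continuousAt
  have hnhds : ∀ᶠ p : E × ℝ in 𝓝 (x₀, 0), Φ p.1 p.2 ∈ Metric.ball x₀ (R / 4) := by
    refine hcont ?_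
    change _ ∈ 𝓝 (Φ x₀ 0)
    rw [(hΦ x₀ (Metric.ball_subset_closedBall hx₀r)).1]
    exact Metric.ball_mem_nhds _ (by positivity)
  obtain ⟨ε₂, hε₂, h2⟩ := Metric.eventually_nhds_iff_ball.1 hnhds
  have hmin : 0 < min ε₁ (min ε₂ r) := lt_min hε₁0 (lt_min hε₂ hr)
  have hlr : min ε₁ (min ε₂ r) ≤ r := (min_le_right _ _).trans (min_le_right _ _)
  have hl2 : min ε₁ (min ε₂ r) ≤ ε₂ := (min_le_right _ _).trans (min_le_left _ _)
  have hl1 : min ε₁ (min ε₂ r) ≤ ε₁ := min_le_left _ _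
  refine ⟨min ε₁ (min ε₂ r), hmin, Φ, ?_, ?_, ?_⟩
  · rintro ⟨x, s⟩ ⟨hx, hs⟩
    exact (hsm x (Metric.ball_subset_ball hlr hx) s
      (Ioo_subset_Ioo (neg_le_neg hl1) hl1 hs)).contDiffWithinAt
  · intro x hx
    exact (hΦ x (Metric.ball_subset_closedBall (Metric.ball_subset_ball hlr hx))).1
  · intro x hx t ht
    have hin : Φ x t ∈ Metric.ball x₀ (R / 4) := by
      refine h2 (x, t) ?_
      rw [← ball_prod_same]
      refine ⟨Metric.ball_subset_ball hl2 hx, ?_⟩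
      rw [Real.ball_eq_Ioo]
      exact ⟨by linarith [ht.1], by linarith [ht.2]⟩
    refine ⟨hRU (Metric.ball_subset_ball (by linarith) hin), ?_⟩
    have := (hΦ x (Metric.ball_subset_closedBall (Metric.ball_subset_ball hlr hx))).2 t
      ⟨by linarith [ht.1, min_le_left ε (1 / ((C : ℝ) + 1))],
        by linarith [ht.2, min_le_left ε (1 / ((C : ℝ) + 1))]⟩
    rwa [φ.one_of_mem_closedBall (Metric.ball_subset_closedBall hin), one_smul] at this

end Flow

/-! ### Vector fields in charts and local flows on manifolds -/

section Fields

variable {H : Type*} [TopologicalSpace H] {I : ModelWithCorners ℝ E3 H}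
  {M : Type*} [TopologicalSpace M] [ChartedSpace H M] [IsManifold I ∞ M]

variable (I) in
/-- The components of the vector field `v` in the preferred chart at `p`, as a function on the
target of the chart. -/
def fieldInChart (v : ∀ p : M, TangentSpace I p) (p : M) (y : E3) : E3 :=
  tangentCoordChange I ((extChartAt I p).symm y) p ((extChartAt I p).symm y)
    (v ((extChartAt I p).symm y))

lemma trivializationAt_snd (p : M) (w : TangentBundle I M) :
    (trivializationAt E3 (TangentSpace I) p w).2 = tangentCoordChange I w.1 p w.1 w.2 := rfl

lemma contDiffOn_fieldInChart {v : ∀ p : M, TangentSpace I p} {V : Set M}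
    (hv : IsSmoothVectorFieldOn I v V) (p : M) :
    ContDiffOn ℝ ∞ (fieldInChart I v p)
      ((extChartAt I p).target ∩ (extChartAt I p).symm ⁻¹' V) := by
  have h1 : ContMDiffOn I 𝓘(ℝ, E3) ∞
      (fun q => (trivializationAt E3 (TangentSpace I) p ⟨q, v q⟩).2)
      (V ∩ (chartAt H p).source) :=
    ((Bundle.Trivialization.contMDiffOn_iff (n := ∞) (IM := I) (IB := I)
      (e := trivializationAt E3 (TangentSpace I) p) (f := fun q => (⟨q, v q⟩ : TangentBundle I M))
      (fun q hq => by
        rw [TangentBundle.trivializationAt_source]; exact hq.2)).1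
      (hv.mono inter_subset_left)).2
  have h2 := h1.comp ((contMDiffOn_extChartAt_symm (I := I) (n := ∞) p).mono
    (inter_subset_left (t := (extChartAt I p).symm ⁻¹' V))) (fun y hy => ⟨hy.2, by
      simpa using (extChartAt I p).map_target hy.1⟩)
  exact contMDiffOn_iff_contDiffOn.1 h2

lemma contMDiffAt_of_fieldInChart {v : ∀ p : M, TangentSpace I p} {q : M}
    (h : ContDiffWithinAt ℝ ∞ (fieldInChart I v q) (range I) (extChartAt I q q)) :
    ContMDiffAt I I.tangent ∞ (fun p => (⟨p, v p⟩ : TangentBundle I M)) q := by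
  refine (Bundle.contMDiffAt_section q).2 ?_
  rw [contMDiffAt_iff]
  constructor
  · have h1 : ContinuousWithinAt (fieldInChart I v q) (range I) (extChartAt I q q) :=
      h.continuousWithinAt
    have h2 : Tendsto (extChartAt I q) (𝓝 q) (𝓝[range I] (extChartAt I q q)) :=
      tendsto_nhdsWithin_iff.2 ⟨continuousAt_extChartAt (I := I) q,
        Eventually.of_forall fun x => mem_range_self _⟩
    have h3 : Tendsto (fun x => fieldInChart I v q (extChartAt I q x)) (𝓝 q)
        (𝓝 (fieldInChart I v q (extChartAt I q q))) := h1.tendsto.comp h2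
    have h4 : ∀ x ∈ (extChartAt I q).source, fieldInChart I v q (extChartAt I q x) =
        (trivializationAt E3 (TangentSpace I) q ⟨x, v x⟩).2 := by
      intro x hx
      rw [trivializationAt_snd]
      unfold fieldInChart
      rw [(extChartAt I q).left_inv hx]
    rw [ContinuousAt, ← h4 q (mem_extChartAt_source q)]
    refine h3.congr' ?_
    filter_upwards [extChartAt_source_mem_nhds (I := I) q] with x hx using h4 x hx
  · exact h

lemma contDiffWithinAt_fieldInChart {v : ∀ p : M, TangentSpace I p} {q : M}
    (h : ContMDiffAt I I.tangent ∞ (fun p => (⟨p, v p⟩ : TangentBundle I M)) q) :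
    ContDiffWithinAt ℝ ∞ (fieldInChart I v q) (range I) (extChartAt I q q) := by
  have := (Bundle.contMDiffAt_section q).1 h
  rw [contMDiffAt_iff] at this
  exact this.2

lemma hasDerivAt_comp_integralCurve {v : ∀ p : M, TangentSpace I p} {γ : ℝ → M} {t : ℝ}
    (hγ : HasMFDerivAt 𝓘(ℝ, ℝ) I γ t ((1 : ℝ →L[ℝ] ℝ).smulRight (v (γ t)))) {f : M → ℝ}
    (hf : MDifferentiableAt I 𝓘(ℝ, ℝ) f (γ t)) :
    HasDerivAt (fun s => f (γ s)) (mfderiv I 𝓘(ℝ, ℝ) f (γ t) (v (γ t)) : ℝ) t := by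
  obtain ⟨L, hL, hL1⟩ : ∃ L : ℝ →L[ℝ] ℝ, HasFDerivAt (fun s => f (γ s)) L t ∧
      L 1 = mfderiv I 𝓘(ℝ, ℝ) f (γ t) (v (γ t)) := by
    refine ⟨_, (hf.hasMFDerivAt.comp t hγ).hasFDerivAt, ?_⟩
    change mfderiv I 𝓘(ℝ, ℝ) f (γ t) ((1 : ℝ) • v (γ t)) = _
    rw [one_smul]
  rw [← hL1]
  exact hL.hasDerivAt

lemma continuousOn_mfderiv_apply {v : ∀ p : M, TangentSpace I p} {V : Set M} (hV : IsOpen V)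
    (hv : ContinuousOn (fun p => (⟨p, v p⟩ : TangentBundle I M)) V) {f : M → ℝ}
    (hf : ContMDiffOn I 𝓘(ℝ, ℝ) ∞ f V) :
    ContinuousOn (fun q => (mfderiv I 𝓘(ℝ, ℝ) f q (v q) : ℝ)) V := by
  have h1 := hf.continuousOn_tangentMapWithin (by simp) hV.uniqueMDiffOn
  have h2 := h1.comp hv (fun q hq => hq)
  have h3 : Continuous (fun w : TangentBundle 𝓘(ℝ, ℝ) ℝ => (w.2 : ℝ)) :=
    (contMDiff_snd_tangentBundle_modelSpace ℝ 𝓘(ℝ, ℝ) (n := ∞)).continuous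
  refine (h3.comp_continuousOn h2).congr fun q hq => ?_
  change (mfderiv I 𝓘(ℝ, ℝ) f q (v q) : ℝ) = mfderivWithin I 𝓘(ℝ, ℝ) f V q (v q)
  rw [mfderivWithin_of_isOpen hV hq]

/-- A smooth family of multiples of a smooth vector field, along a smooth map. -/
lemma contMDiffAt_smul_comp {X : ∀ p : M, TangentSpace I p} {N : Type*} [TopologicalSpace N]
    {E' : Type*} [NormedAddCommGroup E'] [NormedSpace ℝ E'] {H' : Type*} [TopologicalSpace H']
    {J : ModelWithCorners ℝ E' H'} [ChartedSpace H' N] {F : N → M} {c : N → ℝ} {x : N}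
    (hX : ContMDiffAt I I.tangent ∞ (fun p => (⟨p, X p⟩ : TangentBundle I M)) (F x))
    (hF : ContMDiffAt J I ∞ F x) (hc : ContMDiffAt J 𝓘(ℝ, ℝ) ∞ c x) :
    ContMDiffAt J I.tangent ∞ (fun y => (⟨F y, c y • X (F y)⟩ : TangentBundle I M)) x := by
  have h1 : ContMDiffAt J I.tangent ∞ (fun y => (⟨F y, X (F y)⟩ : TangentBundle I M)) x :=
    ContMDiffAt.comp x hX hF
  have h2 := (Bundle.contMDiffAt_totalSpace.1 h1).2
  refine Bundle.contMDiffAt_totalSpace.2 ⟨hF, ?_⟩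
  refine (hc.smul h2).congr_of_eventuallyEq (Eventually.of_forall fun y => ?_)
  exact map_smul (tangentCoordChange I (F y) (F x) (F y)) (c y) (X (F y))

/-- Near a point where the vector field `X` does not vanish, the coefficient of a multiple of `X`
extends to a smooth function on the tangent bundle. -/
lemma exists_smooth_coefficient {X : ∀ p : M, TangentSpace I p} {p : M}
    (hX : ContMDiffAt I I.tangent ∞ (fun p => (⟨p, X p⟩ : TangentBundle I M)) p)
    (hXp : X p ≠ 0) (w : TangentSpace I p) :
    ∃ κ : TangentBundle I M → ℝ, ContMDiffAt I.tangent 𝓘(ℝ, ℝ) ∞ κ ⟨p, w⟩ ∧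
      ∃ W ∈ 𝓝 p, ∀ q ∈ W, ∀ c : ℝ, κ ⟨q, c • X q⟩ = c := by
  set τ := trivializationAt E3 (TangentSpace I : M → Type _) p
  set A : M → E3 := fun q => (τ ⟨q, X q⟩).2 with hA
  have hAs : ContMDiffAt I 𝓘(ℝ, E3) ∞ A p := (Bundle.contMDiffAt_section p).1 hX
  have hAp : A p ≠ 0 := by
    have : A p = X p := tangentCoordChange_self (I := I) (mem_extChartAt_source p)
    rw [this]; exact hXp
  have hAw : ContMDiffAt I.tangent 𝓘(ℝ, E3) ∞ (fun w : TangentBundle I M => A w.1) ⟨p, w⟩ :=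
    ContMDiffAt.comp (x := (⟨p, w⟩ : TangentBundle I M)) (g := A)
      (f := fun w : TangentBundle I M => w.1) hAs (Bundle.contMDiffAt_proj _)
  have hτ : ContMDiffAt I.tangent 𝓘(ℝ, E3) ∞ (fun w : TangentBundle I M => (τ w).2) ⟨p, w⟩ :=
    (Bundle.contMDiffAt_totalSpace.1
      (contMDiffAt_id (x := (⟨p, w⟩ : TangentBundle I M)) (I := I.tangent) (n := ∞))).2
  refine ⟨fun w => inner ℝ (A w.1) (τ w).2 / inner ℝ (A w.1) (A w.1), ?_, ?_⟩
  · have h1 : ContMDiffAt I.tangent (𝓘(ℝ, E3 × E3)) ∞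
        (fun w : TangentBundle I M => (A w.1, (τ w).2)) ⟨p, w⟩ := hAw.prodMk_space hτ
    have h2 : ContDiffAt ℝ ∞ (fun z : E3 × E3 => inner ℝ z.1 z.2 / inner ℝ z.1 z.1)
        (A p, (τ ⟨p, w⟩).2) := by
      refine ContDiffAt.div (contDiffAt_fst.inner ℝ contDiffAt_snd)
        (contDiffAt_fst.inner ℝ contDiffAt_fst) ?_
      simpa using hAp
    exact h2.contMDiffAt.comp (⟨p, w⟩ : TangentBundle I M) h1
  · refine ⟨_, hAs.continuousAt.eventually_ne hAp, fun q hq c => ?_⟩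
    have : (τ ⟨q, c • X q⟩).2 = c • A q := map_smul (tangentCoordChange I q p q) c (X q)
    have hne : inner ℝ (A q) (A q) ≠ 0 := by simpa using hq
    simp only [this, inner_smul_right]
    field_simp

/-- A smooth vector field has a smooth local flow near any interior point. -/
theorem exists_isLocalFlow {v : ∀ p : M, TangentSpace I p} {V : Set M} (hV : IsOpen V)
    (hv : IsSmoothVectorFieldOn I v V) {p : M} (hp : p ∈ V) (hpi : p ∈ I.interior M) :
    ∃ (W : Set M) (ε : ℝ) (Φ : M → ℝ → M), p ∈ W ∧ W ⊆ V ∧ IsLocalFlow I v V W ε Φ := by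
  set χ := extChartAt I p with hχ
  have hint : χ p ∈ interior χ.target := I.isInteriorPoint_iff.1 hpi
  set U : Set E3 := interior (χ.target ∩ χ.symm ⁻¹' V) with hU
  have hUsub : U ⊆ χ.target ∩ χ.symm ⁻¹' V := interior_subset
  have hpU : χ p ∈ U := by
    rw [hU, mem_interior_iff_mem_nhds]
    refine inter_mem (mem_interior_iff_mem_nhds.1 hint) ?_
    refine (continuousAt_extChartAt_symm p).preimage_mem_nhds ?_
    rw [extChartAt_to_inv]
    exact hV.mem_nhds hp
  obtain ⟨ε, hε, φ, hφs, hφ0, hφ⟩ := exists_smooth_local_flow isOpen_interior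
    ((contDiffOn_fieldInChart hv p).mono hUsub) hpU
  set W : Set M := χ.source ∩ χ ⁻¹' (Metric.ball (χ p) ε) with hW
  have hWo : IsOpen W := (continuousOn_extChartAt p).isOpen_inter_preimage
    (isOpen_extChartAt_source p) Metric.isOpen_ball
  have hflow : ∀ q ∈ W, ∀ t ∈ Ioo (-ε) ε, φ (χ q) t ∈ U := fun q hq t ht =>
    (hφ (χ q) hq.2 t ht).1
  refine ⟨W ∩ V, ε, fun q t => χ.symm (φ (χ q) t),
    ⟨⟨mem_extChartAt_source p, Metric.mem_ball_self hε⟩, hp⟩, inter_subset_right,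
    hWo.inter hV, hε, fun q hq t ht => (hUsub (hflow q hq.1 t ht)).2, ?_, ?_, ?_⟩
  · intro q hq
    change χ.symm (φ (χ q) 0) = q
    rw [hφ0 _ hq.1.2]
    exact χ.left_inv hq.1.1
  · intro q hq t ht
    have hUt := hflow q hq.1 t ht
    have h1 : HasDerivAt (φ (χ q)) (fieldInChart I v p (φ (χ q) t)) t :=
      (hφ (χ q) hq.1.2 t ht).2
    have htgt : φ (χ q) t ∈ χ.target := (hUsub hUt).1
    have h2 : HasMFDerivWithinAt 𝓘(ℝ, E3) I χ.symm (range I) (φ (χ q) t)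
        (mfderivWithin 𝓘(ℝ, E3) I χ.symm (range I) (φ (χ q) t)) :=
      (mdifferentiableWithinAt_extChartAt_symm htgt).hasMFDerivWithinAt
    have hnhds : range I ∈ 𝓝 (φ (χ q) t) := mem_of_superset
      (mem_interior_iff_mem_nhds.1 hUt) fun y hy => extChartAt_target_subset_range p hy.1
    have h3 := (h2.hasMFDerivAt hnhds).comp t h1.hasFDerivAt.hasMFDerivAt
    refine HasMFDerivAt.hasMFDerivWithinAt ?_
    refine h3.congr_mfderiv (ContinuousLinearMap.ext_ring ?_)
    set z := φ (χ q) t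
    have hz : χ.symm z ∈ (chartAt H p).source := by
      rw [← extChartAt_source I p]
      exact χ.map_target htgt
    have key : mfderivWithin 𝓘(ℝ, E3) I χ.symm (range I) z (fieldInChart I v p z) =
        v (χ.symm z) := by
      have e1 := TangentBundle.symmL_trivializationAt (I := I) hz
      rw [← hχ, χ.right_inv htgt] at e1
      have e2 := TangentBundle.symmL_trivializationAt_eq_core (I := I) hz
      rw [e1] at e2
      have e3 := DFunLike.congr_fun e2 (fieldInChart I v p z)
      refine e3.trans ?_
      have hz1 : χ.symm z ∈ (extChartAt I p).source := χ.map_target htgt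
      have hz2 : χ.symm z ∈ (extChartAt I (χ.symm z)).source := mem_extChartAt_source _
      exact (tangentCoordChange_comp (I := I) (w := χ.symm z) (x := p) (y := χ.symm z)
        ⟨⟨hz2, hz1⟩, hz2⟩).trans (tangentCoordChange_self (I := I) hz2)
    change mfderivWithin 𝓘(ℝ, E3) I χ.symm (range I) z ((1 : ℝ) • fieldInChart I v p z) =
      (1 : ℝ) • v (χ.symm z)
    rw [one_smul, one_smul, key]
  · have h1 : ContMDiffOn (I.prod 𝓘(ℝ, ℝ)) 𝓘(ℝ, E3 × ℝ) ∞ (fun x : M × ℝ => (χ x.1, x.2))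
        ((W ∩ V) ×ˢ Ioo (-ε) ε) := by
      refine ContMDiffOn.prodMk_space ?_ contMDiffOn_snd
      exact (contMDiffOn_extChartAt (x := p) (n := ∞)).comp contMDiffOn_fst
        fun x hx => by simpa [hχ] using hx.1.1.1
    have h2 := hφs.contMDiffOn.comp h1 (fun x hx => ⟨hx.1.1.2, hx.2⟩)
    exact (contMDiffOn_extChartAt_symm p).comp h2 fun x hx =>
      (hUsub (hflow x.1 hx.1.1 x.2 hx.2)).1

end Fields

/-! ### Trajectories of a field of line elements -/

section Trajectories

variable {H : Type*} [TopologicalSpace H] {I : ModelWithCorners ℝ E3 H}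
  {M : Type*} [TopologicalSpace M] [ChartedSpace H M] [IsManifold I ∞ M]

/-- Two continuous lifts to the tangent bundle which agree up to sign, and do not vanish, agree up
to a locally constant sign. -/
lemma eventually_eq_smul_of_eq_or_neg {X : Type*} [TopologicalSpace X] {x₀ : X} {b : X → M}
    {w₁ w₂ : ∀ x, TangentSpace I (b x)}
    (h₁ : ContinuousAt (fun x => (⟨b x, w₁ x⟩ : TangentBundle I M)) x₀)
    (h₂ : ContinuousAt (fun x => (⟨b x, w₂ x⟩ : TangentBundle I M)) x₀)
    (hne : w₂ x₀ ≠ 0) (h : ∀ᶠ x in 𝓝 x₀, w₁ x = w₂ x ∨ w₁ x = -w₂ x)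
    {σ : ℝ} (hσ : σ = 1 ∨ σ = -1) (h₀ : w₁ x₀ = σ • w₂ x₀) :
    ∀ᶠ x in 𝓝 x₀, w₁ x = σ • w₂ x := by
  set τ := trivializationAt E3 (TangentSpace I : M → Type _) (b x₀)
  have hc : ∀ {w : ∀ x, TangentSpace I (b x)},
      ContinuousAt (fun x => (⟨b x, w x⟩ : TangentBundle I M)) x₀ →
      ContinuousAt (fun x => (τ ⟨b x, w x⟩).2) x₀ := fun {w} hw =>
    ((FiberBundle.continuousAt_totalSpace E3 _).1 hw).2
  set A₁ : X → E3 := fun x => (τ ⟨b x, w₁ x⟩).2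
  set A₂ : X → E3 := fun x => (τ ⟨b x, w₂ x⟩).2
  have hA : ∀ x, ∀ c : ℝ, w₁ x = c • w₂ x → A₁ x = c • A₂ x := fun x c hx => by
    have : A₁ x = tangentCoordChange I (b x) (b x₀) (b x) (c • w₂ x) := by rw [← hx]; rfl
    rw [this]
    exact map_smul (tangentCoordChange I (b x) (b x₀) (b x)) c (w₂ x)
  have hA₂ : A₂ x₀ ≠ 0 := by
    have : A₂ x₀ = w₂ x₀ := tangentCoordChange_self (I := I) (mem_extChartAt_source (b x₀))
    rw [this]; exact hne
  have hlt : ∀ᶠ x in 𝓝 x₀, ‖A₁ x - σ • A₂ x‖ < ‖A₂ x‖ := by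
    refine (((hc h₁).sub ((hc h₂).const_smul σ)).norm).eventually_lt (hc h₂).norm ?_
    have : A₁ x₀ - σ • A₂ x₀ = 0 := by rw [hA x₀ σ h₀, sub_self]
    change ‖A₁ x₀ - σ • A₂ x₀‖ < ‖A₂ x₀‖
    rw [this, norm_zero]
    exact norm_pos_iff.2 hA₂
  filter_upwards [h, hlt] with x hx hxlt
  have key : ∀ c : ℝ, (c = 1 ∨ c = -1) → w₁ x = c • w₂ x → c = σ := by
    intro c hcc hcx
    by_contra hne
    rw [hA x c hcx, ← sub_smul, norm_smul] at hxlt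
    have : ‖c - σ‖ = 2 := by
      rcases hcc with rfl | rfl <;> rcases hσ with rfl | rfl <;> first | exact absurd rfl hne | norm_num
    rw [this] at hxlt
    linarith [norm_nonneg (A₂ x)]
  rcases hx with hx | hx
  · have h1 : w₁ x = (1 : ℝ) • w₂ x := by rw [one_smul]; exact hx
    rw [← key 1 (Or.inl rfl) h1]; exact h1
  · have h1 : w₁ x = (-1 : ℝ) • w₂ x := by rw [neg_one_smul]; exact hx
    rw [← key (-1) (Or.inr rfl) h1]; exact h1

/-- A nowhere vanishing smooth vector field `v` on the open set `V` representing the field of line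
elements `l` there. -/
structure IsDirector (l : LineElementField I M) (v : ∀ p : M, TangentSpace I p) (V : Set M) :
    Prop where
  isOpen : IsOpen V
  smooth : IsSmoothVectorFieldOn I v V
  elem_eq : ∀ q ∈ V, l.elem q = {v q, -v q}
  ne_zero : ∀ q ∈ V, v q ≠ 0

variable {l : LineElementField I M} {v : ∀ p : M, TangentSpace I p} {V : Set M}

lemma IsDirector.contMDiffAt (hv : IsDirector l v V) {q : M} (hq : q ∈ V) :
    ContMDiffAt I I.tangent ∞ (fun p => (⟨p, v p⟩ : TangentBundle I M)) q :=
  hv.smooth.contMDiffAt (hv.isOpen.mem_nhds hq)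

lemma IsDirector.eq_or_eq_neg (hv : IsDirector l v V) {q : M} (hq : q ∈ V) {w : TangentSpace I q}
    (hw : w ∈ l.elem q) : ∃ σ : ℝ, (σ = 1 ∨ σ = -1) ∧ w = σ • v q := by
  rw [hv.elem_eq q hq] at hw
  rcases hw with hw | hw
  · exact ⟨1, Or.inl rfl, by rw [one_smul]; exact hw⟩
  · exact ⟨-1, Or.inr rfl, by rw [neg_one_smul]; exact hw⟩

lemma neg_mem_elem {q : M} {w : TangentSpace I q} (hw : w ∈ l.elem q) : -w ∈ l.elem q := by
  obtain ⟨v, hv⟩ := l.exists_eq q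
  rw [hv] at hw ⊢
  rcases hw with hw | hw
  · right; rw [hw]; rfl
  · left; rw [hw, neg_neg]

lemma continuousOn_velocity {γ : ℝ → M} {a b : ℝ} (hγ : l.IsTrajectoryOn γ (Ioo a b)) :
    ContinuousOn (fun t => (⟨γ t, mfderiv 𝓘(ℝ, ℝ) I γ t (1 : ℝ)⟩ : TangentBundle I M))
      (Ioo a b) := by
  have h1 := hγ.1.continuousOn_tangentMapWithin le_rfl isOpen_Ioo.uniqueMDiffOn
  have h2 : Continuous (fun t : ℝ => (⟨t, (1 : ℝ)⟩ : TangentBundle 𝓘(ℝ, ℝ) ℝ)) := by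
    refine (tangentBundleModelSpaceHomeomorph 𝓘(ℝ, ℝ)).symm.continuous.comp
      (continuous_id.prodMk continuous_const)
  refine (h1.comp h2.continuousOn (fun t ht => ht)).congr fun t ht => ?_
  change (⟨γ t, mfderiv 𝓘(ℝ, ℝ) I γ t (1 : ℝ)⟩ : TangentBundle I M) =
    ⟨γ t, mfderivWithin 𝓘(ℝ, ℝ) I γ (Ioo a b) t (1 : ℝ)⟩
  rw [mfderivWithin_of_isOpen isOpen_Ioo ht]

/-- Where a trajectory meets the domain of a director, it is locally an integral curve of the
director or of its opposite. -/
lemma IsDirector.eventually_velocity_eq (hv : IsDirector l v V) {γ : ℝ → M} {a b t₀ : ℝ}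
    (hγ : l.IsTrajectoryOn γ (Ioo a b)) (ht₀ : t₀ ∈ Ioo a b) (hV : γ t₀ ∈ V) :
    ∃ σ : ℝ, (σ = 1 ∨ σ = -1) ∧
      ∀ᶠ t in 𝓝 t₀, mfderiv 𝓘(ℝ, ℝ) I γ t (1 : ℝ) = σ • v (γ t) := by
  have hJ : Ioo a b ∈ 𝓝 t₀ := Ioo_mem_nhds ht₀.1 ht₀.2
  have hcont : ContinuousAt γ t₀ := hγ.1.continuousOn.continuousAt hJ
  obtain ⟨σ, hσ, h0⟩ := hv.eq_or_eq_neg hV (hγ.2 t₀ ht₀)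
  refine ⟨σ, hσ, eventually_eq_smul_of_eq_or_neg (b := γ)
    (w₁ := fun t => mfderiv 𝓘(ℝ, ℝ) I γ t (1 : ℝ)) (w₂ := fun t => v (γ t))
    ((continuousOn_velocity hγ).continuousAt hJ) ?_ (hv.ne_zero _ hV) ?_ hσ h0⟩
  · exact ContinuousAt.comp (f := γ) (hv.contMDiffAt hV).continuousAt hcont
  · filter_upwards [hJ, hcont.preimage_mem_nhds (hv.isOpen.mem_nhds hV)] with t ht htV
    have := hγ.2 t ht
    rw [hv.elem_eq _ htV] at this
    exact this

lemma hasMFDerivAt_of_velocity_eq {γ : ℝ → M} {a b t : ℝ}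
    (hγ : l.IsTrajectoryOn γ (Ioo a b)) (ht : t ∈ Ioo a b) {w : TangentSpace I (γ t)}
    (h : mfderiv 𝓘(ℝ, ℝ) I γ t (1 : ℝ) = w) :
    HasMFDerivAt 𝓘(ℝ, ℝ) I γ t ((1 : ℝ →L[ℝ] ℝ).smulRight w) := by
  have h1 : MDifferentiableAt 𝓘(ℝ, ℝ) I γ t :=
    ((hγ.1 t ht).contMDiffAt (Ioo_mem_nhds ht.1 ht.2)).mdifferentiableAt one_ne_zero
  refine h1.hasMFDerivAt.congr_mfderiv (ContinuousLinearMap.ext_ring ?_)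
  refine h.trans ?_
  change w = (1 : ℝ) • w
  rw [one_smul]

/-- A trajectory with the same position and velocity as an integral curve of a director, at one
moment, coincides with it. -/
theorem IsDirector.eqOn_of_velocity_eq [T2Space M] (hv : IsDirector l v V)
    (hVi : V ⊆ I.interior M) {γ₁ γ₂ : ℝ → M} {a b c d t₀ : ℝ}
    (h₁ : IsMIntegralCurveOn γ₁ v (Ioo a b)) (h₁V : ∀ t ∈ Ioo a b, γ₁ t ∈ V)
    (h₂ : l.IsTrajectoryOn γ₂ (Ioo c d)) (ht₁ : t₀ ∈ Ioo a b) (ht₂ : t₀ ∈ Ioo c d)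
    (h0 : γ₁ t₀ = γ₂ t₀) (h0' : mfderiv 𝓘(ℝ, ℝ) I γ₂ t₀ (1 : ℝ) = v (γ₂ t₀)) :
    EqOn γ₁ γ₂ (Ioo a b ∩ Ioo c d) := by
  set J := Ioo a b ∩ Ioo c d with hJ
  have hJo : IsOpen J := isOpen_Ioo.inter isOpen_Ioo
  have hJc : IsPreconnected J := by
    rw [hJ, Ioo_inter_Ioo]; exact isPreconnected_Ioo
  set s := {t | t ∈ J ∧ γ₁ t = γ₂ t ∧ mfderiv 𝓘(ℝ, ℝ) I γ₂ t (1 : ℝ) = v (γ₂ t)} with hs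
  have hc1 : ∀ t ∈ J, ContinuousAt γ₁ t := fun t ht =>
    (h₁.continuousWithinAt ht.1).continuousAt (isOpen_Ioo.mem_nhds ht.1)
  have hc2 : ∀ t ∈ J, ContinuousAt γ₂ t := fun t ht =>
    h₂.1.continuousOn.continuousAt (isOpen_Ioo.mem_nhds ht.2)
  suffices J ⊆ s from fun t ht => (this ht).2.1
  refine hJc.subset_of_closure_inter_subset ?_ ⟨t₀, ⟨ht₁, ht₂⟩, ⟨ht₁, ht₂⟩, h0, h0'⟩ ?_
  · refine isOpen_iff_mem_nhds.2 fun t ht => ?_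
    have hVt : γ₂ t ∈ V := by rw [← ht.2.1]; exact h₁V t ht.1.1
    obtain ⟨σ, hσ, hev⟩ := hv.eventually_velocity_eq h₂ ht.1.2 hVt
    have hσ1 : σ = 1 := by
      have h3 := hev.self_of_nhds
      rw [ht.2.2] at h3
      have h4 : (1 - σ) • v (γ₂ t) = 0 := by rw [sub_smul, one_smul, ← h3, sub_self]
      rcases smul_eq_zero.1 h4 with h5 | h5
      · linarith
      · exact absurd h5 (hv.ne_zero _ hVt)
    subst hσ1
    have hcurve : IsMIntegralCurveAt γ₂ v t := by
      filter_upwards [hev, isOpen_Ioo.mem_nhds ht.1.2] with u hu huJ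
      exact hasMFDerivAt_of_velocity_eq h₂ huJ (by rw [hu, one_smul])
    have heq := isMIntegralCurveAt_eventuallyEq_of_contMDiffAt (I := I) (hVi (h₁V t ht.1.1))
      ((hv.contMDiffAt (h₁V t ht.1.1)).of_le (by simp))
      (h₁.isMIntegralCurveAt (isOpen_Ioo.mem_nhds ht.1.1)) hcurve ht.2.1
    filter_upwards [heq, hev, hJo.mem_nhds ht.1] with u hu1 hu2 hu3
    exact ⟨hu3, hu1, by rw [hu2, one_smul]⟩
  · rintro t ⟨htc, htJ⟩
    have hfreq : ∃ᶠ u in 𝓝 t, u ∈ s := mem_closure_iff_frequently.1 htc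
    have heq : γ₁ t = γ₂ t := by
      by_contra hne
      have : ∀ᶠ u in 𝓝 t, γ₁ u ≠ γ₂ u :=
        ((hc1 t htJ).prodMk (hc2 t htJ)).preimage_mem_nhds
          (isClosed_diagonal.isOpen_compl.mem_nhds (show (γ₁ t, γ₂ t) ∉ diagonal M from hne))
      obtain ⟨u, hu1, hu2⟩ := (hfreq.and_eventually this).exists
      exact hu2 hu1.2.1
    have hVt : γ₂ t ∈ V := by rw [← heq]; exact h₁V t htJ.1
    obtain ⟨σ, hσ, hev⟩ := hv.eventually_velocity_eq h₂ htJ.2 hVt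
    obtain ⟨u, hu1, hu2, hu3⟩ := (hfreq.and_eventually
      (hev.and ((hc2 t htJ).preimage_mem_nhds (hv.isOpen.mem_nhds hVt)))).exists
    have hσ1 : σ = 1 := by
      rw [hu1.2.2] at hu2
      have h4 : (1 - σ) • v (γ₂ u) = 0 := by rw [sub_smul, one_smul, ← hu2, sub_self]
      rcases smul_eq_zero.1 h4 with h5 | h5
      · linarith
      · exact absurd h5 (hv.ne_zero _ hu3)
    subst hσ1
    exact ⟨htJ, heq, by rw [hev.self_of_nhds, one_smul]⟩

/-- Affine change of the time parameter of a trajectory, with unit speed. -/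
lemma isTrajectoryOn_comp_affine {γ : ℝ → M} {a b : ℝ} (hγ : l.IsTrajectoryOn γ (Ioo a b))
    {σ : ℝ} (hσ : σ = 1 ∨ σ = -1) (τ : ℝ) {c d : ℝ}
    (hcd : ∀ t ∈ Ioo c d, σ * t + τ ∈ Ioo a b) :
    l.IsTrajectoryOn (fun t => γ (σ * t + τ)) (Ioo c d) ∧
      ∀ t ∈ Ioo c d, mfderiv 𝓘(ℝ, ℝ) I (fun t => γ (σ * t + τ)) t (1 : ℝ) =
        σ • mfderiv 𝓘(ℝ, ℝ) I γ (σ * t + τ) (1 : ℝ) := by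
  have hd : ∀ t ∈ Ioo c d, mfderiv 𝓘(ℝ, ℝ) I (fun t => γ (σ * t + τ)) t (1 : ℝ) =
      σ • mfderiv 𝓘(ℝ, ℝ) I γ (σ * t + τ) (1 : ℝ) := by
    intro t ht
    have h1 : MDifferentiableAt 𝓘(ℝ, ℝ) I γ (σ * t + τ) :=
      ((hγ.1 _ (hcd t ht)).contMDiffAt (isOpen_Ioo.mem_nhds (hcd t ht))).mdifferentiableAt
        one_ne_zero
    have h2 : HasDerivAt (fun t : ℝ => σ * t + τ) σ t := by
      simpa using ((hasDerivAt_id t).const_mul σ).add_const τ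
    have h3 := HasMFDerivAt.comp t (g := γ) (f := fun t : ℝ => σ * t + τ) h1.hasMFDerivAt
      h2.hasFDerivAt.hasMFDerivAt
    refine (DFunLike.congr_fun h3.mfderiv (1 : ℝ)).trans ?_
    change mfderiv 𝓘(ℝ, ℝ) I γ (σ * t + τ) ((1 : ℝ) • σ) = _
    rw [show (1 : ℝ) • σ = σ • (1 : ℝ) by simp]
    exact map_smul (mfderiv 𝓘(ℝ, ℝ) I γ (σ * t + τ)) σ (1 : ℝ)
  refine ⟨⟨?_, fun t ht => ?_⟩, hd⟩
  · refine hγ.1.comp ?_ fun t ht => hcd t ht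
    exact (ContDiff.contMDiff (by fun_prop)).contMDiffOn
  · rw [hd t ht]
    have h4 := hγ.2 _ (hcd t ht)
    rcases hσ with rfl | rfl
    · rw [one_smul]; exact h4
    · rw [neg_one_smul]; exact neg_mem_elem h4

lemma IsLocalFlow.isTrajectoryOn (hv : IsDirector l v V) {U W : Set M} {ε : ℝ} {Φ : M → ℝ → M}
    (hΦ : IsLocalFlow I v U W ε Φ) (hUV : U ⊆ V) {p : M} (hp : p ∈ W) :
    l.IsTrajectoryOn (Φ p) (Ioo (-ε) ε) ∧
      ∀ t ∈ Ioo (-ε) ε, mfderiv 𝓘(ℝ, ℝ) I (Φ p) t (1 : ℝ) = v (Φ p t) := by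
  have hd : ∀ t ∈ Ioo (-ε) ε, mfderiv 𝓘(ℝ, ℝ) I (Φ p) t (1 : ℝ) = v (Φ p t) := by
    intro t ht
    have := (hΦ.2.2.2.2.1 p hp t ht).hasMFDerivAt (isOpen_Ioo.mem_nhds ht)
    refine (DFunLike.congr_fun this.mfderiv (1 : ℝ)).trans ?_
    change (1 : ℝ) • v (Φ p t) = _
    rw [one_smul]
  refine ⟨⟨?_, fun t ht => ?_⟩, hd⟩
  · have h1 := hΦ.2.2.2.2.2.comp (contMDiffOn_const.prodMk contMDiffOn_id :
      ContMDiffOn 𝓘(ℝ, ℝ) (I.prod 𝓘(ℝ, ℝ)) ∞ (fun t : ℝ => (p, t)) (Ioo (-ε) ε))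
      (fun t ht => ⟨hp, ht⟩)
    exact h1.of_le (by simp)
  · rw [hd t ht, hv.elem_eq _ (hUV (hΦ.2.2.1 p hp t ht))]
    exact Or.inl rfl

/-- A trajectory through a point of a flow line of a director runs along that flow line. -/
lemma IsLocalFlow.eq_trajectory [T2Space M] (hv : IsDirector l v V) (hVi : V ⊆ I.interior M)
    {U W : Set M} {ε : ℝ} {Φ : M → ℝ → M} (hΦ : IsLocalFlow I v U W ε Φ) (hUV : U ⊆ V) {p : M}
    (hp : p ∈ W) {η : ℝ → M} {a b t₁ c₁ σ : ℝ} (hη : l.IsTrajectoryOn η (Ioo a b))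
    (ht₁ : t₁ ∈ Ioo a b) (hc₁ : c₁ ∈ Ioo (-ε) ε) (h0 : η t₁ = Φ p c₁) (hσ : σ = 1 ∨ σ = -1)
    (h0' : mfderiv 𝓘(ℝ, ℝ) I η t₁ (1 : ℝ) = σ • v (η t₁)) {s : ℝ} (hs : s ∈ Ioo (-ε) ε)
    (hs' : σ * (s - c₁) + t₁ ∈ Ioo a b) : Φ p s = η (σ * (s - c₁) + t₁) := by
  have hσσ : σ * σ = 1 := by rcases hσ with rfl | rfl <;> norm_num
  obtain ⟨c, d, hcd⟩ : ∃ c d : ℝ, ∀ t, t ∈ Ioo c d ↔ σ * t + (t₁ - σ * c₁) ∈ Ioo a b := by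
    rcases hσ with rfl | rfl
    · refine ⟨a - (t₁ - c₁), b - (t₁ - c₁), fun t => ?_⟩
      simp only [mem_Ioo]
      constructor <;> (rintro ⟨h1, h2⟩; constructor <;> linarith)
    · refine ⟨t₁ + c₁ - b, t₁ + c₁ - a, fun t => ?_⟩
      simp only [mem_Ioo]
      constructor <;> (rintro ⟨h1, h2⟩; constructor <;> linarith)
  obtain ⟨hη1, hη2⟩ := isTrajectoryOn_comp_affine hη hσ (t₁ - σ * c₁) (fun t => (hcd t).1)
  have e1 : σ * c₁ + (t₁ - σ * c₁) = t₁ := by ring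
  have hmem : c₁ ∈ Ioo c d := (hcd c₁).2 (by rw [e1]; exact ht₁)
  have hmem' : s ∈ Ioo c d := (hcd s).2 (by convert hs' using 1; ring)
  have := hv.eqOn_of_velocity_eq hVi (hΦ.2.2.2.2.1 p hp) (fun t ht => hUV (hΦ.2.2.1 p hp t ht))
    hη1 hc₁ hmem (by simp only [e1, h0]) (by
      rw [hη2 c₁ hmem]
      have hgen : ∀ u, u = t₁ → σ • mfderiv 𝓘(ℝ, ℝ) I η u (1 : ℝ) = v (η u) := by
        rintro _ rfl
        rw [h0', smul_smul, hσσ, one_smul]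
      exact hgen _ e1)
  rw [this ⟨hs, hmem'⟩]
  change η (σ * s + (t₁ - σ * c₁)) = _
  congr 1
  ring

/-- The exponential map of `l` is computed by the local flows of directors. -/
lemma IsLocalFlow.isExp_iff [T2Space M] (hv : IsDirector l v V) (hVi : V ⊆ I.interior M)
    {U W : Set M} {ε : ℝ} {Φ : M → ℝ → M} (hΦ : IsLocalFlow I v U W ε Φ) (hUV : U ⊆ V) {p : M}
    (hp : p ∈ W) {c : ℝ} (hc : c ∈ Ioo (-ε) ε) (q : M) :
    l.IsExp (⟨p, c • v p⟩ : TangentBundle I M) q ↔ q = Φ p c := by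
  have hε : (0 : ℝ) ∈ Ioo (-ε) ε := ⟨by linarith [hΦ.2.1], hΦ.2.1⟩
  have hp0 : Φ p 0 = p := hΦ.2.2.2.1 p hp
  have hpV : p ∈ V := by
    have := hUV (hΦ.2.2.1 p hp 0 hε)
    rwa [hp0] at this
  constructor
  · rintro ⟨c', a, b, γ, h0, hc', hγ, hq, hγ0, hw⟩
    change γ 0 = p at hγ0
    have hVγ : γ 0 ∈ V := by rw [hγ0]; exact hpV
    obtain ⟨σ, hσ, hvel⟩ := hv.eq_or_eq_neg hVγ (hγ.2 0 h0)
    have hcc : c = c' * σ := by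
      rw [hvel] at hw
      clear hvel hγ hq
      subst hγ0
      have h1 : c • v (γ 0) = c' • σ • v (γ 0) := by
        simpa only [TotalSpace.mk_inj] using hw
      have h2 : (c - c' * σ) • v (γ 0) = 0 := by rw [sub_smul, mul_smul, ← h1, sub_self]
      rcases smul_eq_zero.1 h2 with h3 | h3
      · linarith
      · exact absurd h3 (hv.ne_zero _ hpV)
    have hσσ : σ * σ = 1 := by rcases hσ with rfl | rfl <;> norm_num
    have hc'' : σ * (c - 0) + 0 = c' := by
      rw [hcc]; linear_combination c' * hσσ
    have := hΦ.eq_trajectory hv hVi hUV hp hγ h0 hε (by rw [hp0, hγ0]) hσ hvel hc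
      (by rw [hc'']; exact hc')
    rw [this, hc'', hq]
  · rintro rfl
    obtain ⟨h1, h2⟩ := hΦ.isTrajectoryOn hv hUV hp
    refine ⟨c, -ε, ε, Φ p, hε, hc, h1, rfl, hp0, ?_⟩
    rw [h2 0 hε]
    rw [hp0]

/-- Running a flow line backwards from its point at time `s`. -/
lemma IsLocalFlow.isExp_backward (hv : IsDirector l v V)
    {U W : Set M} {ε : ℝ} {Φ : M → ℝ → M} (hΦ : IsLocalFlow I v U W ε Φ) (hUV : U ⊆ V) {q : M}
    (hq : q ∈ W) {s : ℝ} (hs : s ∈ Ioo (-ε) ε) :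
    l.IsExp (⟨Φ q s, (-s) • v (Φ q s)⟩ : TangentBundle I M) q := by
  obtain ⟨h1, h2⟩ := hΦ.isTrajectoryOn hv hUV hq
  have hcd : ∀ t ∈ Ioo (-ε - s) (ε - s), 1 * t + s ∈ Ioo (-ε) ε := fun t ht =>
    ⟨by linarith [ht.1], by linarith [ht.2]⟩
  obtain ⟨h3, h4⟩ := isTrajectoryOn_comp_affine h1 (Or.inl rfl) s hcd
  have h0 : (0 : ℝ) ∈ Ioo (-ε - s) (ε - s) := ⟨by linarith [hs.1], by linarith [hs.2]⟩
  refine ⟨-s, -ε - s, ε - s, _, h0, ⟨by linarith [hΦ.2.1], by linarith [hΦ.2.1]⟩, h3, ?_, ?_, ?_⟩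
  · rw [show 1 * -s + s = 0 by ring]
    exact hΦ.2.2.2.1 q hq
  · change Φ q (1 * 0 + s) = Φ q s
    rw [show 1 * 0 + s = s by ring]
  · rw [h4 0 h0, one_smul, h2 _ (hcd 0 h0)]
    change _ = (⟨Φ q (1 * 0 + s), -s • v (Φ q (1 * 0 + s))⟩ : TangentBundle I M)
    rw [show 1 * 0 + s = s by ring]

lemma IsLocalFlow.mono_time {U W : Set M} {ε ε' : ℝ} {Φ : M → ℝ → M}
    (hΦ : IsLocalFlow I v U W ε Φ) (h0 : 0 < ε') (h : ε' ≤ ε) : IsLocalFlow I v U W ε' Φ := by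
  have hsub : Ioo (-ε') ε' ⊆ Ioo (-ε) ε := Ioo_subset_Ioo (neg_le_neg h) h
  exact ⟨hΦ.1, h0, fun p hp t ht => hΦ.2.2.1 p hp t (hsub ht), hΦ.2.2.2.1,
    fun p hp => (hΦ.2.2.2.2.1 p hp).mono hsub,
    hΦ.2.2.2.2.2.mono (prod_mono_right hsub)⟩

end Trajectories

/-! ### Flows of uniform duration and the implicit return time -/

section Uniform

variable {H : Type*} [TopologicalSpace H] {I : ModelWithCorners ℝ E3 H}
  {M : Type*} [TopologicalSpace M] [ChartedSpace H M] [IsManifold I ∞ M]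
  {l : LineElementField I M} {ι : Type*} {V : ι → Set M} {v : ι → ∀ p : M, TangentSpace I p}

variable (I) in
/-- Every point of the open set `N'` has a neighbourhood on which the flow of one of the vector
fields `v i` is defined for the times `|t| < r`, and stays in `N` and in the domain `V i`. -/
def HasUniformFlow (v : ι → ∀ p : M, TangentSpace I p) (V : ι → Set M) (N N' : Set M) (r : ℝ) :
    Prop :=
  IsOpen N' ∧ N' ⊆ N ∧ ∀ q ∈ N', ∃ (i : ι) (W : Set M) (Φ : M → ℝ → M), q ∈ W ∧
    IsLocalFlow I (v i) (V i ∩ N) W r Φ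

lemma HasUniformFlow.mono_time {N N' : Set M} {r r' : ℝ} (h : HasUniformFlow I v V N N' r)
    (h0 : 0 < r') (hr : r' ≤ r) : HasUniformFlow I v V N N' r' := by
  refine ⟨h.1, h.2.1, fun q hq => ?_⟩
  obtain ⟨i, W, Φ, hW, hΦ⟩ := h.2.2 q hq
  exact ⟨i, W, Φ, hW, hΦ.mono_time h0 hr⟩

/-- By compactness of `L`, the time for which the flows are defined can be chosen uniformly. -/
lemma exists_hasUniformFlow (hv : ∀ i, IsDirector l (v i) (V i))
    (hVi : ∀ i, V i ⊆ I.interior M) {L N : Set M} (hL : IsCompact L) (hN : IsOpen N)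
    (hLN : L ⊆ N) (hLV : L ⊆ ⋃ i, V i) :
    ∃ N' r, 0 < r ∧ L ⊆ N' ∧ HasUniformFlow I v V N N' r := by
  refine hL.induction_on (p := fun s => ∃ N' r, 0 < r ∧ s ⊆ N' ∧ HasUniformFlow I v V N N' r)
    ?_ ?_ ?_ ?_
  · exact ⟨∅, 1, one_pos, subset_rfl, isOpen_empty, empty_subset _, fun q hq => hq.elim⟩
  · rintro s t hst ⟨N', r, hr, ht, h⟩
    exact ⟨N', r, hr, hst.trans ht, h⟩
  · rintro s t ⟨N₁, r₁, hr₁, hs, h₁⟩ ⟨N₂, r₂, hr₂, ht, h₂⟩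
    have hr : 0 < min r₁ r₂ := lt_min hr₁ hr₂
    refine ⟨N₁ ∪ N₂, min r₁ r₂, hr, union_subset_union hs ht, h₁.1.union h₂.1,
      union_subset h₁.2.1 h₂.2.1, ?_⟩
    rintro q (hq | hq)
    · exact (h₁.mono_time hr (min_le_left _ _)).2.2 q hq
    · exact (h₂.mono_time hr (min_le_right _ _)).2.2 q hq
  · intro p hp
    obtain ⟨i, hi⟩ := mem_iUnion.1 (hLV hp)
    obtain ⟨W, ε, Φ, hpW, hWV, hΦ⟩ := exists_isLocalFlow ((hv i).isOpen.inter hN)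
      ((hv i).smooth.mono inter_subset_left) ⟨hi, hLN hp⟩ (hVi i hi)
    exact ⟨W, mem_nhdsWithin_of_mem_nhds (hΦ.1.mem_nhds hpW), W, ε, hΦ.2.1, subset_rfl, hΦ.1,
      hWV.trans inter_subset_right, fun q hq => ⟨i, W, Φ, hq, hΦ⟩⟩

lemma IsLocalFlow.mem_of_mem {w : ∀ p : M, TangentSpace I p} {U W : Set M} {ε : ℝ}
    {Φ : M → ℝ → M} (hΦ : IsLocalFlow I w U W ε Φ) {q : M} (hq : q ∈ W) : q ∈ U := by
  have := hΦ.2.2.1 q hq 0 ⟨by linarith [hΦ.2.1], hΦ.2.1⟩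
  rwa [hΦ.2.2.2.1 q hq] at this

variable (I) in
/-- The derivative of the function `F` in the direction of the vector field `w`. -/
def derivAlong (w : ∀ p : M, TangentSpace I p) (F : M → ℝ) (q : M) : ℝ :=
  mfderiv I 𝓘(ℝ, ℝ) F q (w q)

/-- Along a flow line, a function with derivative at least one in the direction of the field grows
at least as fast as the time. -/
lemma IsLocalFlow.sub_le_sub {w : ∀ p : M, TangentSpace I p} {V₁ N W : Set M} {ε : ℝ}
    {Φ : M → ℝ → M} (hΦ : IsLocalFlow I w (V₁ ∩ N) W ε Φ) (hV₁ : IsOpen V₁) {F : M → ℝ}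
    (hF : ContMDiffOn I 𝓘(ℝ, ℝ) ∞ F V₁)
    (hgrow : ∀ q ∈ N ∩ V₁, 1 ≤ derivAlong I w F q) {q : M} (hq : q ∈ W)
    {s t : ℝ} (hs : s ∈ Ioo (-ε) ε) (ht : t ∈ Ioo (-ε) ε) (hst : s ≤ t) :
    t - s ≤ F (Φ q t) - F (Φ q s) := by
  have hd : ∀ u ∈ Ioo (-ε) ε,
      HasDerivAt (fun u => F (Φ q u)) (derivAlong I w F (Φ q u)) u := by
    intro u hu
    have h1 := (hΦ.2.2.2.2.1 q hq u hu).hasMFDerivAt (isOpen_Ioo.mem_nhds hu)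
    refine hasDerivAt_comp_integralCurve h1 ?_
    exact ((hF _ (hΦ.2.2.1 q hq u hu).1).contMDiffAt
      (hV₁.mem_nhds (hΦ.2.2.1 q hq u hu).1)).mdifferentiableAt (by simp)
  have := (convex_Ioo (-ε) ε).mul_sub_le_image_sub_of_le_deriv (f := fun u => F (Φ q u)) (C := 1)
    (fun u hu => (hd u hu).continuousAt.continuousWithinAt)
    (fun u hu => (hd u (interior_subset hu)).differentiableAt.differentiableWithinAt)
    (fun u hu => by
      have hu' := interior_subset hu
      rw [(hd u hu').deriv]
      exact hgrow _ (hΦ.2.2.1 q hq u hu').symm) s hs t ht hst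
  linarith

/-- The implicit function theorem for an equation `f (q, t) = 0` with unknown `t`, where `q` is a
point of a manifold near an interior point `q₀`. -/
lemma exists_implicit_time {f : M × ℝ → ℝ} {q₀ : M} {s₀ d : ℝ} (hq₀ : q₀ ∈ I.interior M)
    (hf : ContMDiffAt (I.prod 𝓘(ℝ, ℝ)) 𝓘(ℝ, ℝ) ∞ f (q₀, s₀)) (h0 : f (q₀, s₀) = 0)
    (hd : HasDerivAt (fun t => f (q₀, t)) d s₀) (hd0 : d ≠ 0) :
    ∃ τ : M → ℝ, ContMDiffAt I 𝓘(ℝ, ℝ) ∞ τ q₀ ∧ τ q₀ = s₀ ∧ ∀ᶠ q in 𝓝 q₀, f (q, τ q) = 0 := by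
  set χ := extChartAt I q₀ with hχ
  have hint : χ.target ∈ 𝓝 (χ q₀) := mem_interior_iff_mem_nhds.1 (I.isInteriorPoint_iff.1 hq₀)
  set g : E3 × ℝ → ℝ := fun z => f (χ.symm z.1, z.2) with hg
  have hinv : χ.symm (χ q₀) = q₀ := extChartAt_to_inv q₀
  have hgs : ContDiffAt ℝ ∞ g (χ q₀, s₀) := by
    have h1 : ContMDiffAt 𝓘(ℝ, E3) I ∞ χ.symm (χ q₀) :=
      (contMDiffOn_extChartAt_symm q₀).contMDiffAt hint
    have h2 : ContMDiffAt (𝓘(ℝ, E3 × ℝ)) (I.prod 𝓘(ℝ, ℝ)) ∞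
        (fun z : E3 × ℝ => (χ.symm z.1, z.2)) (χ q₀, s₀) := by
      refine ContMDiffAt.prodMk ?_ ?_
      · exact ContMDiffAt.comp (χ q₀, s₀) (g := χ.symm) (f := fun z : E3 × ℝ => z.1) h1
          contDiffAt_fst.contMDiffAt
      · exact contDiffAt_snd.contMDiffAt
    have h3 : ContMDiffAt (𝓘(ℝ, E3 × ℝ)) 𝓘(ℝ, ℝ) ∞ g (χ q₀, s₀) := by
      refine ContMDiffAt.comp (χ q₀, s₀) (g := f) ?_ h2
      change ContMDiffAt _ _ _ _ (χ.symm (χ q₀), s₀)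
      rw [hinv]; exact hf
    exact contMDiffAt_iff_contDiffAt.1 h3
  have hder : (fderiv ℝ g (χ q₀, s₀) ∘L .inr ℝ E3 ℝ) 1 = d := by
    have h1 : HasDerivAt (fun t => g (χ q₀, t)) ((fderiv ℝ g (χ q₀, s₀) ∘L .inr ℝ E3 ℝ) 1) s₀ := by
      have h2 : HasFDerivAt g (fderiv ℝ g (χ q₀, s₀)) (χ q₀, s₀) :=
        (hgs.differentiableAt (by simp)).hasFDerivAt
      exact (HasFDerivAt.comp s₀ h2 (hasFDerivAt_prodMk_right (𝕜 := ℝ) (χ q₀) s₀)).hasDerivAt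
    refine h1.unique ?_
    simp only [hg, hinv]
    exact hd
  have hinvt : (fderiv ℝ g (χ q₀, s₀) ∘L .inr ℝ E3 ℝ).IsInvertible := by
    refine ⟨ContinuousLinearEquiv.unitsEquivAut ℝ (Units.mk0 d hd0), ?_⟩
    refine ContinuousLinearMap.ext_ring ?_
    rw [hder]
    simp
  have hg0 : g (χ q₀, s₀) = 0 := by simp only [hg, hinv]; exact h0
  have hcχ : ContinuousAt χ q₀ := continuousAt_extChartAt (I := I) q₀
  refine ⟨fun q => hgs.implicitFunction (by simp) hinvt (χ q), ?_, ?_, ?_⟩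
  · exact ContMDiffAt.comp q₀ (g := hgs.implicitFunction (by simp) hinvt)
      (hgs.contDiffAt_implicitFunction (by simp) hinvt).contMDiffAt
      (contMDiffAt_extChartAt (I := I))
  · exact hgs.implicitFunction_apply_self (by simp) hinvt
  · have h1 := hgs.eventually_apply_implicitFunction (by simp) hinvt
    filter_upwards [hcχ.tendsto.eventually h1, extChartAt_source_mem_nhds (I := I) q₀]
      with q hq hqs
    rw [hg0] at hq
    simp only [hg, hχ, (extChartAt I q₀).left_inv hqs] at hq
    exact hq

end Uniform

/-! ### The band of a transverse surface -/

section Band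

variable {H : Type*} [TopologicalSpace H] {I : ModelWithCorners ℝ E3 H}
  {M : Type*} [TopologicalSpace M] [ChartedSpace H M] [IsManifold I ∞ M]
  {l : LineElementField I M} {ι : Type*} {V : ι → Set M} {v : ι → ∀ p : M, TangentSpace I p}

variable (I) in
/-- Local defining functions `F i : V i → ℝ`, with a common zero set, which grow at least at unit
rate along the vector fields `v i` inside `N`. -/
structure IsTransverseFamily (v : ι → ∀ p : M, TangentSpace I p) (V : ι → Set M) (N : Set M)
    (F : ι → M → ℝ) : Prop where
  smooth : ∀ i, ContMDiffOn I 𝓘(ℝ, ℝ) ∞ (F i) (V i)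
  zero_iff : ∀ i j, ∀ q ∈ V i ∩ V j, F i q = 0 ↔ F j q = 0
  one_le : ∀ i, ∀ q ∈ N ∩ V i, 1 ≤ derivAlong I (v i) (F i) q

/-- The common zero set of the functions `F i`, inside `N`. -/
def levelSurface (V : ι → Set M) (N : Set M) (F : ι → M → ℝ) : Set M :=
  {q ∈ N | ∃ i, q ∈ V i ∧ F i q = 0}

lemma IsTransverseFamily.eq_zero {N N' : Set M} {F : ι → M → ℝ}
    (hF : IsTransverseFamily I v V N F) {q : M} (hq : q ∈ levelSurface V N' F) {i : ι}
    (hi : q ∈ V i) : F i q = 0 := by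
  obtain ⟨_, j, hj, h⟩ := hq
  exact (hF.zero_iff i j q ⟨hi, hj⟩).2 h

lemma IsTransverseFamily.sub_le_sub {N N' : Set M} {F : ι → M → ℝ}
    (hF : IsTransverseFamily I v V N F) (hN : N' ⊆ N) {i : ι} (hi : IsOpen (V i)) {W : Set M}
    {ε : ℝ} {Φ : M → ℝ → M} (hΦ : IsLocalFlow I (v i) (V i ∩ N') W ε Φ) {q : M} (hq : q ∈ W)
    {s t : ℝ} (hs : s ∈ Ioo (-ε) ε) (ht : t ∈ Ioo (-ε) ε) (hst : s ≤ t) :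
    t - s ≤ F i (Φ q t) - F i (Φ q s) :=
  hΦ.sub_le_sub hi (hF.smooth i) (fun q hq => hF.one_le i q ⟨hN hq.1, hq.2⟩) hq hs ht hst

lemma abs_sub_le_abs_sub_of_sub_le_sub {f : ℝ → ℝ} {a b : ℝ}
    (h : ∀ s ∈ Ioo a b, ∀ t ∈ Ioo a b, s ≤ t → t - s ≤ f t - f s) {s t : ℝ} (hs : s ∈ Ioo a b)
    (ht : t ∈ Ioo a b) : |t - s| ≤ |f t - f s| := by
  rcases le_total s t with hst | hst
  · have := h s hs t ht hst
    rw [abs_of_nonneg (sub_nonneg.2 hst)]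
    exact this.trans (le_abs_self _)
  · have := h t ht s hs hst
    rw [abs_sub_comm, abs_sub_comm (f t), abs_of_nonneg (sub_nonneg.2 hst)]
    exact this.trans (le_abs_self _)

lemma IsTransverseFamily.abs_sub_le_abs_sub {N N' : Set M} {F : ι → M → ℝ}
    (hF : IsTransverseFamily I v V N F) (hN : N' ⊆ N) {i : ι} (hi : IsOpen (V i)) {W : Set M}
    {ε : ℝ} {Φ : M → ℝ → M} (hΦ : IsLocalFlow I (v i) (V i ∩ N') W ε Φ) {q : M} (hq : q ∈ W)
    {s t : ℝ} (hs : s ∈ Ioo (-ε) ε) (ht : t ∈ Ioo (-ε) ε) :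
    |t - s| ≤ |F i (Φ q t) - F i (Φ q s)| :=
  abs_sub_le_abs_sub_of_sub_le_sub (f := fun t => F i (Φ q t))
    (fun _ hs _ ht hst => hF.sub_le_sub hN hi hΦ hq hs ht hst) hs ht

lemma mem_band_of_director {w : ∀ p : M, TangentSpace I p} {V₁ S : Set M}
    (hv : IsDirector l w V₁) {ρ : ℝ} {q : M} (hq : q ∈ V₁) (hqS : q ∈ S) {c : ℝ} (hc : |c| < ρ) :
    (⟨q, c • w q⟩ : TangentBundle I M) ∈ l.band (ENNReal.ofReal ρ) S := by
  refine ⟨hqS, w q, ?_, c, ?_, rfl⟩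
  · rw [hv.elem_eq q hq]; exact Or.inl rfl
  · exact (ENNReal.ofReal_lt_ofReal_iff (lt_of_le_of_lt (abs_nonneg c) hc)).2 hc

lemma exists_coefficient_of_mem_band {u : ∀ p : M, TangentSpace I p} {V₁ S : Set M}
    (hv : IsDirector l u V₁) {ρ : ℝ} {w : TangentBundle I M}
    (hw : w ∈ l.band (ENNReal.ofReal ρ) S) (hV : w.proj ∈ V₁) :
    ∃ c : ℝ, |c| < ρ ∧ w = ⟨w.proj, c • u w.proj⟩ := by
  obtain ⟨q, x⟩ := w
  obtain ⟨_, y, hy, c, hc, hx⟩ := hw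
  obtain ⟨σ, hσ, rfl⟩ := hv.eq_or_eq_neg hV hy
  have hc' : |c| < ρ := by
    by_contra h
    exact absurd hc (not_lt.2 (ENNReal.ofReal_le_ofReal (not_lt.1 h)))
  refine ⟨c * σ, ?_, ?_⟩
  · rcases hσ with rfl | rfl <;> simpa using hc'
  · change x = c • σ • u q at hx
    rw [hx, smul_smul]

/-- If two flow lines meet, then the starting point of the second one lies on the first one. -/
lemma exists_eq_flow_of_flow_eq [T2Space M] (hv : ∀ i, IsDirector l (v i) (V i))
    (hVi : ∀ i, V i ⊆ I.interior M) {i j : ι} {N N' W W' : Set M} {ε : ℝ} {Φ Φ' : M → ℝ → M}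
    (hΦ : IsLocalFlow I (v i) (V i ∩ N) W ε Φ) (hΦ' : IsLocalFlow I (v j) (V j ∩ N') W' ε Φ')
    {p p' : M} (hp : p ∈ W) (hp' : p' ∈ W') {c c' : ℝ} (hcc : |c| + |c'| < ε)
    (h : Φ p c = Φ' p' c') : ∃ s : ℝ, |s| ≤ |c| + |c'| ∧ Φ p s = p' := by
  have habs : ∀ x : ℝ, |x| < ε → x ∈ Ioo (-ε) ε := fun x hx => abs_lt.1 hx
  have hc := habs c (by linarith [abs_nonneg c'])
  have hc' := habs c' (by linarith [abs_nonneg c])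
  obtain ⟨h1, h2⟩ := hΦ'.isTrajectoryOn (hv j) inter_subset_left hp'
  have hmem : Φ' p' c' ∈ V i := by rw [← h]; exact (hΦ.2.2.1 p hp c hc).1
  obtain ⟨σ, hσ, hvel⟩ := (hv i).eq_or_eq_neg hmem (h1.2 c' hc')
  have hs : |c - σ * c'| ≤ |c| + |c'| := by
    refine (abs_sub _ _).trans (le_of_eq ?_)
    rcases hσ with rfl | rfl <;> simp
  have hσσ : σ * σ = 1 := by rcases hσ with rfl | rfl <;> norm_num
  have e : σ * (c - σ * c' - c) + c' = 0 := by linear_combination -c' * hσσ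
  have := hΦ.eq_trajectory (hv i) (hVi i) inter_subset_left hp h1 hc' hc h.symm hσ hvel
    (s := c - σ * c') (habs _ (lt_of_le_of_lt hs hcc))
    (by rw [e]; exact ⟨by linarith [hΦ.2.1], hΦ.2.1⟩)
  refine ⟨_, hs, ?_⟩
  rw [this, e, hΦ'.2.2.2.1 p' hp']

variable {N₀ N₁ N₂ N₃ : Set M} {R : ℝ} {F : ι → M → ℝ}

/-- The exponential map is injective on the band: a flow line crosses the surface only once,
because the defining function increases along it. -/
lemma eq_of_isExp [T2Space M] (hv : ∀ i, IsDirector l (v i) (V i))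
    (hVi : ∀ i, V i ⊆ I.interior M) (h₁₂ : HasUniformFlow I v V N₁ N₂ R)
    (hF : IsTransverseFamily I v V N₁ F) {w w' : TangentBundle I M}
    (hw : w ∈ l.band (ENNReal.ofReal (R / 2)) (levelSurface V N₂ F))
    (hw' : w' ∈ l.band (ENNReal.ofReal (R / 2)) (levelSurface V N₂ F)) {q : M}
    (h : l.IsExp w q) (h' : l.IsExp w' q) : w = w' := by
  obtain ⟨i, W, Φ, hW, hΦ⟩ := h₁₂.2.2 _ hw.1.1
  obtain ⟨j, W', Φ', hW', hΦ'⟩ := h₁₂.2.2 _ hw'.1.1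
  have hpi : w.proj ∈ V i := (hΦ.mem_of_mem hW).1
  have hR : 0 < R := hΦ.2.1
  obtain ⟨c, hc, hwc⟩ := exists_coefficient_of_mem_band (hv i) hw hpi
  obtain ⟨c', hc', hwc'⟩ := exists_coefficient_of_mem_band (hv j) hw' (hΦ'.mem_of_mem hW').1
  have hcI : c ∈ Ioo (-R) R := abs_lt.1 (by linarith)
  have hq : q = Φ w.proj c :=
    (hΦ.isExp_iff (hv i) (hVi i) inter_subset_left hW hcI q).1 (by rw [← hwc]; exact h)
  have hq' : q = Φ' w'.proj c' :=
    (hΦ'.isExp_iff (hv j) (hVi j) inter_subset_left hW' (abs_lt.1 (by linarith)) q).1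
      (by rw [← hwc']; exact h')
  obtain ⟨s, hs, hps⟩ := exists_eq_flow_of_flow_eq hv hVi hΦ hΦ' hW hW' (by linarith)
    (hq.symm.trans hq')
  have hsI : s ∈ Ioo (-R) R := abs_lt.1 (by linarith)
  have h0I : (0 : ℝ) ∈ Ioo (-R) R := ⟨by linarith, hR⟩
  have hΦ0 := hΦ.2.2.2.1 _ hW
  have hpi' : w'.proj ∈ V i := by rw [← hps]; exact (hΦ.2.2.1 _ hW s hsI).1
  have hs0 : s = 0 := by
    have := hF.abs_sub_le_abs_sub subset_rfl (hv i).isOpen hΦ hW h0I hsI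
    rw [hps, hΦ0, hF.eq_zero hw.1 hpi, hF.eq_zero hw'.1 hpi', sub_zero, sub_zero, abs_zero] at this
    exact abs_eq_zero.1 (le_antisymm this (abs_nonneg s))
  have hpp : w'.proj = w.proj := by rw [← hps, hs0, hΦ0]
  obtain ⟨d, hd, hwd⟩ := exists_coefficient_of_mem_band (hv i) hw' hpi'
  rw [hpp] at hwd
  have hdI : d ∈ Ioo (-R) R := abs_lt.1 (by linarith)
  have hqd : q = Φ w.proj d :=
    (hΦ.isExp_iff (hv i) (hVi i) inter_subset_left hW hdI q).1 (by rw [← hwd]; exact h')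
  have hcd : c = d := by
    have := hF.abs_sub_le_abs_sub subset_rfl (hv i).isOpen hΦ hW hdI hcI
    rw [← hq, ← hqd, sub_self, abs_zero] at this
    exact sub_eq_zero.1 (abs_eq_zero.1 (le_antisymm this (abs_nonneg _)))
  rw [hwc, hwd, hcd]

/-- The exponential map has smooth local right inverses, with values in the band. -/
lemma exists_smooth_local_inverse [T2Space M] (hv : ∀ i, IsDirector l (v i) (V i))
    (hVi : ∀ i, V i ⊆ I.interior M) (h₀₁ : HasUniformFlow I v V N₀ N₁ R)
    (h₁₂ : HasUniformFlow I v V N₁ N₂ R)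
    (hF : IsTransverseFamily I v V N₀ F) {w : TangentBundle I M}
    (hw : w ∈ l.band (ENNReal.ofReal (R / 2)) (levelSurface V N₂ F)) {q : M} (h : l.IsExp w q) :
    ∃ g : M → TangentBundle I M, ContMDiffAt I I.tangent ∞ g q ∧ ∀ᶠ x in 𝓝 q,
      g x ∈ l.band (ENNReal.ofReal (R / 2)) (levelSurface V N₂ F) ∧ l.IsExp (g x) x := by
  obtain ⟨j, W', Φ', hW', hΦ'⟩ := h₁₂.2.2 _ hw.1.1
  have hR : 0 < R := hΦ'.2.1
  obtain ⟨c', hc', hwc'⟩ := exists_coefficient_of_mem_band (hv j) hw (hΦ'.mem_of_mem hW').1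
  have hcI' : c' ∈ Ioo (-R) R := abs_lt.1 (by linarith)
  have hq' : q = Φ' w.proj c' :=
    (hΦ'.isExp_iff (hv j) (hVi j) inter_subset_left hW' hcI' q).1 (by rw [← hwc']; exact h)
  have hqN : q ∈ N₁ := by rw [hq']; exact (hΦ'.2.2.1 _ hW' c' hcI').2
  obtain ⟨i, W, Φ, hW, hΦ⟩ := h₀₁.2.2 q hqN
  obtain ⟨s, hs, hps⟩ := exists_eq_flow_of_flow_eq hv hVi hΦ hΦ' hW hW' (c := 0) (c' := c')
    (by rw [abs_zero]; linarith) (by rw [hΦ.2.2.2.1 q hW, hq'])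
  rw [abs_zero, zero_add] at hs
  have hsI : s ∈ Ioo (-R) R := abs_lt.1 (by linarith)
  have hpi : Φ q s ∈ V i := (hΦ.2.2.1 q hW s hsI).1
  have hFp : F i (Φ q s) = 0 := hF.eq_zero (by rw [hps]; exact hw.1) hpi
  have hΦs : ContMDiffAt (I.prod 𝓘(ℝ, ℝ)) I ∞ (fun x : M × ℝ => Φ x.1 x.2) (q, s) :=
    hΦ.2.2.2.2.2.contMDiffAt ((hΦ.1.prod isOpen_Ioo).mem_nhds ⟨hW, hsI⟩)
  have hFi : ContMDiffAt I 𝓘(ℝ, ℝ) ∞ (F i) (Φ q s) :=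
    (hF.smooth i).contMDiffAt ((hv i).isOpen.mem_nhds hpi)
  have hd := hasDerivAt_comp_integralCurve
    ((hΦ.2.2.2.2.1 q hW s hsI).hasMFDerivAt (isOpen_Ioo.mem_nhds hsI)) (f := F i)
    (hFi.mdifferentiableAt (by simp))
  obtain ⟨τ, hτ, hτ0, hτF⟩ := exists_implicit_time (f := fun x : M × ℝ => F i (Φ x.1 x.2))
    (hVi i (hΦ.mem_of_mem hW).1)
    (ContMDiffAt.comp (q, s) (g := F i) (f := fun x : M × ℝ => Φ x.1 x.2) hFi hΦs) hFp hd
    (by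
      have : 1 ≤ derivAlong I (v i) (F i) (Φ q s) := hF.one_le i _ (hΦ.2.2.1 q hW s hsI).symm
      exact (lt_of_lt_of_le one_pos this).ne')
  have hpair : ContMDiffAt I (I.prod 𝓘(ℝ, ℝ)) ∞ (fun x => (x, τ x)) q := contMDiffAt_id.prodMk hτ
  have hΦτ : ContMDiffAt I I ∞ (fun x => Φ x (τ x)) q := by
    refine ContMDiffAt.comp q (g := fun x : M × ℝ => Φ x.1 x.2) (f := fun x => (x, τ x)) ?_ hpair
    rw [hτ0]; exact hΦs
  refine ⟨fun x => ⟨Φ x (τ x), (-τ x) • v i (Φ x (τ x))⟩, ?_, ?_⟩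
  · refine contMDiffAt_smul_comp (F := fun x => Φ x (τ x)) ((hv i).contMDiffAt ?_) hΦτ hτ.neg
    rw [hτ0]; exact hpi
  · have hN₂ : ∀ᶠ x in 𝓝 q, Φ x (τ x) ∈ N₂ := by
      refine hΦτ.continuousAt.preimage_mem_nhds (h₁₂.1.mem_nhds ?_)
      rw [hτ0, hps]
      exact hw.1.1
    have hτs : ∀ᶠ x in 𝓝 q, |τ x| < R / 2 :=
      hτ.continuousAt.abs.eventually_lt continuousAt_const (by rw [hτ0]; linarith)
    filter_upwards [hτF, hN₂, hτs, hΦ.1.mem_nhds hW] with x hx1 hx2 hx3 hx4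
    have hτI : τ x ∈ Ioo (-R) R := abs_lt.1 (by linarith)
    have hxi := (hΦ.2.2.1 x hx4 _ hτI).1
    exact ⟨mem_band_of_director (S := levelSurface V N₂ F) (hv i) hxi
        ⟨hx2, i, hxi, hx1⟩ (by rw [abs_neg]; exact hx3),
      hΦ.isExp_backward (hv i) inter_subset_left hx4 hτI⟩

/-- The exponential map is locally the restriction of a smooth map. -/
lemma exists_smooth_local_exp [T2Space M] (hv : ∀ i, IsDirector l (v i) (V i))
    (hVi : ∀ i, V i ⊆ I.interior M) (h₁₂ : HasUniformFlow I v V N₁ N₂ R)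
    {w : TangentBundle I M}
    (hw : w ∈ l.band (ENNReal.ofReal (R / 2)) (levelSurface V N₂ F)) :
    ∃ f : TangentBundle I M → M, ContMDiffAt I.tangent I ∞ f w ∧ ∀ᶠ x in 𝓝 w,
      x ∈ l.band (ENNReal.ofReal (R / 2)) (levelSurface V N₂ F) →
        ∀ q, l.IsExp x q ↔ q = f x := by
  obtain ⟨i, W, Φ, hW, hΦ⟩ := h₁₂.2.2 _ hw.1.1
  have hR : 0 < R := hΦ.2.1
  have hpi : w.proj ∈ V i := (hΦ.mem_of_mem hW).1
  obtain ⟨c, hc, hwc⟩ := exists_coefficient_of_mem_band (hv i) hw hpi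
  obtain ⟨κ, hκ, W₁, hW₁, hκ'⟩ := exists_smooth_coefficient ((hv i).contMDiffAt hpi)
    ((hv i).ne_zero _ hpi) w.snd
  have hκ₀ : κ w = c := by
    have := hκ' _ (mem_of_mem_nhds hW₁) c
    rwa [← hwc] at this
  have hcI : c ∈ Ioo (-R) R := abs_lt.1 (by linarith)
  refine ⟨fun x => Φ x.proj (κ x), ?_, ?_⟩
  · have h1 : ContMDiffAt (I.prod 𝓘(ℝ, ℝ)) I ∞ (fun x : M × ℝ => Φ x.1 x.2) (w.proj, κ w) :=
      hΦ.2.2.2.2.2.contMDiffAt ((hΦ.1.prod isOpen_Ioo).mem_nhds ⟨hW, by rw [hκ₀]; exact hcI⟩)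
    have h2 : ContMDiffAt I.tangent (I.prod 𝓘(ℝ, ℝ)) ∞
        (fun x : TangentBundle I M => (x.proj, κ x)) w :=
      ContMDiffAt.prodMk (Bundle.contMDiffAt_proj _) hκ
    exact ContMDiffAt.comp w (g := fun x : M × ℝ => Φ x.1 x.2)
      (f := fun x : TangentBundle I M => (x.proj, κ x)) h1 h2
  · have hproj : ContinuousAt (fun x : TangentBundle I M => x.proj) w :=
      (FiberBundle.continuous_proj E3 (TangentSpace I)).continuousAt
    filter_upwards [hproj.preimage_mem_nhds (hΦ.1.mem_nhds hW), hproj.preimage_mem_nhds hW₁]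
      with x hxW hxW₁ hx q
    obtain ⟨d, hd, hxd⟩ := exists_coefficient_of_mem_band (hv i) hx (hΦ.mem_of_mem hxW).1
    have hκd : κ x = d := by
      have := hκ' _ hxW₁ d
      rwa [← hxd] at this
    rw [hκd]
    have := hΦ.isExp_iff (hv i) (hVi i) inter_subset_left hxW
      (abs_lt.1 (by linarith) : d ∈ Ioo (-R) R) q
    rwa [← hxd] at this

lemma isSmoothSurface_levelSurface (hv : ∀ i, IsDirector l (v i) (V i))
    (hVi : ∀ i, V i ⊆ I.interior M) (hN₂ : IsOpen N₂) (hN : N₂ ⊆ N₀)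
    (hF : IsTransverseFamily I v V N₀ F) : IsSmoothSurface I (levelSurface V N₂ F) := by
  refine ⟨fun q hq => ?_, fun p hp => ?_⟩
  · obtain ⟨_, i, hi, _⟩ := hq
    exact hVi i hi
  · obtain ⟨hp2, i, hi, hp0⟩ := id hp
    refine ⟨N₂ ∩ V i, hN₂.inter (hv i).isOpen, ⟨hp2, hi⟩, F i,
      (hF.smooth i).mono inter_subset_right, fun h0 => ?_, ?_⟩
    · have := hF.one_le i p ⟨hN hp2, hi⟩
      rw [derivAlong, h0] at this
      exact absurd (show (1 : ℝ) ≤ 0 from this) (by norm_num)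
    · ext q
      constructor
      · rintro ⟨hq, hq'⟩
        exact ⟨hq', hF.eq_zero hq hq'.2⟩
      · rintro ⟨hq, hq'⟩
        exact ⟨⟨hq.1, i, hq.2, hq'⟩, hq⟩

/-- A point at which the defining function is small lies on a short flow line issuing from the
surface. -/
lemma exists_isExp_of_abs_le (hv : ∀ i, IsDirector l (v i) (V i))
    (hN : N₂ ⊆ N₀) (h₂₃ : HasUniformFlow I v V N₂ N₃ R)
    (hF : IsTransverseFamily I v V N₀ F) {δ : ℝ} (hδ : δ < R / 2) {q : M} (hq : q ∈ N₃)
    (hFq : ∀ i, q ∈ V i → |F i q| ≤ δ) :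
    ∃ w ∈ l.band (ENNReal.ofReal (R / 2)) (levelSurface V N₂ F), l.IsExp w q := by
  obtain ⟨i, W, Φ, hW, hΦ⟩ := h₂₃.2.2 q hq
  have hR : 0 < R := hΦ.2.1
  have hqi := (hΦ.mem_of_mem hW).1
  have hδ0 : 0 ≤ δ := (abs_nonneg _).trans (hFq i hqi)
  have hΦ0 := hΦ.2.2.2.1 _ hW
  have hI : ∀ t ∈ Icc (-δ) δ, t ∈ Ioo (-R) R := fun t ht =>
    ⟨by linarith [ht.1], by linarith [ht.2]⟩
  have h0I : (0 : ℝ) ∈ Icc (-δ) δ := ⟨by linarith, hδ0⟩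
  have hcont : ContinuousOn (fun t => F i (Φ q t)) (Icc (-δ) δ) := by
    refine (hF.smooth i).continuousOn.comp (fun t ht => ?_)
      (fun t ht => (hΦ.2.2.1 q hW t (hI t ht)).1)
    exact ((hΦ.2.2.2.2.1 q hW).continuousWithinAt (hI t ht)).mono hI
  have hle : (-δ : ℝ) ∈ Icc (-δ) δ := ⟨le_rfl, by linarith⟩
  have hge : δ ∈ Icc (-δ) δ := ⟨by linarith, le_rfl⟩
  have h1 := hF.sub_le_sub hN (hv i).isOpen hΦ hW (hI _ hle) (hI _ h0I) (by linarith)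
  have h2 := hF.sub_le_sub hN (hv i).isOpen hΦ hW (hI _ h0I) (hI _ hge) hδ0
  rw [hΦ0] at h1 h2
  have h3 := abs_le.1 (hFq i hqi)
  obtain ⟨t, ht, ht0⟩ := intermediate_value_Icc (by linarith) hcont
    (⟨by linarith, by linarith⟩ : (0 : ℝ) ∈ Icc (F i (Φ q (-δ))) (F i (Φ q δ)))
  have htm := hΦ.2.2.1 q hW t (hI t ht)
  refine ⟨_, mem_band_of_director (S := levelSurface V N₂ F) (hv i) htm.1
    ⟨htm.2, i, htm.1, ht0⟩ (c := -t) ?_,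
    hΦ.isExp_backward (hv i) inter_subset_left hW (hI t ht)⟩
  rw [abs_neg]
  exact lt_of_le_of_lt (abs_le.2 ht) hδ

/-- Let `L` be a compact set which, for every `δ > 0`, lies at height at most `δ` with respect to
some family of functions growing at unit rate along the line elements. Then the line elements have
a transverse surface whose band is a neighbourhood of `L`, and the projection to the surface is
injective on `L`. -/
theorem exists_band_neighborhood [T2Space M] (hv : ∀ i, IsDirector l (v i) (V i))
    (hVi : ∀ i, V i ⊆ I.interior M) {L : Set M} (hL : IsCompact L) (hN₀ : IsOpen N₀)
    (hLN : L ⊆ N₀) (hLV : L ⊆ ⋃ i, V i)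
    (hF : ∀ δ : ℝ, 0 < δ → ∃ F : ι → M → ℝ, IsTransverseFamily I v V N₀ F ∧
      ∀ i, ∀ q ∈ L ∩ V i, |F i q| ≤ δ) :
    ∃ (U S : Set M) (r : ℝ≥0∞), IsOpen U ∧ L ⊆ U ∧ 0 < r ∧ IsSmoothSurface I S ∧ S ⊆ U ∧
      ∃ e : TangentBundle I M → M, l.IsExpMapOn e (l.band r S) ∧ IsDiffeoOn I e (l.band r S) U ∧
      ∃ pr : M → M, MapsTo pr U S ∧ (∀ w ∈ l.band r S, pr (e w) = w.proj) ∧ InjOn pr L := by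
  -- nested neighbourhoods `N₃ ⊆ N₂ ⊆ N₁ ⊆ N₀` of `L`, each flowing into the next larger one for a
  -- fixed time: points of `L` reach the surface inside `N₂`, and the band over it remains in `N₁`
  obtain ⟨N₁, R₁, hR₁, hL₁, h₀₁⟩ := exists_hasUniformFlow hv hVi hL hN₀ hLN hLV
  obtain ⟨N₂, R₂, hR₂, hL₂, h₁₂⟩ := exists_hasUniformFlow hv hVi hL h₀₁.1 hL₁ hLV
  obtain ⟨N₃, R₃, hR₃, hL₃, h₂₃⟩ := exists_hasUniformFlow hv hVi hL h₁₂.1 hL₂ hLV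
  obtain ⟨R, hR, hRR₁, hRR₂, hRR₃⟩ : ∃ R, 0 < R ∧ R ≤ R₁ ∧ R ≤ R₂ ∧ R ≤ R₃ :=
    ⟨min R₁ (min R₂ R₃), lt_min hR₁ (lt_min hR₂ hR₃), min_le_left _ _,
      (min_le_right _ _).trans (min_le_left _ _), (min_le_right _ _).trans (min_le_right _ _)⟩
  replace h₀₁ := h₀₁.mono_time hR hRR₁
  replace h₁₂ := h₁₂.mono_time hR hRR₂
  replace h₂₃ := h₂₃.mono_time hR hRR₃
  have hN₂₀ : N₂ ⊆ N₀ := h₁₂.2.1.trans h₀₁.2.1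
  -- the height `R / 4` is passed in time less than `R / 2`, as heights grow at unit rate
  obtain ⟨F, hFt, hFL⟩ := hF (R / 4) (by positivity)
  have hFt₁ : IsTransverseFamily I v V N₁ F :=
    ⟨hFt.smooth, hFt.zero_iff, fun i q hq => hFt.one_le i q ⟨h₀₁.2.1 hq.1, hq.2⟩⟩
  set S := levelSurface V N₂ F with hS
  set B := l.band (ENNReal.ofReal (R / 2)) S with hB
  obtain ⟨e, he⟩ : ∃ e : TangentBundle I M → M, l.IsExpMapOn e B := by
    have : ∀ w : TangentBundle I M, ∃ y : M, w ∈ B → ∀ q, l.IsExp w q ↔ q = y := by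
      intro w
      by_cases hw : w ∈ B
      · obtain ⟨f, _, hf⟩ := exists_smooth_local_exp hv hVi h₁₂ hw
        exact ⟨f w, fun h => hf.self_of_nhds h⟩
      · exact ⟨w.proj, fun h => absurd h hw⟩
    choose e he using this
    exact ⟨e, fun w hw => he w hw⟩
  have hinj : InjOn e B := fun w hw w' hw' h => eq_of_isExp hv hVi h₁₂ hFt₁ hw hw'
    ((he w hw _).2 rfl) ((he w' hw' _).2 h)
  have hlocal : ∀ q ∈ e '' B, ∃ g : M → TangentBundle I M, ContMDiffAt I I.tangent ∞ g q ∧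
      ∀ᶠ x in 𝓝 q, g x ∈ B ∧ e (g x) = x := by
    rintro _ ⟨w, hw, rfl⟩
    obtain ⟨g, hg, hg'⟩ := exists_smooth_local_inverse hv hVi h₀₁ h₁₂ hFt hw ((he w hw _).2 rfl)
    refine ⟨g, hg, ?_⟩
    filter_upwards [hg'] with x hx
    exact ⟨hx.1, ((he _ hx.1 x).1 hx.2).symm⟩
  have hdirector : ∀ p ∈ S, ∃ i, p ∈ V i := fun p hp => ⟨hp.2.choose, hp.2.choose_spec.1⟩
  have hSU : S ⊆ e '' B := by
    intro p hp
    obtain ⟨i, W, Φ, hW, hΦ⟩ := h₁₂.2.2 p hp.1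
    have hw := mem_band_of_director (hv i) (hΦ.mem_of_mem hW).1 hp (c := 0) (ρ := R / 2)
      (by rw [abs_zero]; positivity)
    refine ⟨_, hw, ?_⟩
    have := (hΦ.isExp_iff (hv i) (hVi i) inter_subset_left hW
      (⟨by linarith, hR⟩ : (0 : ℝ) ∈ Ioo (-R) R) p).2 (hΦ.2.2.2.1 p hW).symm
    exact ((he _ hw p).1 this).symm
  have hLU : L ⊆ e '' B := by
    intro q hq
    obtain ⟨w, hw, hwq⟩ := exists_isExp_of_abs_le hv hN₂₀ h₂₃ hFt (δ := R / 4) (by linarith)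
      (hL₃ hq) (fun i hi => hFL i q ⟨hq, hi⟩)
    exact ⟨w, hw, ((he w hw q).1 hwq).symm⟩
  obtain ⟨g, hgB⟩ : ∃ g : M → TangentBundle I M, ∀ w ∈ B, g (e w) = w := by
    have : ∀ q : M, ∃ w : TangentBundle I M, q ∈ e '' B → w ∈ B ∧ e w = q := by
      intro q
      by_cases hq : q ∈ e '' B
      · exact ⟨hq.choose, fun _ => hq.choose_spec⟩
      · exact ⟨⟨q, 0⟩, fun h => absurd h hq⟩
    choose g hg using this
    exact ⟨g, fun w hw => hinj (hg _ ⟨w, hw, rfl⟩).1 hw (hg _ ⟨w, hw, rfl⟩).2⟩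
  refine ⟨e '' B, S, ENNReal.ofReal (R / 2), ?_, hLU, ENNReal.ofReal_pos.2 (by positivity),
    isSmoothSurface_levelSurface hv hVi h₁₂.1 hN₂₀ hFt, hSU, e, he, ⟨hinj.bijOn_image, ?_, g, ?_, ?_⟩,
    fun q => (g q).proj, ?_, fun w hw => congrArg TotalSpace.proj (hgB w hw), ?_⟩
  · refine isOpen_iff_mem_nhds.2 fun q hq => ?_
    obtain ⟨g', _, hg'⟩ := hlocal q hq
    filter_upwards [hg'] with x hx
    exact ⟨_, hx.1, hx.2⟩
  · intro w hw
    obtain ⟨f, hf, hf'⟩ := exists_smooth_local_exp hv hVi h₁₂ hw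
    refine hf.contMDiffWithinAt.congr_of_eventuallyEq ?_ ((hf'.self_of_nhds hw _).1
      ((he w hw _).2 rfl))
    filter_upwards [mem_nhdsWithin_of_mem_nhds hf', self_mem_nhdsWithin] with x hx hxB
    exact (hx hxB _).1 ((he x hxB _).2 rfl)
  · refine ⟨hgB, ?_⟩
    rintro _ ⟨w, hw, rfl⟩
    rw [hgB w hw]
  · intro q hq
    obtain ⟨g', hg's, hg'⟩ := hlocal q hq
    refine (hg's.congr_of_eventuallyEq ?_).contMDiffWithinAt
    filter_upwards [hg'] with x hx
    rw [← hgB _ hx.1, hx.2]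
  · rintro _ ⟨w, hw, rfl⟩
    change (g (e w)).proj ∈ S
    rw [hgB w hw]
    exact hw.1
  · intro q₁ hq₁ q₂ hq₂ hpr
    obtain ⟨w₁, hw₁, rfl⟩ := hLU hq₁
    obtain ⟨w₂, hw₂, rfl⟩ := hLU hq₂
    simp only [hgB _ hw₁, hgB _ hw₂] at hpr
    obtain ⟨i, W, Φ, hW, hΦ⟩ := h₁₂.2.2 _ hw₁.1.1
    have hpi : w₁.proj ∈ V i := (hΦ.mem_of_mem hW).1
    obtain ⟨c₁, hc₁, hwc₁⟩ := exists_coefficient_of_mem_band (hv i) hw₁ hpi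
    obtain ⟨c₂, hc₂, hwc₂⟩ := exists_coefficient_of_mem_band (hv i) hw₂ (by rw [← hpr]; exact hpi)
    rw [← hpr] at hwc₂
    have hI₁ : c₁ ∈ Ioo (-R) R := abs_lt.1 (by linarith)
    have hI₂ : c₂ ∈ Ioo (-R) R := abs_lt.1 (by linarith)
    have he₁ : e w₁ = Φ w₁.proj c₁ :=
      (hΦ.isExp_iff (hv i) (hVi i) inter_subset_left hW hI₁ _).1
        (by rw [← hwc₁]; exact (he _ hw₁ _).2 rfl)
    have he₂ : e w₂ = Φ w₁.proj c₂ :=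
      (hΦ.isExp_iff (hv i) (hVi i) inter_subset_left hW hI₂ _).1
        (by rw [← hwc₂]; exact (he _ hw₂ _).2 rfl)
    have hm₁ : e w₁ ∈ V i := by rw [he₁]; exact (hΦ.2.2.1 _ hW _ hI₁).1
    have hm₂ : e w₂ ∈ V i := by rw [he₂]; exact (hΦ.2.2.1 _ hW _ hI₂).1
    -- for every `δ` some family is at most `δ / 2` at both points, which bounds their time distance
    have hle : |c₁ - c₂| ≤ 0 := by
      refine le_of_forall_pos_le_add fun δ hδ => ?_
      obtain ⟨G, hG, hGL⟩ := hF (δ / 2) (by positivity)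
      have h1 := hG.abs_sub_le_abs_sub (h₀₁.2.1) (hv i).isOpen hΦ hW hI₂ hI₁
      rw [← he₁, ← he₂] at h1
      have h2 := hGL i _ ⟨hq₁, hm₁⟩
      have h3 := hGL i _ ⟨hq₂, hm₂⟩
      have h4 := abs_sub (G i (e w₁)) (G i (e w₂))
      linarith
    have hcc : c₁ = c₂ := sub_eq_zero.1 (abs_eq_zero.1 (le_antisymm hle (abs_nonneg _)))
    rw [he₁, he₂, hcc]

end Band

/-! ### Gluing local height functions -/

section Gluing

universe u

variable {H : Type*} [TopologicalSpace H] {I : ModelWithCorners ℝ E3 H}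
  {M : Type u} [TopologicalSpace M] [ChartedSpace H M] [IsManifold I ∞ M]
  {l : LineElementField I M}

lemma derivAlong_eq {w : ∀ p : M, TangentSpace I p} {F : M → ℝ} {q : M}
    {A : TangentSpace I q →L[ℝ] ℝ} (h : HasMFDerivAt I 𝓘(ℝ, ℝ) F q A) :
    derivAlong I w F q = A (w q) := DFunLike.congr_fun h.mfderiv (w q)

lemma derivAlong_congr {w : ∀ p : M, TangentSpace I p} {F G : M → ℝ} {q : M}
    (h : F =ᶠ[𝓝 q] G) : derivAlong I w F q = derivAlong I w G q := by
  exact DFunLike.congr_fun (congrArg (fun A : E3 →L[ℝ] ℝ => A) h.mfderiv_eq) (w q)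

lemma derivAlong_mul {w : ∀ p : M, TangentSpace I p} {F G : M → ℝ} {q : M}
    (hF : MDifferentiableAt I 𝓘(ℝ, ℝ) F q) (hG : MDifferentiableAt I 𝓘(ℝ, ℝ) G q) :
    derivAlong I w (fun x => F x * G x) q =
      F q * derivAlong I w G q + G q * derivAlong I w F q :=
  derivAlong_eq (hF.hasMFDerivAt.mul hG.hasMFDerivAt)

lemma derivAlong_const_mul {w : ∀ p : M, TangentSpace I p} {F : M → ℝ} {q : M} (c : ℝ)
    (hF : MDifferentiableAt I 𝓘(ℝ, ℝ) F q) :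
    derivAlong I w (fun x => c * F x) q = c * derivAlong I w F q :=
  derivAlong_eq (hF.hasMFDerivAt.const_smul c)

lemma derivAlong_add {w : ∀ p : M, TangentSpace I p} {F G : M → ℝ} {q : M}
    (hF : MDifferentiableAt I 𝓘(ℝ, ℝ) F q) (hG : MDifferentiableAt I 𝓘(ℝ, ℝ) G q) :
    derivAlong I w (fun x => F x + G x) q = derivAlong I w F q + derivAlong I w G q :=
  derivAlong_eq (hF.hasMFDerivAt.add hG.hasMFDerivAt)

lemma derivAlong_sum {ι : Type*} (t : Finset ι) {w : ∀ p : M, TangentSpace I p}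
    {F : ι → M → ℝ} {q : M} (hF : ∀ i ∈ t, MDifferentiableAt I 𝓘(ℝ, ℝ) (F i) q) :
    MDifferentiableAt I 𝓘(ℝ, ℝ) (fun x => ∑ i ∈ t, F i x) q ∧
      derivAlong I w (fun x => ∑ i ∈ t, F i x) q = ∑ i ∈ t, derivAlong I w (F i) q := by
  classical
  induction t using Finset.induction_on with
  | empty =>
    simp only [Finset.sum_empty]
    exact ⟨mdifferentiableAt_const, derivAlong_eq (hasMFDerivAt_const (0 : ℝ) q)⟩
  | insert i s hi ih =>
    obtain ⟨h1, h2⟩ := ih fun j hj => hF j (Finset.mem_insert_of_mem hj)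
    have h3 := hF i (Finset.mem_insert_self i s)
    simp only [Finset.sum_insert hi]
    exact ⟨h3.add h1, by rw [derivAlong_add h3 h1, h2]⟩

lemma derivAlong_smul_field {w w' : ∀ p : M, TangentSpace I p} {F : M → ℝ} {q : M} {c : ℝ}
    (h : w q = c • w' q) : derivAlong I w F q = c * derivAlong I w' F q := by
  unfold derivAlong
  rw [h]
  exact map_smul (mfderiv I 𝓘(ℝ, ℝ) F q) c (w' q)

open Classical in
/-- The sign relating two vector fields which agree up to sign. -/
def relSign (w w' : ∀ p : M, TangentSpace I p) (q : M) : ℝ := if w q = w' q then 1 else -1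

lemma relSign_eq_or (w w' : ∀ p : M, TangentSpace I p) (q : M) :
    relSign w w' q = 1 ∨ relSign w w' q = -1 := by
  unfold relSign; split_ifs <;> simp

lemma relSign_eq {w w' : ∀ p : M, TangentSpace I p} {q : M} (h0 : w' q ≠ 0) {σ : ℝ}
    (hσ : σ = 1 ∨ σ = -1) (h : w q = σ • w' q) : relSign w w' q = σ := by
  unfold relSign
  rcases hσ with rfl | rfl
  · rw [if_pos (by rw [h, one_smul])]
  · rw [if_neg]
    intro h1
    rw [h1] at h
    have h2 : (2 : ℝ) • w' q = 0 := by
      rw [two_smul]; nth_rewrite 1 [h]; rw [neg_one_smul, neg_add_cancel]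
    rcases smul_eq_zero.1 h2 with h3 | h3
    · norm_num at h3
    · exact h0 h3

section

variable {w w' : ∀ p : M, TangentSpace I p} {V V' : Set M}

lemma IsDirector.eq_relSign_smul (hv : IsDirector l w V) (hv' : IsDirector l w' V') {q : M}
    (hq : q ∈ V) (hq' : q ∈ V') : w q = relSign w w' q • w' q := by
  obtain ⟨σ, hσ, h⟩ := hv'.eq_or_eq_neg hq' (w := w q) (by rw [hv.elem_eq q hq]; exact Or.inl rfl)
  rw [relSign_eq (hv'.ne_zero q hq') hσ h]
  exact h

lemma IsDirector.eventually_relSign_eq (hv : IsDirector l w V) (hv' : IsDirector l w' V') {q : M}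
    (hq : q ∈ V) (hq' : q ∈ V') : ∀ᶠ x in 𝓝 q, relSign w w' x = relSign w w' q := by
  have hev := eventually_eq_smul_of_eq_or_neg (b := fun x : M => x) (w₁ := w) (w₂ := w')
    (hv.contMDiffAt hq).continuousAt (hv'.contMDiffAt hq').continuousAt (hv'.ne_zero q hq')
    (by
      filter_upwards [hv.isOpen.mem_nhds hq, hv'.isOpen.mem_nhds hq'] with x hx hx'
      obtain ⟨σ, hσ, h⟩ := hv'.eq_or_eq_neg hx' (w := w x)
        (by rw [hv.elem_eq x hx]; exact Or.inl rfl)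
      rcases hσ with rfl | rfl
      · exact Or.inl (by rw [h, one_smul])
      · exact Or.inr (by rw [h, neg_one_smul]))
    (relSign_eq_or w w' q) (hv.eq_relSign_smul hv' hq hq')
  filter_upwards [hev, hv'.isOpen.mem_nhds hq'] with x hx hx'
  exact relSign_eq (hv'.ne_zero x hx') (relSign_eq_or w w' q) hx

/-- A bump function times a local height function, with the sign which makes it depend only on
the line elements: it is smooth, and so is its derivative along a director. -/
lemma glueTerm (hv : IsDirector l w V) (hv' : IsDirector l w' V') {b f : M → ℝ}
    (hb : ContMDiff I 𝓘(ℝ, ℝ) ∞ b) (hbV : tsupport b ⊆ V) (hf : ContMDiffOn I 𝓘(ℝ, ℝ) ∞ f V)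
    {q : M} (hq' : q ∈ V') :
    ContMDiffAt I 𝓘(ℝ, ℝ) ∞ (fun x => b x * f x * relSign w' w x) q ∧
      derivAlong I w' (fun x => b x * f x * relSign w' w x) q =
        b q * derivAlong I w f q + f q * derivAlong I w b q := by
  by_cases hq : q ∈ tsupport b
  · have hqV := hbV hq
    set σ := relSign w' w q with hσ
    have hfq : ContMDiffAt I 𝓘(ℝ, ℝ) ∞ f q := hf.contMDiffAt (hv.isOpen.mem_nhds hqV)
    have hbf : ContMDiffAt I 𝓘(ℝ, ℝ) ∞ (fun x => b x * f x) q := (hb q).mul hfq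
    have heq : (fun x => b x * f x * relSign w' w x) =ᶠ[𝓝 q] fun x => σ * (b x * f x) := by
      filter_upwards [hv'.eventually_relSign_eq hv hq' hqV] with x hx
      rw [hx, mul_comm]
    have hσσ : σ * σ = 1 := by rcases relSign_eq_or w' w q with h | h <;> rw [hσ, h] <;> norm_num
    refine ⟨(contMDiffAt_const.mul hbf).congr_of_eventuallyEq heq, ?_⟩
    rw [derivAlong_congr heq, derivAlong_const_mul _ (hbf.mdifferentiableAt (by simp)),
      derivAlong_smul_field (hv'.eq_relSign_smul hv hq' hqV), ← mul_assoc, ← hσ, hσσ, one_mul,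
      derivAlong_mul ((hb q).mdifferentiableAt (by simp)) (hfq.mdifferentiableAt (by simp))]
  · have hb0 : b =ᶠ[𝓝 q] fun _ => 0 := notMem_tsupport_iff_eventuallyEq.1 hq
    have heq : (fun x => b x * f x * relSign w' w x) =ᶠ[𝓝 q] fun _ => 0 := by
      filter_upwards [hb0] with x hx
      rw [hx, zero_mul, zero_mul]
    have h0 : ∀ u : ∀ p : M, TangentSpace I p, derivAlong I u (fun _ : M => (0 : ℝ)) q = 0 :=
      fun u => derivAlong_eq (hasMFDerivAt_const (0 : ℝ) q)
    refine ⟨contMDiffAt_const.congr_of_eventuallyEq heq, ?_⟩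
    rw [derivAlong_congr heq, derivAlong_congr hb0, h0, h0, hb0.self_of_nhds]
    ring

end

/-- Near `p`, the set `L` is contained in the zero set of a continuous function `h` that is a
uniform limit of smooth functions growing at least at unit rate along the line elements. -/
def HasHeight (l : LineElementField I M) (L : Set M) (p : M) : Prop :=
  ∃ (V : Set M) (v : ∀ p : M, TangentSpace I p) (h : M → ℝ), IsDirector l v V ∧
    V ⊆ I.interior M ∧ p ∈ V ∧ ContinuousOn h V ∧ (∀ q ∈ L ∩ V, h q = 0) ∧
    ∀ δ : ℝ, 0 < δ → ∃ f : M → ℝ, ContMDiffOn I 𝓘(ℝ, ℝ) ∞ f V ∧ (∀ q ∈ V, |f q - h q| ≤ δ) ∧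
      ∀ q ∈ V, 1 ≤ derivAlong I v f q

set_option maxHeartbeats 1000000 in
/-- Local height functions along a compact set can be glued, near that set, to families of
functions growing at unit rate along the line elements. -/
theorem exists_transverseFamily [T2Space M] {L : Set M} (hL : IsCompact L)
    (hh : ∀ p ∈ L, HasHeight l L p) :
    ∃ (ι : Type u) (V : ι → Set M) (v : ι → ∀ p : M, TangentSpace I p) (N₀ : Set M),
      (∀ i, IsDirector l (v i) (V i)) ∧ (∀ i, V i ⊆ I.interior M) ∧ IsOpen N₀ ∧ L ⊆ N₀ ∧
      L ⊆ ⋃ i, V i ∧ ∀ δ : ℝ, 0 < δ → ∃ F : ι → M → ℝ, IsTransverseFamily I v V N₀ F ∧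
        ∀ i, ∀ q ∈ L ∩ V i, |F i q| ≤ δ := by
  have hdata : ∀ p : L, HasHeight l L p := fun p => hh p p.2
  choose V₀ v₀ h₀ hdir hint hmem hcont hzero happrox using hdata
  have hbump : ∀ p : L, ∃ b : M → ℝ, ContMDiff I 𝓘(ℝ, ℝ) ∞ b ∧ (∀ q, 0 ≤ b q) ∧
      (∀ q, b q ≤ 1) ∧ b =ᶠ[𝓝 (p : M)] 1 ∧ HasCompactSupport b ∧ tsupport b ⊆ V₀ p := by
    intro p
    obtain ⟨b, -, hb⟩ := (SmoothBumpFunction.nhds_basis_tsupport (I := I) (p : M)).mem_iff.1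
      ((hdir p).isOpen.mem_nhds (hmem p))
    exact ⟨b, b.contMDiff, fun _ => b.nonneg, fun _ => b.le_one, b.eventuallyEq_one,
      b.hasCompactSupport, hb⟩
  choose b₀ hbs hb0 hb1 hbone hbc hbV using hbump
  obtain ⟨t, ht⟩ := hL.elim_finite_subcover (fun p : L => interior {q | b₀ p q = 1})
    (fun p => isOpen_interior) (fun p hp => mem_iUnion.2 ⟨⟨p, hp⟩,
      mem_interior_iff_mem_nhds.2 (hbone ⟨p, hp⟩)⟩)
  -- a common bound of the derivatives of the bump functions along the directors
  obtain ⟨C, hC0, hC⟩ : ∃ C : ℝ, 0 ≤ C ∧ ∀ p ∈ t, ∀ q ∈ tsupport (b₀ p),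
      |derivAlong I (v₀ p) (b₀ p) q| ≤ C := by
    have h1 : ∀ p : L, ∃ C : ℝ, 0 ≤ C ∧ ∀ q ∈ tsupport (b₀ p),
        |derivAlong I (v₀ p) (b₀ p) q| ≤ C := by
      intro p
      have hc : ContinuousOn (derivAlong I (v₀ p) (b₀ p)) (V₀ p) :=
        continuousOn_mfderiv_apply (hdir p).isOpen (hdir p).smooth.continuousOn
          (hbs p).contMDiffOn
      obtain ⟨C, hC⟩ := (hbc p).exists_bound_of_continuousOn (hc.mono (hbV p))
      exact ⟨max C 0, le_max_right _ _, fun q hq => (hC q hq).trans (le_max_left _ _)⟩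
    choose C hC0 hC using h1
    exact ⟨∑ p ∈ t, C p, Finset.sum_nonneg fun p _ => hC0 p, fun p hp q hq =>
      (hC p q hq).trans (Finset.single_le_sum (fun p _ => hC0 p) hp)⟩
  set n : ℝ := (t.card : ℝ) with hn
  have hn0 : 0 ≤ n := Nat.cast_nonneg _
  -- where all local heights are below `2 κ`, the terms with derivatives of bump functions add up to
  -- at most `1 / 2`, while the bump function equal to one contributes at least one
  set κ : ℝ := 1 / (4 * (n * C + 1)) with hκ
  have hnC : 0 ≤ n * C := mul_nonneg hn0 hC0
  have hκ0 : 0 < κ := by positivity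
  have hκC : n * (2 * κ * C) ≤ 1 / 2 := by
    have : n * (2 * κ * C) = (n * C) / (2 * (n * C + 1)) := by rw [hκ]; field_simp; ring
    rw [this, div_le_div_iff₀ (by positivity) two_pos]
    linarith
  -- some bump function is locally one on `N₀`, and all local heights are small there
  set N₀ : Set M := (⋃ p ∈ t, interior {q | b₀ p q = 1}) ∩
    ⋂ p ∈ t, {q | q ∈ tsupport (b₀ p) → |h₀ p q| < κ} with hN₀
  have hN₀o : IsOpen N₀ := by
    refine (isOpen_biUnion fun p _ => isOpen_interior).inter
      (isOpen_biInter_finset fun p _ => ?_)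
    have hcl : IsClosed (tsupport (b₀ p) ∩ (fun q => |h₀ p q|) ⁻¹' Ici κ) :=
      (((hcont p).mono (hbV p)).abs).preimage_isClosed_of_isClosed (isClosed_tsupport _)
        isClosed_Ici
    convert hcl.isOpen_compl using 1
    ext q
    simp only [mem_ofPred_eq, mem_compl_iff, mem_inter_iff, mem_preimage, mem_Ici, not_and, not_le]
  refine ⟨t, fun p => V₀ p, fun p => v₀ p, N₀, fun p => hdir p, fun p => hint p, hN₀o, ?_, ?_, ?_⟩
  · refine fun q hq => ⟨ht hq, mem_iInter₂.2 fun p _ hqp => ?_⟩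
    rw [hzero p q ⟨hq, hbV p hqp⟩, abs_zero]
    exact hκ0
  · intro q hq
    obtain ⟨p, hp, hqp⟩ := mem_iUnion₂.1 (ht hq)
    have h1 : b₀ p q = 1 := (interior_subset hqp : q ∈ {q | b₀ p q = 1})
    refine mem_iUnion.2 ⟨⟨p, hp⟩, hbV p (subset_tsupport _ ?_)⟩
    rw [Function.mem_support, h1]
    exact one_ne_zero
  intro δ hδ
  set δ' : ℝ := min κ (δ / (2 * (n + 1))) with hδ'
  have hδ'0 : 0 < δ' := lt_min hκ0 (by positivity)
  choose f hfs hfh hfd using fun p => happrox p δ' hδ'0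
  set T : L → L → M → ℝ := fun p p' x => b₀ p x * f p x * relSign (v₀ p') (v₀ p) x with hT
  have hterm := fun p p' q (hq : q ∈ V₀ p') => glueTerm (hdir p) (hdir p') (hbs p) (hbV p) (hfs p) hq
  -- the factor `2` turns the growth rate `1 / 2` of the sum into a unit rate
  refine ⟨fun p' x => 2 * ∑ p ∈ t, T p p' x, ⟨?_, ?_, ?_⟩, ?_⟩
  · intro p' q hq
    refine ContMDiffAt.contMDiffWithinAt ?_
    exact contMDiffAt_const.mul (contMDiffAt_finsetSum fun p _ => (hterm p p' q hq).1)
  · rintro p' p'' q ⟨hq', hq''⟩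
    have hrel : ∑ p ∈ t, T p p' q =
        relSign (v₀ p') (v₀ p'') q * ∑ p ∈ t, T p p'' q := by
      rw [Finset.mul_sum]
      refine Finset.sum_congr rfl fun p _ => ?_
      simp only [hT]
      by_cases hqp : q ∈ tsupport (b₀ p)
      · have hqV := hbV p hqp
        have h1 := (hdir p').eq_relSign_smul (hdir p'') hq' hq''
        have h2 := (hdir p'').eq_relSign_smul (hdir p) hq'' hqV
        rw [h2, smul_smul] at h1
        have h3 := relSign_eq ((hdir p).ne_zero q hqV) (σ := relSign (v₀ p') (v₀ p'') q *
          relSign (v₀ p'') (v₀ p) q) (by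
            rcases relSign_eq_or (v₀ p') (v₀ p'') q with h | h <;>
            rcases relSign_eq_or (v₀ p'') (v₀ p) q with h' | h' <;> rw [h, h'] <;> norm_num) h1
        rw [h3]; ring
      · rw [image_eq_zero_of_notMem_tsupport hqp]; ring
    rw [hrel]
    rcases relSign_eq_or (v₀ p') (v₀ p'') q with h | h <;> rw [h] <;> simp
  · rintro p' q ⟨⟨hq1, hq2⟩, hq'⟩
    have hdiff := fun p (_ : p ∈ t) => (hterm p p' q hq').1.mdifferentiableAt
      (by simp : (∞ : WithTop ℕ∞) ≠ 0)
    have e1 : derivAlong I (v₀ p') (fun x => 2 * ∑ p ∈ t, T p p' x) q =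
        2 * ∑ p ∈ t, (b₀ p q * derivAlong I (v₀ p) (f p) q +
          f p q * derivAlong I (v₀ p) (b₀ p) q) := by
      rw [derivAlong_const_mul _ (derivAlong_sum t hdiff (w := v₀ p')).1,
        (derivAlong_sum t hdiff).2, Finset.sum_congr rfl fun p _ => (hterm p p' q hq').2]
    have hle : ∀ p ∈ t, b₀ p q - 2 * κ * C ≤ b₀ p q * derivAlong I (v₀ p) (f p) q +
        f p q * derivAlong I (v₀ p) (b₀ p) q := by
      intro p hp
      by_cases hqp : q ∈ tsupport (b₀ p)
      · have hqV := hbV p hqp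
        have h1 : b₀ p q * 1 ≤ b₀ p q * derivAlong I (v₀ p) (f p) q :=
          mul_le_mul_of_nonneg_left (hfd p q hqV) (hb0 p q)
        have h2 : |h₀ p q| < κ := mem_iInter₂.1 hq2 p hp hqp
        have h3 : |f p q| ≤ 2 * κ := by
          have h4 : |f p q| ≤ |f p q - h₀ p q| + |h₀ p q| := by
            have h5 := abs_add_le (f p q - h₀ p q) (h₀ p q)
            rwa [sub_add_cancel] at h5
          have h5 := (hfh p q hqV).trans (min_le_left _ _)
          linarith
        have h4 : |f p q * derivAlong I (v₀ p) (b₀ p) q| ≤ 2 * κ * C := by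
          rw [abs_mul]
          exact mul_le_mul h3 (hC p hp q hqp) (abs_nonneg _) (by positivity)
        linarith [(abs_le.1 h4).1]
      · have hb : b₀ p =ᶠ[𝓝 q] fun _ => 0 := notMem_tsupport_iff_eventuallyEq.1 hqp
        have h0 : derivAlong I (v₀ p) (fun _ : M => (0 : ℝ)) q = 0 :=
          derivAlong_eq (hasMFDerivAt_const (0 : ℝ) q)
        rw [derivAlong_congr hb, h0, hb.self_of_nhds]
        have : 0 ≤ 2 * κ * C := by positivity
        linarith
    have hsum := Finset.sum_le_sum hle
    rw [Finset.sum_sub_distrib, Finset.sum_const, nsmul_eq_mul, ← hn] at hsum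
    obtain ⟨p₁, hp₁, hqp₁⟩ := mem_iUnion₂.1 hq1
    have h1 : b₀ p₁ q = 1 := (interior_subset hqp₁ : q ∈ {q | b₀ p₁ q = 1})
    have h2 : b₀ p₁ q ≤ ∑ p ∈ t, b₀ p q := Finset.single_le_sum (fun p _ => hb0 p q) hp₁
    change 1 ≤ derivAlong I (v₀ p') (fun x => 2 * ∑ p ∈ t, T p p' x) q
    rw [e1]
    linarith
  · rintro p' q ⟨hqL, -⟩
    have hle : ∀ p ∈ t, |T p p' q| ≤ δ' := by
      intro p hp
      simp only [hT, abs_mul]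
      have hs : |relSign (v₀ p') (v₀ p) q| = 1 := by
        rcases relSign_eq_or (v₀ p') (v₀ p) q with h | h <;> rw [h] <;> norm_num
      rw [hs, mul_one, abs_of_nonneg (hb0 p q)]
      by_cases hqp : q ∈ tsupport (b₀ p)
      · have hqV := hbV p hqp
        have h1 := hfh p q hqV
        rw [hzero p q ⟨hqL, hqV⟩, sub_zero] at h1
        calc b₀ p q * |f p q| ≤ 1 * δ' :=
              mul_le_mul (hb1 p q) h1 (abs_nonneg _) zero_le_one
          _ = δ' := one_mul _
      · rw [image_eq_zero_of_notMem_tsupport hqp, zero_mul]; exact hδ'0.le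
    have h1 := (Finset.abs_sum_le_sum_abs (fun p => T p p' q) t).trans (Finset.sum_le_sum hle)
    rw [Finset.sum_const, nsmul_eq_mul, ← hn] at h1
    have h2 : n * δ' ≤ δ / 2 := by
      have : δ' ≤ δ / (2 * (n + 1)) := min_le_right _ _
      calc n * δ' ≤ n * (δ / (2 * (n + 1))) := mul_le_mul_of_nonneg_left this hn0
        _ = (n / (n + 1)) * (δ / 2) := by field_simp
        _ ≤ 1 * (δ / 2) := by
          refine mul_le_mul_of_nonneg_right ?_ (by positivity)
          rw [div_le_one (by positivity)]; linarith
        _ = δ / 2 := one_mul _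
    rw [abs_mul, abs_two]
    linarith

end Gluing

/-! ### Height functions from the chord condition -/

open MeasureTheory in
/-- A Lipschitz function is a uniform limit of smooth functions with the same Lipschitz constant,
namely of its mollifications. -/
lemma exists_contDiff_lipschitzWith {E : Type*} [NormedAddCommGroup E] [NormedSpace ℝ E]
    [FiniteDimensional ℝ E] {g : E → ℝ} {K : ℝ≥0} (hg : LipschitzWith K g) {δ : ℝ} (hδ : 0 < δ) :
    ∃ g' : E → ℝ, ContDiff ℝ ∞ g' ∧ LipschitzWith K g' ∧ ∀ x, |g' x - g x| ≤ δ := by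
  borelize E
  set μ : Measure E := Measure.addHaar
  set r : ℝ := δ / (K + 1) with hr
  have hr0 : 0 < r := by positivity
  set φ : ContDiffBump (0 : E) := ⟨r / 2, r, half_pos hr0, half_lt_self hr0⟩
  have hloc : LocallyIntegrable g μ := hg.continuous.locallyIntegrable
  refine ⟨convolution (φ.normed μ) g (ContinuousLinearMap.lsmul ℝ ℝ) μ,
    φ.hasCompactSupport_normed.contDiff_convolution_left _ φ.contDiff_normed hloc, ?_, ?_⟩
  · have hint : ∀ x, Integrable (fun t => φ.normed μ t * g (x - t)) μ := fun x =>
      φ.hasCompactSupport_normed.convolutionExists_left (ContinuousLinearMap.lsmul ℝ ℝ)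
        φ.continuous_normed hloc x
    refine LipschitzWith.of_dist_le_mul fun x y => ?_
    change dist (∫ t, φ.normed μ t * g (x - t) ∂μ) (∫ t, φ.normed μ t * g (y - t) ∂μ) ≤ _
    rw [dist_eq_norm, ← integral_sub (hint x) (hint y)]
    calc ‖∫ t, (φ.normed μ t * g (x - t) - φ.normed μ t * g (y - t)) ∂μ‖
        ≤ ∫ t, φ.normed μ t * (K * dist x y) ∂μ := by
          refine norm_integral_le_of_norm_le (φ.integrable_normed.mul_const _)
            (Eventually.of_forall fun t => ?_)
          rw [← mul_sub, norm_mul, Real.norm_of_nonneg (φ.nonneg_normed t)]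
          refine mul_le_mul_of_nonneg_left ?_ (φ.nonneg_normed t)
          have := hg.dist_le_mul (x - t) (y - t)
          rwa [dist_sub_right, Real.dist_eq] at this
      _ = K * dist x y := by
          rw [integral_mul_const, φ.integral_normed, one_mul]
  · intro x
    rw [← Real.dist_eq]
    refine φ.dist_normed_convolution_le hg.continuous.aestronglyMeasurable fun y hy => ?_
    refine (hg.dist_le_mul y x).trans ?_
    have h1 : dist y x ≤ r := (Metric.mem_ball.1 hy).le
    calc (K : ℝ) * dist y x ≤ K * r := mul_le_mul_of_nonneg_left h1 K.2
      _ ≤ (K + 1) * r := by nlinarith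
      _ = δ := by rw [hr]; field_simp

/-- A functional which vanishes on the plane `P` is small on the vectors which make a small angle
with `P`. -/
lemma abs_le_of_angleToPlane_lt {P : Submodule ℝ E3} {A : E3 →L[ℝ] ℝ} (hA : ∀ u ∈ P, A u = 0)
    (hP : ∃ u ∈ P, u ≠ 0) {w : E3} {ε : ℝ} (h : angleToPlane w P < ε) :
    |A w| ≤ ‖A‖ * (ε * ‖w‖) := by
  obtain ⟨u₀, hu₀, hu₀0⟩ := hP
  obtain ⟨θ, ⟨u, hu, hu0, rfl⟩, hθ⟩ := exists_lt_of_csInf_lt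
    (⟨_, u₀, hu₀, hu₀0, rfl⟩ : {θ | ∃ u ∈ P, u ≠ 0 ∧ θ = InnerProductGeometry.angle w u}.Nonempty) h
  set c : ℝ := inner ℝ w u / (‖u‖ * ‖u‖) with hc
  have hu' : 0 < ‖u‖ := norm_pos_iff.2 hu0
  have h1 : A w = A (w - c • u) := by rw [map_sub, map_smul, hA u hu, smul_zero, sub_zero]
  have h2 : ‖w - c • u‖ = Real.sin (InnerProductGeometry.angle w u) * ‖w‖ := by
    have h3 := InnerProductGeometry.sin_angle_mul_norm_mul_norm w u
    rw [real_inner_self_eq_norm_mul_norm, real_inner_self_eq_norm_mul_norm] at h3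
    have h4 : ‖w - c • u‖ * ‖w - c • u‖ = ‖w‖ * ‖w‖ - inner ℝ w u * inner ℝ w u / (‖u‖ * ‖u‖) := by
      rw [← real_inner_self_eq_norm_mul_norm, inner_sub_left, inner_sub_right, inner_sub_right,
        real_inner_smul_left, real_inner_smul_right, real_inner_smul_left, real_inner_smul_right,
        real_inner_self_eq_norm_mul_norm, real_inner_self_eq_norm_mul_norm,
        real_inner_comm w u, hc]
      field_simp
      ring
    have h5 : ‖w - c • u‖ * ‖u‖ = √(‖w‖ * ‖w‖ * (‖u‖ * ‖u‖) - inner ℝ w u * inner ℝ w u) := by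
      rw [← Real.sqrt_mul_self (mul_nonneg (norm_nonneg (w - c • u)) hu'.le)]
      congr 1
      have h6 : ‖w - c • u‖ * ‖u‖ * (‖w - c • u‖ * ‖u‖) =
          ‖w - c • u‖ * ‖w - c • u‖ * (‖u‖ * ‖u‖) := by ring
      rw [h6, h4]
      field_simp
    rw [← h3] at h5
    have : ‖w - c • u‖ * ‖u‖ = (Real.sin (InnerProductGeometry.angle w u) * ‖w‖) * ‖u‖ := by
      rw [h5]; ring
    exact mul_right_cancel₀ hu'.ne' this
  rw [h1]
  refine (A.le_opNorm _).trans (mul_le_mul_of_nonneg_left ?_ (norm_nonneg A))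
  rw [h2]
  refine mul_le_mul_of_nonneg_right ?_ (norm_nonneg w)
  exact (Real.sin_le (InnerProductGeometry.angle_nonneg w u)).trans hθ.le

section Heights

variable {H : Type*} [TopologicalSpace H] {I : ModelWithCorners ℝ E3 H}
  {M : Type*} [TopologicalSpace M] [ChartedSpace H M] [IsManifold I ∞ M]

lemma mfderiv_extend_injective {φ : OpenPartialHomeomorph M H}
    (hφ : φ ∈ IsManifold.maximalAtlas I 1 M) {p : M} (hp : p ∈ φ.source) :
    Function.Injective (mfderiv I 𝓘(ℝ, E3) (φ.extend I) p) := by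
  have hd : φ.MDifferentiable I I :=
    ⟨(contMDiffOn_of_mem_maximalAtlas hφ).mdifferentiableOn one_ne_zero,
      (contMDiffOn_symm_of_mem_maximalAtlas hφ).mdifferentiableOn one_ne_zero⟩
  have h1 := (I.hasMFDerivAt (x := φ p)).comp p (hd.mdifferentiableAt hp).hasMFDerivAt
  have h2 : mfderiv I 𝓘(ℝ, E3) (φ.extend I) p = _ := h1.mfderiv
  rw [h2]
  exact hd.mfderiv_injective hp

/-- In the preferred chart at a point `p` of a Legendrian curve, the chords of the curve near `p`
are almost tangent to the plane at `p`. -/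
lemma IsLegendrian.exists_chord_le {ξ : ∀ p : M, Submodule ℝ (TangentSpace I p)} {L : Set M}
    (hL : IsLegendrian I ξ L) {p : M} (hp : p ∈ L) (hpi : p ∈ I.interior M)
    {A : E3 →L[ℝ] ℝ} (hA : ∀ x : E3, x ∈ ξ p ↔ A x = 0) {ε : ℝ} (hε : 0 < ε) :
    ∃ U : Set M, IsOpen U ∧ p ∈ U ∧ ∀ p' ∈ L ∩ U, ∀ p'' ∈ L ∩ U,
      |A (extChartAt I p p'' - extChartAt I p p')| ≤
        ε * ‖extChartAt I p p'' - extChartAt I p p'‖ := by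
  obtain ⟨φ, hφ, hpφ, hchord⟩ := hL.2 p hp
  set χ := extChartAt I p with hχ
  have htgt : χ.target ∈ 𝓝 (χ p) := mem_interior_iff_mem_nhds.1 (I.isInteriorPoint_iff.1 hpi)
  -- the change from the preferred chart to the chart in which chords are controlled; by strict
  -- differentiability it acts on short chords almost as its derivative `B` at `p`
  set T : E3 → E3 := fun y => φ.extend I (χ.symm y) with hT
  have hinv : χ.symm (χ p) = p := extChartAt_to_inv p
  have hψ : ContMDiffAt I 𝓘(ℝ, E3) 1 (φ.extend I) p := φ.contMDiffAt_extend hφ hpφ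
  have hTs : ContDiffAt ℝ 1 T (χ p) := by
    have h1 : ContMDiffAt 𝓘(ℝ, E3) I 1 χ.symm (χ p) :=
      (contMDiffOn_extChartAt_symm p).contMDiffAt htgt
    refine contMDiffAt_iff_contDiffAt.1 (ContMDiffAt.comp (χ p) (g := φ.extend I) ?_ h1)
    rw [hinv]; exact hψ
  obtain ⟨B, hB, hBe⟩ : ∃ B : E3 →L[ℝ] E3, HasStrictFDerivAt T B (χ p) ∧
      B = mfderiv I 𝓘(ℝ, E3) (φ.extend I) p := by
    refine ⟨_, hTs.hasStrictFDerivAt one_ne_zero, ?_⟩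
    have h1 := (hψ.mdifferentiableAt one_ne_zero).mfderiv
    have h2 : fderivWithin ℝ (writtenInExtChartAt I 𝓘(ℝ, E3) p (φ.extend I)) (range I) (χ p) =
        fderiv ℝ T (χ p) := by
      rw [fderivWithin_of_mem_nhds (mem_of_superset htgt (extChartAt_target_subset_range p))]
      rfl
    exact (h1.trans h2).symm
  have hBinj : Function.Injective B := by
    rw [hBe]; exact mfderiv_extend_injective hφ hpφ
  set Be : E3 ≃L[ℝ] E3 := (LinearEquiv.ofInjectiveEndo (B : E3 →ₗ[ℝ] E3) hBinj).toContinuousLinearEquiv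
  have hBeB : ∀ x, Be x = B x := fun x => rfl
  set A' : E3 →L[ℝ] ℝ := A.comp (Be.symm : E3 →L[ℝ] E3) with hA'
  have hA'B : ∀ x, A' (B x) = A x := fun x => by
    rw [← hBeB]; simp [hA']
  set P : Submodule ℝ E3 := (ξ p).map (mfderiv I 𝓘(ℝ, E3) (φ.extend I) p).toLinearMap with hP
  have hP0 : ∀ u ∈ P, A' u = 0 := by
    rintro u ⟨x, hx, rfl⟩
    have h1 : mfderiv I 𝓘(ℝ, E3) (φ.extend I) p x = B x := by rw [hBe]; rfl
    exact (congrArg A' h1).trans ((hA'B x).trans ((hA x).1 hx))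
  have hPne : ∃ u ∈ P, u ≠ 0 := by
    obtain ⟨x, hx, hx0⟩ := (Submodule.ne_bot_iff _).1
      (LinearMap.ker_ne_bot_of_finrank_lt (f := (A : E3 →ₗ[ℝ] ℝ)) (by simp))
    refine ⟨B x, ⟨x, (hA x).2 hx, ?_⟩, fun h => hx0 (hBinj (h.trans (map_zero B).symm))⟩
    rw [hBe]; rfl
  -- the angle condition and the error of linearization each contribute at most `ε / 2`
  set C : ℝ := ‖A'‖ + 1 with hC
  have hC0 : 0 < C := by positivity
  have hA'C : ‖A'‖ ≤ C := by linarith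
  set a : ℝ := ‖B‖ + 1 with ha
  have ha0 : 0 < a := by positivity
  set η : ℝ≥0 := ⟨min 1 (ε / (2 * C)), by positivity⟩ with hη
  have hη0 : 0 < η := by
    rw [← NNReal.coe_pos]; exact lt_min one_pos (by positivity)
  obtain ⟨s, hs, hsB⟩ := hB.approximates_deriv_on_nhds (Or.inr hη0)
  obtain ⟨U, hUo, hpU, hUφ, hU⟩ := hchord (ε / (2 * C * a)) (by positivity)
  have hnhds : U ∩ (χ.source ∩ χ ⁻¹' s) ∈ 𝓝 p :=
    inter_mem (hUo.mem_nhds hpU) (inter_mem (extChartAt_source_mem_nhds (I := I) p)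
      ((continuousAt_extChartAt (I := I) p).preimage_mem_nhds hs))
  obtain ⟨U', hU', hU'o, hpU'⟩ := mem_nhds_iff.1 hnhds
  refine ⟨U', hU'o, hpU', fun p' hp' p'' hp'' => ?_⟩
  by_cases hne : p' = p''
  · rw [hne, sub_self, map_zero, abs_zero, norm_zero, mul_zero]
  have m' := hU' hp'.2
  have m'' := hU' hp''.2
  have hang := hU p' ⟨hp'.1, m'.1⟩ p'' ⟨hp''.1, m''.1⟩ hne
  have hTx : ∀ q ∈ χ.source, T (χ q) = φ.extend I q := fun q hq => by
    simp only [hT, χ.left_inv hq]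
  have happ := hsB (χ p'') m''.2.2 (χ p') m'.2.2
  rw [hTx _ m'.2.1, hTx _ m''.2.1] at happ
  set w := φ.extend I p'' - φ.extend I p'
  set x := χ p'' - χ p'
  have h1 := abs_le_of_angleToPlane_lt hP0 hPne hang
  have hη1 : (η : ℝ) ≤ 1 := min_le_left _ _
  have hη2 : (η : ℝ) ≤ ε / (2 * C) := min_le_right _ _
  have hx0 := norm_nonneg x
  have hw : ‖w‖ ≤ a * ‖x‖ := by
    have h2 := norm_add_le (w - B x) (B x)
    rw [sub_add_cancel] at h2
    have h3 := B.le_opNorm x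
    have h4 : (η : ℝ) * ‖x‖ ≤ 1 * ‖x‖ := mul_le_mul_of_nonneg_right hη1 hx0
    rw [ha]
    linarith
  have h2 : |A x| ≤ |A' w| + C * (η * ‖x‖) := by
    have e : A x = A' w - A' (w - B x) := by rw [map_sub A' w, hA'B, sub_sub_cancel]
    rw [e]
    refine (abs_sub _ _).trans (add_le_add le_rfl ?_)
    exact (A'.le_opNorm _).trans (mul_le_mul hA'C happ (norm_nonneg _) hC0.le)
  have h3 : |A' w| ≤ C * (ε / (2 * C * a) * (a * ‖x‖)) := by
    refine h1.trans (mul_le_mul hA'C ?_ (by positivity) hC0.le)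
    exact mul_le_mul_of_nonneg_left hw (by positivity)
  have h4 : C * (ε / (2 * C * a) * (a * ‖x‖)) = ε / 2 * ‖x‖ := by field_simp
  have h5 : C * (η * ‖x‖) ≤ ε / 2 * ‖x‖ := by
    calc C * (η * ‖x‖) ≤ C * (ε / (2 * C) * ‖x‖) :=
          mul_le_mul_of_nonneg_left (mul_le_mul_of_nonneg_right hη2 hx0) hC0.le
      _ = ε / 2 * ‖x‖ := by field_simp
  linarith

lemma mfderiv_extChartAt_apply (v : ∀ p : M, TangentSpace I p) {p q : M}
    (hq : q ∈ (extChartAt I p).source) :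
    mfderiv I 𝓘(ℝ, E3) (extChartAt I p) q (v q) = fieldInChart I v p (extChartAt I p q) := by
  have hq' : q ∈ (chartAt H p).source := by rwa [extChartAt_source] at hq
  have e1 := TangentBundle.continuousLinearMapAt_trivializationAt (I := I) hq'
  have e2 := TangentBundle.continuousLinearMapAt_trivializationAt_eq_core (I := I) hq'
  rw [e1] at e2
  refine (DFunLike.congr_fun e2 (v q)).trans ?_
  unfold fieldInChart
  rw [(extChartAt I p).left_inv hq]
  rfl

lemma derivAlong_comp_extChartAt {v : ∀ p : M, TangentSpace I p} {p q : M}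
    (hq : q ∈ (extChartAt I p).source) {G : E3 → ℝ}
    (hG : DifferentiableAt ℝ G (extChartAt I p q)) :
    derivAlong I v (fun x => G (extChartAt I p x)) q =
      fderiv ℝ G (extChartAt I p q) (fieldInChart I v p (extChartAt I p q)) := by
  have hq' : q ∈ (chartAt H p).source := by rwa [extChartAt_source] at hq
  have h1 := hG.hasFDerivAt.hasMFDerivAt.comp q
    (mdifferentiableAt_extChartAt (I := I) hq').hasMFDerivAt
  refine (derivAlong_eq (w := v) h1).trans ?_
  rw [← mfderiv_extChartAt_apply v hq]
  rfl

lemma fieldInChart_self (v : ∀ p : M, TangentSpace I p) (p : M) :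
    fieldInChart I v p (extChartAt I p p) = v p := by
  unfold fieldInChart
  rw [extChartAt_to_inv]
  exact tangentCoordChange_self (I := I) (mem_extChartAt_source p)

variable {l : LineElementField I M} {v : ∀ p : M, TangentSpace I p} {V : Set M}

lemma IsDirector.mono (hv : IsDirector l v V) {V' : Set M} (hV' : IsOpen V') (h : V' ⊆ V) :
    IsDirector l v V' :=
  ⟨hV', hv.smooth.mono h, fun q hq => hv.elem_eq q (h hq), fun q hq => hv.ne_zero q (h hq)⟩

lemma IsDirector.continuousAt_fieldInChart (hv : IsDirector l v V) {p : M} (hp : p ∈ V) :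
    ContinuousAt (fun q => fieldInChart I v p (extChartAt I p q)) p := by
  have h1 := (contDiffWithinAt_fieldInChart (hv.contMDiffAt hp)).continuousWithinAt
  have h2 : Tendsto (extChartAt I p) (𝓝 p) (𝓝[range I] (extChartAt I p p)) :=
    tendsto_nhdsWithin_iff.2 ⟨continuousAt_extChartAt (I := I) p,
      Eventually.of_forall fun x => mem_range_self _⟩
  exact h1.tendsto.comp h2

/-- A Legendrian curve lies at height zero with respect to line elements transverse to the plane
field. In the chart at `p`, let `A` be a linear function vanishing on the plane at `p`, and equal
to one on the line element. By the chord condition `A` restricts to a function on the curve with a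
small Lipschitz constant. If `g` is an extension with the same Lipschitz constant, then `A - g`
vanishes on the curve, and it increases along the line elements. -/
theorem IsLegendrian.hasHeight {ξ : ∀ p : M, Submodule ℝ (TangentSpace I p)} {L : Set M}
    (hL : IsLegendrian I ξ L) {p : M} (hp : p ∈ L) (hpi : p ∈ I.interior M)
    (hv : IsDirector l v V) (hpV : p ∈ V) {A : E3 →L[ℝ] ℝ} (hA : ∀ x : E3, x ∈ ξ p ↔ A x = 0)
    (hAv : A (v p) = 1) : HasHeight l L p := by
  set χ := extChartAt I p with hχ
  set c : ℝ := ‖fieldInChart I v p (χ p)‖ + 1 with hc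
  have hc0 : 0 < c := by positivity
  -- a function with Lipschitz constant `1 / (4 * c)` grows at rate at most `1 / 4` along the field
  obtain ⟨U, hUo, hpU, hU⟩ := hL.exists_chord_le hp hpi hA (ε := 1 / (4 * c)) (by positivity)
  have hvc := hv.continuousAt_fieldInChart hpV
  have hev1 : ∀ᶠ q in 𝓝 p, 3 / 4 < A (fieldInChart I v p (χ q)) := by
    refine (A.continuous.continuousAt.comp hvc).eventually_const_lt ?_
    change 3 / 4 < A (fieldInChart I v p (χ p))
    rw [fieldInChart_self, hAv]; norm_num
  have hev2 : ∀ᶠ q in 𝓝 p, ‖fieldInChart I v p (χ q)‖ < c := by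
    exact hvc.norm.eventually_lt_const (lt_add_one _)
  have hint : I.interior M ∈ 𝓝 p := (I.isOpen_interior (n := ∞) (by simp)).mem_nhds hpi
  obtain ⟨V', hV', hV'o, hpV'⟩ := mem_nhds_iff.1
    (inter_mem (hUo.mem_nhds hpU) (inter_mem (hv.isOpen.mem_nhds hpV) (inter_mem hint
      (inter_mem (extChartAt_source_mem_nhds (I := I) p) (inter_mem hev1 hev2)))))
  set K : ℝ≥0 := ⟨1 / (4 * c), by positivity⟩ with hK
  have hlip : LipschitzOnWith K A (χ '' (L ∩ V')) := by
    refine LipschitzOnWith.of_dist_le_mul ?_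
    rintro _ ⟨q, hq, rfl⟩ _ ⟨q', hq', rfl⟩
    rw [dist_eq_norm, dist_eq_norm, ← map_sub, Real.norm_eq_abs]
    exact hU q' ⟨hq'.1, (hV' hq'.2).1⟩ q ⟨hq.1, (hV' hq.2).1⟩
  obtain ⟨g, hg, hgA⟩ := hlip.extend_real
  have hχc : ContinuousOn χ V' := (continuousOn_extChartAt p).mono fun q hq => (hV' hq).2.2.2.1
  refine ⟨V', v, fun q => 2 * (A (χ q) - g (χ q)), hv.mono hV'o fun q hq => (hV' hq).2.1,
    fun q hq => (hV' hq).2.2.1, hpV', ?_, ?_, ?_⟩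
  · exact continuousOn_const.mul ((A.continuous.comp_continuousOn hχc).sub
      (hg.continuous.comp_continuousOn hχc))
  · intro q hq
    change 2 * (A (χ q) - g (χ q)) = 0
    rw [hgA (mem_image_of_mem χ hq), sub_self, mul_zero]
  · intro δ hδ
    obtain ⟨g', hg's, hg'K, hg'⟩ := exists_contDiff_lipschitzWith hg (half_pos hδ)
    set G : E3 → ℝ := fun y => 2 * (A y - g' y) with hG
    have hGs : ContDiff ℝ ∞ G := contDiff_const.mul (A.contDiff.sub hg's)
    refine ⟨fun q => G (χ q), ?_, ?_, ?_⟩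
    · exact hGs.contMDiff.comp_contMDiffOn
        ((contMDiffOn_extChartAt (x := p) (n := ∞)).mono fun q hq => by
          have := (hV' hq).2.2.2.1
          rwa [extChartAt_source] at this)
    · intro q _
      have := hg' (χ q)
      simp only [hG]
      rw [show 2 * (A (χ q) - g' (χ q)) - 2 * (A (χ q) - g (χ q)) = -(2 * (g' (χ q) - g (χ q))) by
        ring, abs_neg, abs_mul, abs_two]
      linarith
    · intro q hq
      obtain ⟨-, -, -, hqs, hq1, hq2⟩ := hV' hq
      rw [derivAlong_comp_extChartAt hqs (hGs.differentiable (by simp) _)]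
      have hd : HasFDerivAt G ((2 : ℝ) • (A - fderiv ℝ g' (χ q))) (χ q) :=
        (A.hasFDerivAt.sub ((hg's.differentiable (by simp) (χ q)).hasFDerivAt)).const_mul 2
      rw [hd.fderiv]
      set y := fieldInChart I v p (χ q)
      change 1 ≤ 2 * (A y - fderiv ℝ g' (χ q) y)
      have h1 : |fderiv ℝ g' (χ q) y| ≤ K * ‖y‖ :=
        ((fderiv ℝ g' (χ q)).le_opNorm y).trans
          (mul_le_mul_of_nonneg_right (norm_fderiv_le_of_lipschitz ℝ hg'K) (norm_nonneg y))
      have h2 : (K : ℝ) * ‖y‖ ≤ 1 / (4 * c) * c :=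
        mul_le_mul_of_nonneg_left (le_of_lt hq2) (by positivity)
      have h3 : 1 / (4 * c) * c = 1 / 4 := by field_simp
      have h4 : 3 / 4 < A y := hq1
      have h5 := (abs_le.1 h1).2
      linarith

end Heights

/-! ### Exterior derivatives and Reeb vectors in Euclidean space -/

section Exterior

variable {E : Type*} [NormedAddCommGroup E] [NormedSpace ℝ E]

lemma minSmoothness_le_infty : minSmoothness ℝ 2 ≤ (∞ : WithTop ℕ∞) := by
  rw [minSmoothness_of_isRCLikeNormedField]
  exact WithTop.coe_le_coe.2 le_top

/-- The exterior derivative within the set `s` of the 1-form `β` on a vector space. -/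
def skewDeriv (s : Set E) (β : E → E →L[ℝ] ℝ) (y u v : E) : ℝ :=
  fderivWithin ℝ β s y u v - fderivWithin ℝ β s y v u

/-- The exterior derivative commutes with pullbacks, because the second derivative of the map is
symmetric. -/
lemma skewDeriv_pullback {s : Set E} (hs : UniqueDiffOn ℝ s) {T : E → E} {y : E} (hy : y ∈ s)
    (hyi : y ∈ closure (interior s)) (hT : ContDiffWithinAt ℝ ∞ T s y)
    (hTs : ∀ᶠ x in 𝓝[s] y, T x ∈ s) {β γ : E → E →L[ℝ] ℝ}
    (hβ : DifferentiableWithinAt ℝ β s (T y))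
    (hγ : ∀ᶠ x in 𝓝[s] y, γ x = (β (T x)).comp (fderivWithin ℝ T s x)) (u v : E) :
    skewDeriv s γ y u v =
      skewDeriv s β (T y) (fderivWithin ℝ T s y u) (fderivWithin ℝ T s y v) := by
  have hT1 : HasFDerivWithinAt T (fderivWithin ℝ T s y) s y :=
    (hT.differentiableWithinAt (by simp)).hasFDerivWithinAt
  have hT2 : HasFDerivWithinAt (fderivWithin ℝ T s) (fderivWithin ℝ (fderivWithin ℝ T s) s y) s y :=
    ((hT.fderivWithin_right (m := ∞) hs le_rfl hy).differentiableWithinAt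
      (by simp)).hasFDerivWithinAt
  have hβT : HasFDerivWithinAt (fun x => β (T x))
      ((fderivWithin ℝ β s (T y)).comp (fderivWithin ℝ T s y)) s y :=
    hβ.hasFDerivWithinAt.comp_of_tendsto y hT1
      (tendsto_nhdsWithin_iff.2 ⟨hT1.continuousWithinAt, hTs⟩)
  have hγ0 : γ y = (β (T y)).comp (fderivWithin ℝ T s y) := hγ.self_of_nhdsWithin hy
  have hγ1 := (hβT.clm_comp hT2).congr_of_eventuallyEq hγ hγ0
  have hsymm := hT.isSymmSndFDerivWithinAt minSmoothness_le_infty hs hyi hy u v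
  unfold skewDeriv
  rw [hγ1.fderivWithin (hs y hy)]
  change β (T y) (fderivWithin ℝ (fderivWithin ℝ T s) s y u v) +
      fderivWithin ℝ β s (T y) (fderivWithin ℝ T s y u) (fderivWithin ℝ T s y v) -
    (β (T y) (fderivWithin ℝ (fderivWithin ℝ T s) s y v u) +
      fderivWithin ℝ β s (T y) (fderivWithin ℝ T s y v) (fderivWithin ℝ T s y u)) = _
  rw [hsymm]
  ring

lemma skewDeriv_smul {s : Set E} (hs : UniqueDiffOn ℝ s) {y : E} (hy : y ∈ s) {f : E → ℝ}
    {β γ : E → E →L[ℝ] ℝ} (hf : DifferentiableWithinAt ℝ f s y)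
    (hβ : DifferentiableWithinAt ℝ β s y) (hγ : ∀ᶠ x in 𝓝[s] y, γ x = f x • β x) (u v : E) :
    skewDeriv s γ y u v = f y * skewDeriv s β y u v +
      (fderivWithin ℝ f s y u * β y v - fderivWithin ℝ f s y v * β y u) := by
  have h1 := (hf.hasFDerivWithinAt.smul hβ.hasFDerivWithinAt).congr_of_eventuallyEq hγ
    (hγ.self_of_nhdsWithin hy)
  unfold skewDeriv
  rw [h1.fderivWithin (hs y hy)]
  change f y * fderivWithin ℝ β s y u v + fderivWithin ℝ f s y u * β y v -
    (f y * fderivWithin ℝ β s y v u + fderivWithin ℝ f s y v * β y u) = _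
  ring

/-- The variational equation of a flow `F`, on a set which may have boundary points: the derivative
of `F` in the space direction satisfies the linearized equation. -/
lemma hasDerivAt_variation {s : Set E} (hs : UniqueDiffOn ℝ s) (hsi : s ⊆ closure (interior s))
    {F : E × ℝ → E} {y₀ : E} (hy₀ : y₀ ∈ s) {t₀ : ℝ}
    (hF : ContDiffWithinAt ℝ ∞ F (s ×ˢ univ) (y₀, t₀))
    (hFs : ∀ᶠ x in 𝓝[s ×ˢ univ] (y₀, t₀), F x ∈ s) {V : E → E}
    (hV : DifferentiableWithinAt ℝ V s (F (y₀, t₀)))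
    (hode : ∀ᶠ x in 𝓝[s ×ˢ univ] (y₀, t₀), HasDerivAt (fun t => F (x.1, t)) (V (F x)) x.2)
    (w : E) :
    HasDerivAt (fun t => fderivWithin ℝ (fun y => F (y, t)) s y₀ w)
      (fderivWithin ℝ V s (F (y₀, t₀)) (fderivWithin ℝ (fun y => F (y, t₀)) s y₀ w)) t₀ := by
  set S : Set (E × ℝ) := s ×ˢ univ with hS
  have hSu : UniqueDiffOn ℝ S := hs.prod uniqueDiffOn_univ
  have hmem : (y₀, t₀) ∈ S := ⟨hy₀, mem_univ _⟩
  have hSi : (y₀, t₀) ∈ closure (interior S) := by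
    rw [hS, interior_prod_eq, closure_prod_eq, interior_univ, closure_univ]
    exact ⟨hsi hy₀, mem_univ _⟩
  set G : E × ℝ → E × ℝ →L[ℝ] E := fderivWithin ℝ F S with hG
  have hdiff : ∀ᶠ x in 𝓝[S] (y₀, t₀), DifferentiableWithinAt ℝ F S x := by
    have h1 := (hF.of_le (m := 1) (by simp)).eventually (by simp)
    rw [insert_eq_of_mem hmem] at h1
    exact h1.mono fun x hx => hx.differentiableWithinAt one_ne_zero
  -- partial derivatives in terms of the total derivative
  have hspace : ∀ t, DifferentiableWithinAt ℝ F S (y₀, t) →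
      fderivWithin ℝ (fun y => F (y, t)) s y₀ w = G (y₀, t) (w, 0) := by
    intro t ht
    have h1 : HasFDerivWithinAt (fun y : E => (y, t)) (ContinuousLinearMap.inl ℝ E ℝ) s y₀ :=
      (hasFDerivAt_prodMk_left y₀ t).hasFDerivWithinAt
    have hmaps : MapsTo (fun y : E => (y, t)) s S := fun y hy => ⟨hy, mem_univ _⟩
    have h2 := (ht.hasFDerivWithinAt.comp y₀ h1 hmaps).fderivWithin (hs y₀ hy₀)
    exact DFunLike.congr_fun h2 w
  have htime : ∀ x ∈ S, DifferentiableWithinAt ℝ F S x → ∀ d, HasDerivAt (fun t => F (x.1, t)) d x.2 →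
      G x (0, 1) = d := by
    rintro ⟨y, t⟩ hx hdx d hd
    have h1 : HasFDerivAt (fun t : ℝ => (y, t)) (ContinuousLinearMap.inr ℝ E ℝ) t :=
      hasFDerivAt_prodMk_right y t
    have h2 := (hdx.hasFDerivWithinAt.comp_hasFDerivAt t h1
      (Eventually.of_forall fun t => ⟨hx.1, mem_univ _⟩)).hasDerivAt
    exact h2.unique hd
  have hline : Tendsto (fun t : ℝ => (y₀, t)) (𝓝 t₀) (𝓝[S] (y₀, t₀)) :=
    tendsto_nhdsWithin_iff.2 ⟨(Continuous.prodMk_right y₀).continuousAt,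
      Eventually.of_forall fun t => ⟨hy₀, mem_univ _⟩⟩
  obtain ⟨G', hG'⟩ : ∃ G', HasFDerivWithinAt G G' S (y₀, t₀) :=
    ⟨_, ((hF.fderivWithin_right (m := ∞) hSu le_rfl hmem).differentiableWithinAt
      (by simp)).hasFDerivWithinAt⟩
  have hsymm : G' (0, 1) (w, 0) = G' (w, 0) (0, 1) := by
    have h1 := hF.isSymmSndFDerivWithinAt minSmoothness_le_infty hSu hSi hmem (0, 1) (w, 0)
    rw [hG'.fderivWithin (hSu _ hmem)] at h1
    exact h1
  have hF0 := (hdiff.self_of_nhdsWithin hmem).hasFDerivWithinAt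
  have hVF : HasFDerivWithinAt (fun x => V (F x)) ((fderivWithin ℝ V s (F (y₀, t₀))).comp
      (G (y₀, t₀))) S (y₀, t₀) :=
    hV.hasFDerivWithinAt.comp_of_tendsto (y₀, t₀) hF0
      (tendsto_nhdsWithin_iff.2 ⟨hF0.continuousWithinAt, hFs⟩)
  have hmixed : G' (w, 0) (0, 1) = fderivWithin ℝ V s (F (y₀, t₀)) (G (y₀, t₀) (w, 0)) := by
    have h1 : HasFDerivWithinAt (fun x => G x (0, 1))
        ((ContinuousLinearMap.apply ℝ E ((0, 1) : E × ℝ)).comp G') S (y₀, t₀) :=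
      (ContinuousLinearMap.apply ℝ E ((0, 1) : E × ℝ)).hasFDerivAt.comp_hasFDerivWithinAt _ hG'
    have h2 : (fun x => V (F x)) =ᶠ[𝓝[S] (y₀, t₀)] fun x => G x (0, 1) := by
      filter_upwards [hdiff, hode, self_mem_nhdsWithin] with x hx1 hx2 hx3
      exact (htime x hx3 hx1 _ hx2).symm
    have h3 := (h1.congr_of_eventuallyEq h2 (h2.self_of_nhdsWithin hmem)).fderivWithin
      (hSu _ hmem)
    rw [hVF.fderivWithin (hSu _ hmem)] at h3
    exact (DFunLike.congr_fun h3 (w, 0)).symm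
  have hmain : HasDerivAt (fun t => G (y₀, t) (w, 0)) (G' (0, 1) (w, 0)) t₀ := by
    have h1 : HasFDerivAt (fun t : ℝ => (y₀, t)) (ContinuousLinearMap.inr ℝ E ℝ) t₀ :=
      hasFDerivAt_prodMk_right y₀ t₀
    have h2 := hG'.comp_hasFDerivAt t₀ h1 (Eventually.of_forall fun t => ⟨hy₀, mem_univ _⟩)
    exact ((ContinuousLinearMap.apply ℝ E ((w, 0) : E × ℝ)).hasFDerivAt.comp t₀ h2).hasDerivAt
  rw [hspace t₀ (hdiff.self_of_nhdsWithin hmem), ← hmixed, ← hsymm]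
  refine hmain.congr_of_eventuallyEq ?_
  filter_upwards [hline.eventually hdiff] with t ht using hspace t ht

/-- The flow of a field `V` with `β (V) = const` and `dβ (V, ·) = 0` preserves the form `β`. -/
lemma hasDerivAt_form_variation {s : Set E} (hs : UniqueDiffOn ℝ s)
    (hsi : s ⊆ closure (interior s)) {F : E × ℝ → E} {y₀ : E} (hy₀ : y₀ ∈ s) {t₀ : ℝ}
    (hF : ContDiffWithinAt ℝ ∞ F (s ×ˢ univ) (y₀, t₀))
    (hFs : ∀ᶠ x in 𝓝[s ×ˢ univ] (y₀, t₀), F x ∈ s) {V : E → E}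
    (hV : DifferentiableWithinAt ℝ V s (F (y₀, t₀)))
    (hode : ∀ᶠ x in 𝓝[s ×ˢ univ] (y₀, t₀), HasDerivAt (fun t => F (x.1, t)) (V (F x)) x.2)
    {β : E → E →L[ℝ] ℝ} (hβ : DifferentiableWithinAt ℝ β s (F (y₀, t₀))) {c : ℝ}
    (hβV : ∀ᶠ y in 𝓝[s] (F (y₀, t₀)), β y (V y) = c)
    (hdβ : ∀ x, skewDeriv s β (F (y₀, t₀)) (V (F (y₀, t₀))) x = 0) (w : E) :
    HasDerivAt (fun t => β (F (y₀, t)) (fderivWithin ℝ (fun y => F (y, t)) s y₀ w)) 0 t₀ := by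
  have hmem : (y₀, t₀) ∈ s ×ˢ (univ : Set ℝ) := ⟨hy₀, mem_univ _⟩
  have hline : Tendsto (fun t : ℝ => (y₀, t)) (𝓝 t₀) (𝓝[s ×ˢ univ] (y₀, t₀)) :=
    tendsto_nhdsWithin_iff.2 ⟨(Continuous.prodMk_right y₀).continuousAt,
      Eventually.of_forall fun t => ⟨hy₀, mem_univ _⟩⟩
  have hFmem : F (y₀, t₀) ∈ s := hFs.self_of_nhdsWithin hmem
  set Z := fderivWithin ℝ (fun y => F (y, t₀)) s y₀ w
  have hZ := hasDerivAt_variation hs hsi hy₀ hF hFs hV hode w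
  have hFt : HasDerivAt (fun t => F (y₀, t)) (V (F (y₀, t₀))) t₀ := hode.self_of_nhdsWithin hmem
  have hβF : HasDerivAt (fun t => β (F (y₀, t)))
      (fderivWithin ℝ β s (F (y₀, t₀)) (V (F (y₀, t₀)))) t₀ := by
    have h1 := hβ.hasFDerivWithinAt.comp_hasFDerivAt t₀ hFt.hasFDerivAt (hline.eventually hFs)
    refine (hasDerivAt_iff_hasFDerivAt.2 (h1.congr_fderiv (ContinuousLinearMap.ext_ring ?_)))
    change fderivWithin ℝ β s (F (y₀, t₀)) ((1 : ℝ) • V (F (y₀, t₀))) =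
      (1 : ℝ) • fderivWithin ℝ β s (F (y₀, t₀)) (V (F (y₀, t₀)))
    rw [one_smul, one_smul]
  have hu := hβF.clm_apply hZ
  have hconst : fderivWithin ℝ β s (F (y₀, t₀)) Z (V (F (y₀, t₀))) +
      β (F (y₀, t₀)) (fderivWithin ℝ V s (F (y₀, t₀)) Z) = 0 := by
    have h1 := hβ.hasFDerivWithinAt.clm_apply hV.hasFDerivWithinAt
    have h2 : HasFDerivWithinAt (fun y => β y (V y)) (0 : E →L[ℝ] ℝ) s (F (y₀, t₀)) :=
      (hasFDerivWithinAt_const c _ _).congr_of_eventuallyEq hβV (hβV.self_of_nhdsWithin hFmem)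
    have h3 := DFunLike.congr_fun ((hs _ hFmem).eq h1 h2) Z
    change β (F (y₀, t₀)) (fderivWithin ℝ V s (F (y₀, t₀)) Z) +
      fderivWithin ℝ β s (F (y₀, t₀)) Z (V (F (y₀, t₀))) = 0 at h3
    linarith
  refine hu.congr_deriv ?_
  have h4 := hdβ Z
  unfold skewDeriv at h4
  linarith

end Exterior

section ReebVector

/-- The vectors of the standard basis. -/
def stdVec (i : Fin 3) : E3 := EuclideanSpace.single i 1

lemma stdVec_apply (i j : Fin 3) : stdVec i j = if j = i then 1 else 0 := by
  simp [stdVec]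

lemma eq_sum_stdVec (x : E3) : x = x 0 • stdVec 0 + x 1 • stdVec 1 + x 2 • stdVec 2 := by
  ext i
  fin_cases i <;> simp [stdVec]

/-- The alternation of a bilinear form. -/
def skew (D : E3 →L[ℝ] E3 →L[ℝ] ℝ) (u v : E3) : ℝ := D u v - D v u

/-- The value of `b ∧ skew D` on the standard basis. -/
def reebDet (b : E3 →L[ℝ] ℝ) (D : E3 →L[ℝ] E3 →L[ℝ] ℝ) : ℝ :=
  b (stdVec 0) * skew D (stdVec 1) (stdVec 2) + b (stdVec 1) * skew D (stdVec 2) (stdVec 0) +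
    b (stdVec 2) * skew D (stdVec 0) (stdVec 1)

/-- The vector `R` with `b R = 1` and `skew D R = 0`, given by Cramer's formula. -/
def reebVector (b : E3 →L[ℝ] ℝ) (D : E3 →L[ℝ] E3 →L[ℝ] ℝ) : E3 :=
  (reebDet b D)⁻¹ • (skew D (stdVec 1) (stdVec 2) • stdVec 0 +
    skew D (stdVec 2) (stdVec 0) • stdVec 1 + skew D (stdVec 0) (stdVec 1) • stdVec 2)

variable {b : E3 →L[ℝ] ℝ} {D : E3 →L[ℝ] E3 →L[ℝ] ℝ}

lemma apply_eq_sum (b : E3 →L[ℝ] ℝ) (u : E3) :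
    b u = u 0 * b (stdVec 0) + u 1 * b (stdVec 1) + u 2 * b (stdVec 2) := by
  conv_lhs => rw [eq_sum_stdVec u]
  simp only [map_add, map_smul, smul_eq_mul]

lemma skew_eq_sum (D : E3 →L[ℝ] E3 →L[ℝ] ℝ) (u v : E3) :
    skew D u v = (u 1 * v 2 - u 2 * v 1) * skew D (stdVec 1) (stdVec 2) +
      (u 2 * v 0 - u 0 * v 2) * skew D (stdVec 2) (stdVec 0) +
      (u 0 * v 1 - u 1 * v 0) * skew D (stdVec 0) (stdVec 1) := by
  have h : ∀ u v, D u v = u 0 * D (stdVec 0) v + u 1 * D (stdVec 1) v + u 2 * D (stdVec 2) v :=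
    fun u v => apply_eq_sum (D.flip v) u
  unfold skew
  rw [h u v, h v u, apply_eq_sum (D (stdVec 0)) v, apply_eq_sum (D (stdVec 1)) v,
    apply_eq_sum (D (stdVec 2)) v, apply_eq_sum (D (stdVec 0)) u, apply_eq_sum (D (stdVec 1)) u,
    apply_eq_sum (D (stdVec 2)) u]
  ring

lemma reebDet_ne_zero {u v w : E3} (h : b u * skew D v w + b v * skew D w u + b w * skew D u v ≠ 0) :
    reebDet b D ≠ 0 := by
  intro h0
  apply h
  have e : b u * skew D v w + b v * skew D w u + b w * skew D u v =
      (u 0 * (v 1 * w 2 - v 2 * w 1) + u 1 * (v 2 * w 0 - v 0 * w 2) +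
        u 2 * (v 0 * w 1 - v 1 * w 0)) * reebDet b D := by
    rw [apply_eq_sum b u, apply_eq_sum b v, apply_eq_sum b w, skew_eq_sum D u v, skew_eq_sum D v w,
      skew_eq_sum D w u, reebDet]
    ring
  rw [e, h0, mul_zero]

lemma reebVector_apply (i : Fin 3) : reebVector b D i = (reebDet b D)⁻¹ *
    (![skew D (stdVec 1) (stdVec 2), skew D (stdVec 2) (stdVec 0),
      skew D (stdVec 0) (stdVec 1)] i) := by
  fin_cases i <;> simp [reebVector, stdVec]

lemma apply_reebVector (h : reebDet b D ≠ 0) : b (reebVector b D) = 1 := by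
  have h1 : b (reebVector b D) = (reebDet b D)⁻¹ * reebDet b D := by
    simp only [reebVector, map_smul, map_add, smul_eq_mul]
    rw [reebDet]
    ring
  rw [h1, inv_mul_cancel₀ h]

lemma skew_reebVector (w : E3) : skew D (reebVector b D) w = 0 := by
  rw [skew_eq_sum, reebVector_apply, reebVector_apply, reebVector_apply]
  simp
  ring

lemma eq_reebVector (h : reebDet b D ≠ 0) {R : E3} (h1 : b R = 1) (h2 : ∀ w, skew D R w = 0) :
    R = reebVector b D := by
  have e0 := h2 (stdVec 0)
  have e1 := h2 (stdVec 1)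
  have e2 := h2 (stdVec 2)
  rw [skew_eq_sum] at e0 e1 e2
  rw [apply_eq_sum] at h1
  have d : ∀ i j : Fin 3, i ≠ j → stdVec j i = 0 := fun i j hij => by
    rw [stdVec_apply, if_neg hij]
  have d' : ∀ i : Fin 3, stdVec i i = 1 := fun i => by rw [stdVec_apply, if_pos rfl]
  rw [d 1 0 (by decide), d 2 0 (by decide), d'] at e0
  rw [d 0 1 (by decide), d 2 1 (by decide), d'] at e1
  rw [d 0 2 (by decide), d 1 2 (by decide), d'] at e2
  have key : ∀ i, R i * reebDet b D = ![skew D (stdVec 1) (stdVec 2), skew D (stdVec 2) (stdVec 0),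
      skew D (stdVec 0) (stdVec 1)] i := by
    intro i
    unfold reebDet
    generalize skew D (stdVec 1) (stdVec 2) = s₀ at *
    generalize skew D (stdVec 2) (stdVec 0) = s₁ at *
    generalize skew D (stdVec 0) (stdVec 1) = s₂ at *
    fin_cases i <;> simp
    · linear_combination s₀ * h1 - b (stdVec 1) * e2 + b (stdVec 2) * e1
    · linear_combination s₁ * h1 + b (stdVec 0) * e2 - b (stdVec 2) * e0
    · linear_combination s₂ * h1 - b (stdVec 0) * e1 + b (stdVec 1) * e0
  ext i
  rw [reebVector_apply, ← key i]
  field_simp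

lemma reebVector_smul {σ : ℝ} (hσ : σ * σ = 1) :
    reebVector (σ • b) (σ • D) = σ • reebVector b D := by
  have h : ∀ u v, skew (σ • D) u v = σ * skew D u v := fun u v => by
    change σ * D u v - σ * D v u = σ * (D u v - D v u)
    ring
  have hdet : reebDet (σ • b) (σ • D) = reebDet b D := by
    simp only [reebDet, h]
    change σ * b (stdVec 0) * _ + σ * b (stdVec 1) * _ + σ * b (stdVec 2) * _ = _
    linear_combination (b (stdVec 0) * skew D (stdVec 1) (stdVec 2) +
      b (stdVec 1) * skew D (stdVec 2) (stdVec 0) +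
      b (stdVec 2) * skew D (stdVec 0) (stdVec 1)) * hσ
  unfold reebVector
  rw [hdet, h, h, h]
  module

lemma contDiffWithinAt_reebVector {s : Set E3} {y : E3} {β : E3 → E3 →L[ℝ] ℝ}
    {γ : E3 → E3 →L[ℝ] E3 →L[ℝ] ℝ} (hβ : ContDiffWithinAt ℝ ∞ β s y)
    (hγ : ContDiffWithinAt ℝ ∞ γ s y) (h : reebDet (β y) (γ y) ≠ 0) :
    ContDiffWithinAt ℝ ∞ (fun x => reebVector (β x) (γ x)) s y := by
  have h1 : ∀ u v, ContDiffWithinAt ℝ ∞ (fun x => skew (γ x) u v) s y := fun u v =>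
    ((hγ.clm_apply contDiffWithinAt_const).clm_apply contDiffWithinAt_const).sub
      ((hγ.clm_apply contDiffWithinAt_const).clm_apply contDiffWithinAt_const)
  have h2 : ∀ u, ContDiffWithinAt ℝ ∞ (fun x => β x u) s y := fun u =>
    hβ.clm_apply contDiffWithinAt_const
  have h3 : ContDiffWithinAt ℝ ∞ (fun x => reebDet (β x) (γ x)) s y :=
    (((h2 _).mul (h1 _ _)).add ((h2 _).mul (h1 _ _))).add ((h2 _).mul (h1 _ _))
  exact (h3.inv h).smul ((((h1 _ _).smul contDiffWithinAt_const).add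
    ((h1 _ _).smul contDiffWithinAt_const)).add ((h1 _ _).smul contDiffWithinAt_const))

end ReebVector

/-! ### Differential forms in charts -/

section Forms

variable {H : Type*} [TopologicalSpace H] {I : ModelWithCorners ℝ E3 H}
  {M : Type*} [TopologicalSpace M] [ChartedSpace H M] [IsManifold I ∞ M]

lemma range_subset_closure_interior : range I ⊆ closure (interior (range I)) :=
  fun _ hx => I.range_subset_closure_interior hx

lemma mfderivWithin_extChartAt_symm_apply {p : M} {y : E3} (hy : y ∈ (extChartAt I p).target)
    (u : E3) : mfderivWithin 𝓘(ℝ, E3) I (extChartAt I p).symm (range I) y u =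
      tangentCoordChange I p ((extChartAt I p).symm y) ((extChartAt I p).symm y) u := by
  have hz : (extChartAt I p).symm y ∈ (chartAt H p).source := by
    rw [← extChartAt_source I p]
    exact (extChartAt I p).map_target hy
  have e1 := TangentBundle.symmL_trivializationAt (I := I) hz
  rw [(extChartAt I p).right_inv hy] at e1
  have e2 := TangentBundle.symmL_trivializationAt_eq_core (I := I) hz
  rw [e1] at e2
  exact DFunLike.congr_fun e2 u

variable {a : ∀ p : M, TangentSpace I p →L[ℝ] ℝ}

lemma formInChart_apply {p z : M} (hz : z ∈ (extChartAt I p).source) (u : E3) :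
    formInChart I a p (extChartAt I p z) u = a z (tangentCoordChange I p z z u) := by
  have h1 : formInChart I a p (extChartAt I p z) u =
      a ((extChartAt I p).symm (extChartAt I p z)) (tangentCoordChange I p
        ((extChartAt I p).symm (extChartAt I p z)) ((extChartAt I p).symm (extChartAt I p z)) u) :=
    congrArg (a ((extChartAt I p).symm (extChartAt I p z)))
      (mfderivWithin_extChartAt_symm_apply ((extChartAt I p).map_source hz) u)
  rw [h1, (extChartAt I p).left_inv hz]

lemma formInChart_self (p : M) (u : E3) : formInChart I a p (extChartAt I p p) u = a p u := by
  rw [formInChart_apply (mem_extChartAt_source p)]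
  exact congrArg (a p) (tangentCoordChange_self (I := I) (mem_extChartAt_source p))

lemma formInChart_tangentCoordChange {p q z : M} (hp : z ∈ (extChartAt I p).source)
    (hq : z ∈ (extChartAt I q).source) (u : E3) :
    formInChart I a p (extChartAt I p z) (tangentCoordChange I q p z u) =
      formInChart I a q (extChartAt I q z) u := by
  rw [formInChart_apply hp, formInChart_apply hq]
  exact congrArg (a z) (tangentCoordChange_comp (I := I) ⟨⟨hq, hp⟩, mem_extChartAt_source z⟩)

lemma eventually_mem_of_mem_nhdsWithin_range {p z : M} (hz : z ∈ (extChartAt I p).source)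
    {s : Set M} (hs : s ∈ 𝓝 z) :
    ∀ᶠ y in 𝓝[range I] (extChartAt I p z), y ∈ (extChartAt I p).target ∧
      (extChartAt I p).symm y ∈ s := by
  have h1 := extChartAt_target_mem_nhdsWithin' (I := I) hz
  have h2 := (continuousAt_extChartAt_symm' (I := I) hz).preimage_mem_nhds
    (by rwa [(extChartAt I p).left_inv hz])
  exact (eventually_mem_set.2 h1).and (eventually_mem_set.2 (mem_nhdsWithin_of_mem_nhds h2))

/-- The exterior derivative of a form does not depend on the chart in which it is computed. -/
lemma skewDeriv_formInChart {p q z : M} (hp : z ∈ (extChartAt I p).source)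
    (hq : z ∈ (extChartAt I q).source)
    (ha : DifferentiableWithinAt ℝ (formInChart I a p) (range I) (extChartAt I p z)) (u v : E3) :
    skewDeriv (range I) (formInChart I a q) (extChartAt I q z) u v =
      skewDeriv (range I) (formInChart I a p) (extChartAt I p z) (tangentCoordChange I q p z u)
        (tangentCoordChange I q p z v) := by
  set T : E3 → E3 := extChartAt I p ∘ (extChartAt I q).symm with hT
  have hTz : T (extChartAt I q z) = extChartAt I p z := by
    simp only [hT, Function.comp_apply, (extChartAt I q).left_inv hq]
  have hTs : ContDiffWithinAt ℝ ∞ T (range I) (extChartAt I q z) := by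
    refine contDiffWithinAt_ext_coord_change (n := ∞) p q ?_
    rw [PartialEquiv.trans_source, PartialEquiv.symm_source]
    refine ⟨(extChartAt I q).map_source hq, ?_⟩
    rw [mem_preimage, (extChartAt I q).left_inv hq]
    exact hp
  rw [← hTz] at ha ⊢
  refine skewDeriv_pullback I.uniqueDiffOn (mem_range_self _)
    (range_subset_closure_interior (mem_range_self _)) hTs
    (Eventually.of_forall fun x => mem_range_self _) ha ?_ u v
  have hs : (extChartAt I p).source ∈ 𝓝 z := (isOpen_extChartAt_source p).mem_nhds hp
  filter_upwards [eventually_mem_of_mem_nhdsWithin_range hq hs] with y hy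
  ext u
  have h1 := formInChart_tangentCoordChange (a := a) hy.2 ((extChartAt I q).map_target hy.1) u
  rw [(extChartAt I q).right_inv hy.1] at h1
  rw [← h1, tangentCoordChange_def, (extChartAt I q).right_inv hy.1]
  rfl

/-- The 1-form `a` is smooth on `V` in all preferred charts. -/
def IsChartSmoothOn (a : ∀ p : M, TangentSpace I p →L[ℝ] ℝ) (V : Set M) : Prop :=
  ∀ p : M, ∀ z ∈ V ∩ (extChartAt I p).source,
    ContDiffWithinAt ℝ ∞ (formInChart I a p) (range I) (extChartAt I p z)

lemma IsSmoothOneFormOn.isChartSmoothOn {V : Set M} (ha : IsSmoothOneFormOn I a V)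
    (hV : IsOpen V) : IsChartSmoothOn a V := by
  rintro p z ⟨hzV, hz⟩
  set τ := trivializationAt (E3 →L[ℝ] ℝ) (fun p : M => TangentSpace I p →L[ℝ] Trivial M ℝ p) p
    with hτ
  have hτs : ∀ q ∈ (extChartAt I p).source, ∀ A : TangentSpace I q →L[ℝ] ℝ,
      (TotalSpace.mk' (E3 →L[ℝ] ℝ) q A :
        TotalSpace (E3 →L[ℝ] ℝ) (fun p : M => TangentSpace I p →L[ℝ] Trivial M ℝ p)) ∈
        τ.source := by
    intro q hq A
    rw [hτ, hom_trivializationAt_source]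
    refine ⟨?_, mem_univ _⟩
    rw [TangentBundle.trivializationAt_baseSet]
    rwa [extChartAt_source] at hq
  have h1 : ContMDiffOn I 𝓘(ℝ, E3 →L[ℝ] ℝ) ∞
      (fun q => (τ (TotalSpace.mk' (E3 →L[ℝ] ℝ) q (a q))).2) (V ∩ (extChartAt I p).source) :=
    ((Bundle.Trivialization.contMDiffOn_iff (n := ∞) (IM := I) (IB := I) (e := τ)
      (f := fun q => (TotalSpace.mk' (E3 →L[ℝ] ℝ) q (a q) :
        TotalSpace (E3 →L[ℝ] ℝ) (fun p : M => TangentSpace I p →L[ℝ] Trivial M ℝ p)))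
      (fun q hq => hτs q hq.2 (a q))).1 (ha.mono inter_subset_left)).2
  have h2 : ∀ q ∈ (extChartAt I p).source, (τ (TotalSpace.mk' (E3 →L[ℝ] ℝ) q (a q))).2 =
      formInChart I a p (extChartAt I p q) := by
    intro q hq
    ext u
    rw [formInChart_apply hq, hτ, hom_trivializationAt_apply]
    have hq' : q ∈ (chartAt H p).source := by rwa [extChartAt_source] at hq
    have e := DFunLike.congr_fun (TangentBundle.symmL_trivializationAt_eq_core (I := I) hq') u
    have e1 : q ∈ (trivializationAt ℝ (Trivial M ℝ) p).baseSet := mem_univ q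
    change (trivializationAt ℝ (Trivial M ℝ) p).continuousLinearMapAt ℝ q
      (a q ((trivializationAt E3 (TangentSpace I) p).symmL ℝ q u)) = _
    rw [e, Bundle.Trivialization.continuousLinearMapAt_apply_of_mem _ _ e1]
    rfl
  have h3 : ContMDiffOn 𝓘(ℝ, E3) 𝓘(ℝ, E3 →L[ℝ] ℝ) ∞ _
      ((extChartAt I p).target ∩ (extChartAt I p).symm ⁻¹' V) :=
    h1.comp ((contMDiffOn_extChartAt_symm (I := I) (n := ∞) p).mono
      (inter_subset_left (t := (extChartAt I p).symm ⁻¹' V)))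
      (fun y hy => ⟨hy.2, (extChartAt I p).map_target hy.1⟩)
  have h4 := contMDiffOn_iff_contDiffOn.1 h3
  have hmem := eventually_mem_of_mem_nhdsWithin_range hz (hV.mem_nhds hzV)
  refine ((h4 (extChartAt I p z) ⟨(extChartAt I p).map_source hz, ?_⟩).mono_of_mem_nhdsWithin
    hmem).congr_of_eventuallyEq ?_ ?_
  · rw [mem_preimage, (extChartAt I p).left_inv hz]
    exact hzV
  · filter_upwards [hmem] with y hy
    have := h2 _ ((extChartAt I p).map_target hy.1)
    rw [(extChartAt I p).right_inv hy.1] at this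
    exact this.symm
  · have := h2 z hz
    change _ = (τ (TotalSpace.mk' (E3 →L[ℝ] ℝ) _ (a _))).2
    rw [(extChartAt I p).left_inv hz]
    exact this.symm

end Forms

/-! ### Contact forms and their Reeb fields -/

section Reeb

variable {H : Type*} [TopologicalSpace H] {I : ModelWithCorners ℝ E3 H}
  {M : Type*} [TopologicalSpace M] [ChartedSpace H M] [IsManifold I ∞ M]

/-- The 1-form `a` is a contact form for `ξ` on the open set `V`. -/
structure IsContactFormOn (ξ : ∀ p : M, Submodule ℝ (TangentSpace I p))
    (a : ∀ p : M, TangentSpace I p →L[ℝ] ℝ) (V : Set M) : Prop where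
  isOpen : IsOpen V
  smooth : IsChartSmoothOn a V
  mem_iff : ∀ q ∈ V, ∀ x : TangentSpace I q, x ∈ ξ q ↔ a q x = 0
  nondegenerate : ∀ q ∈ V, reebDet (formInChart I a q (extChartAt I q q))
    (fderivWithin ℝ (formInChart I a q) (range I) (extChartAt I q q)) ≠ 0

variable {ξ : ∀ p : M, Submodule ℝ (TangentSpace I p)} {a a' : ∀ p : M, TangentSpace I p →L[ℝ] ℝ}
  {V V' : Set M}

lemma IsContactStructure.exists_isContactFormOn (hξ : IsContactStructure I ξ) (p : M) :
    ∃ V a, p ∈ V ∧ IsContactFormOn ξ a V := by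
  obtain ⟨V, hV, hp, α, hα, h⟩ := hξ p
  refine ⟨V, α, hp, hV, hα.isChartSmoothOn hV, fun q hq x => ?_, fun q hq => ?_⟩
  · rw [(h q hq).1]
    exact Iff.rfl
  · obtain ⟨u, v, w, huvw⟩ := (h q hq).2
    exact reebDet_ne_zero huvw

lemma IsContactFormOn.mono (ha : IsContactFormOn ξ a V) (hV' : IsOpen V') (h : V' ⊆ V) :
    IsContactFormOn ξ a V' :=
  ⟨hV', fun p z hz => ha.smooth p z ⟨h hz.1, hz.2⟩, fun q hq => ha.mem_iff q (h hq),
    fun q hq => ha.nondegenerate q (h hq)⟩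

/-- The Reeb field of the form `a`: `a R = 1` and `da (R, ·) = 0`. -/
def reebField (a : ∀ p : M, TangentSpace I p →L[ℝ] ℝ) (q : M) : TangentSpace I q :=
  reebVector (formInChart I a q (extChartAt I q q))
    (fderivWithin ℝ (formInChart I a q) (range I) (extChartAt I q q))

lemma IsContactFormOn.apply_reebField (ha : IsContactFormOn ξ a V) {q : M} (hq : q ∈ V) :
    a q (reebField a q) = 1 :=
  (formInChart_self (a := a) q (reebField a q)).symm.trans (apply_reebVector (ha.nondegenerate q hq))

lemma IsContactFormOn.reebField_notMem (ha : IsContactFormOn ξ a V) {q : M} (hq : q ∈ V) :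
    reebField a q ∉ ξ q := by
  rw [ha.mem_iff q hq, ha.apply_reebField hq]
  exact one_ne_zero

lemma IsContactFormOn.differentiableWithinAt (ha : IsContactFormOn ξ a V) {p z : M}
    (hz : z ∈ V ∩ (extChartAt I p).source) :
    DifferentiableWithinAt ℝ (formInChart I a p) (range I) (extChartAt I p z) :=
  (ha.smooth p z hz).differentiableWithinAt (by simp)

lemma IsContactFormOn.reebDet_ne_zero (ha : IsContactFormOn ξ a V) {p z : M}
    (hz : z ∈ V ∩ (extChartAt I p).source) :
    reebDet (formInChart I a p (extChartAt I p z))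
      (fderivWithin ℝ (formInChart I a p) (range I) (extChartAt I p z)) ≠ 0 := by
  have h1 := fun u v => skewDeriv_formInChart hz.2 (mem_extChartAt_source (I := I) z)
    (ha.differentiableWithinAt hz) u v
  have h2 := fun u => formInChart_tangentCoordChange (a := a) hz.2
    (mem_extChartAt_source (I := I) z) u
  refine RegularNbhd.reebDet_ne_zero (u := tangentCoordChange I z p z (stdVec 0))
    (v := tangentCoordChange I z p z (stdVec 1)) (w := tangentCoordChange I z p z (stdVec 2)) ?_
  change _ * skewDeriv (range I) (formInChart I a p) (extChartAt I p z) _ _ +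
    _ * skewDeriv (range I) (formInChart I a p) (extChartAt I p z) _ _ +
    _ * skewDeriv (range I) (formInChart I a p) (extChartAt I p z) _ _ ≠ 0
  rw [← h1, ← h1, ← h1, h2, h2, h2]
  exact ha.nondegenerate z hz.1

/-- The Reeb field is characterized by its defining equations, hence has the same expression in all
charts. -/
lemma IsContactFormOn.tangentCoordChange_reebField (ha : IsContactFormOn ξ a V) {p z : M}
    (hz : z ∈ V ∩ (extChartAt I p).source) :
    tangentCoordChange I z p z (reebField a z) =
      reebVector (formInChart I a p (extChartAt I p z))
        (fderivWithin ℝ (formInChart I a p) (range I) (extChartAt I p z)) := by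
  have hzz := mem_extChartAt_source (I := I) z
  refine eq_reebVector (ha.reebDet_ne_zero hz) ?_ fun w => ?_
  · exact (formInChart_tangentCoordChange (a := a) hz.2 hzz (reebField a z)).trans
      (apply_reebVector (ha.nondegenerate z hz.1))
  · have h1 := skewDeriv_formInChart hz.2 hzz (ha.differentiableWithinAt hz) (reebField a z)
      (tangentCoordChange I p z z w)
    have h2 : tangentCoordChange I z p z (tangentCoordChange I p z z w) = w := by
      rw [tangentCoordChange_comp (I := I) ⟨⟨hz.2, hzz⟩, hz.2⟩, tangentCoordChange_self (I := I) hz.2]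
    rw [h2] at h1
    exact h1.symm.trans (skew_reebVector _)

lemma IsContactFormOn.fieldInChart_reebField (ha : IsContactFormOn ξ a V) {p : M} {y : E3}
    (hy : y ∈ (extChartAt I p).target) (hyV : (extChartAt I p).symm y ∈ V) :
    fieldInChart I (reebField a) p y =
      reebVector (formInChart I a p y) (fderivWithin ℝ (formInChart I a p) (range I) y) := by
  have := ha.tangentCoordChange_reebField ⟨hyV, (extChartAt I p).map_target hy⟩
  rw [(extChartAt I p).right_inv hy] at this
  exact this

lemma IsContactFormOn.contDiffWithinAt_fieldInChart (ha : IsContactFormOn ξ a V) {p z : M}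
    (hz : z ∈ V ∩ (extChartAt I p).source) :
    ContDiffWithinAt ℝ ∞ (fieldInChart I (reebField a) p) (range I) (extChartAt I p z) := by
  have hev := eventually_mem_of_mem_nhdsWithin_range hz.2 (ha.isOpen.mem_nhds hz.1)
  have h1 := ha.smooth p z hz
  have h2 := contDiffWithinAt_reebVector h1
    (h1.fderivWithin_right (m := ∞) I.uniqueDiffOn le_rfl (mem_range_self _)) (ha.reebDet_ne_zero hz)
  have h3 : ∀ᶠ y in 𝓝[range I] (extChartAt I p z), fieldInChart I (reebField a) p y =
      reebVector (formInChart I a p y) (fderivWithin ℝ (formInChart I a p) (range I) y) :=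
    hev.mono fun y hy => ha.fieldInChart_reebField hy.1 hy.2
  exact h2.congr_of_eventuallyEq h3 (h3.self_of_nhdsWithin (mem_range_self _))

lemma IsContactFormOn.isSmoothVectorFieldOn (ha : IsContactFormOn ξ a V) :
    IsSmoothVectorFieldOn I (reebField a) V := fun q hq =>
  (contMDiffAt_of_fieldInChart
    (ha.contDiffWithinAt_fieldInChart ⟨hq, mem_extChartAt_source q⟩)).contMDiffWithinAt

/-- Changing the sign of a contact form changes the sign of its Reeb field. -/
lemma IsContactFormOn.reebField_eq_smul (ha : IsContactFormOn ξ a V) {q : M} (hq : q ∈ V) {σ : ℝ}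
    (hσ : σ * σ = 1) (h : ∀ᶠ z in 𝓝 q, a' z = σ • a z) : reebField a' q = σ • reebField a q := by
  have h1 : formInChart I a' q =ᶠ[𝓝[range I] (extChartAt I q q)]
      fun y => σ • formInChart I a q y := by
    filter_upwards [eventually_mem_of_mem_nhdsWithin_range (mem_extChartAt_source (I := I) q) h]
      with y hy
    ext u
    exact DFunLike.congr_fun hy.2 _
  have h2 := h1.self_of_nhdsWithin (mem_range_self _)
  have h3 : fderivWithin ℝ (formInChart I a' q) (range I) (extChartAt I q q) =
      σ • fderivWithin ℝ (formInChart I a q) (range I) (extChartAt I q q) := by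
    have h4 := ((ha.differentiableWithinAt ⟨hq, mem_extChartAt_source q⟩).hasFDerivWithinAt.const_smul
      σ).congr_of_eventuallyEq h1 h2
    exact h4.fderivWithin (I.uniqueDiffOn _ (mem_range_self _))
  unfold reebField
  rw [h2, h3]
  exact reebVector_smul hσ

/-- The product of a contact form with a nonvanishing function is a contact form:
`(f a) ∧ d(f a) = f² (a ∧ da)`. -/
lemma IsContactFormOn.smul (ha : IsContactFormOn ξ a V) {f : M → ℝ}
    (hf : ∀ q ∈ V, ContMDiffAt I 𝓘(ℝ, ℝ) ∞ f q) (hf0 : ∀ q ∈ V, f q ≠ 0) :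
    IsContactFormOn ξ (fun q => f q • a q) V := by
  have hfc : ∀ p : M, ∀ z ∈ V ∩ (extChartAt I p).source,
      ContDiffWithinAt ℝ ∞ (fun y => f ((extChartAt I p).symm y)) (range I) (extChartAt I p z) := by
    intro p z hz
    have h1 := (contMDiffWithinAt_extChartAt_symm_range (I := I) (n := ∞) p
      ((extChartAt I p).map_source hz.2))
    have h2 : ContMDiffAt I 𝓘(ℝ, ℝ) ∞ f ((extChartAt I p).symm (extChartAt I p z)) := by
      rw [(extChartAt I p).left_inv hz.2]; exact hf z hz.1
    exact contMDiffWithinAt_iff_contDiffWithinAt.1 (h2.comp_contMDiffWithinAt _ h1)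
  refine ⟨ha.isOpen, fun p z hz => ?_, fun q hq x => ?_, fun q hq => ?_⟩
  · exact (hfc p z hz).smul (ha.smooth p z hz)
  · rw [ha.mem_iff q hq]
    change _ ↔ f q * a q x = 0
    rw [mul_eq_zero, or_iff_right (hf0 q hq)]
  · have hz : q ∈ V ∩ (extChartAt I q).source := ⟨hq, mem_extChartAt_source q⟩
    have h1 := fun u v => skewDeriv_smul (y := extChartAt I q q) (f := fun y => f ((extChartAt I q).symm y))
      (γ := formInChart I (fun q => f q • a q) q) I.uniqueDiffOn (mem_range_self _)
      ((hfc q q hz).differentiableWithinAt (by simp)) (ha.differentiableWithinAt hz)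
      (Eventually.of_forall fun y => rfl) u v
    have h2 : ∀ u, formInChart I (fun q => f q • a q) q (extChartAt I q q) u =
        f ((extChartAt I q).symm (extChartAt I q q)) * formInChart I a q (extChartAt I q q) u :=
      fun u => rfl
    have h3 := ha.nondegenerate q hq
    have h4 : reebDet (formInChart I (fun q => f q • a q) q (extChartAt I q q))
        (fderivWithin ℝ (formInChart I (fun q => f q • a q) q) (range I) (extChartAt I q q)) =
        f ((extChartAt I q).symm (extChartAt I q q)) ^ 2 *
          reebDet (formInChart I a q (extChartAt I q q))
            (fderivWithin ℝ (formInChart I a q) (range I) (extChartAt I q q)) := by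
      unfold reebDet
      change _ * skewDeriv (range I) (formInChart I (fun q => f q • a q) q) (extChartAt I q q) _ _ +
        _ * skewDeriv (range I) (formInChart I (fun q => f q • a q) q) (extChartAt I q q) _ _ +
        _ * skewDeriv (range I) (formInChart I (fun q => f q • a q) q) (extChartAt I q q) _ _ =
        _ * (_ * skewDeriv (range I) (formInChart I a q) (extChartAt I q q) _ _ +
        _ * skewDeriv (range I) (formInChart I a q) (extChartAt I q q) _ _ +
        _ * skewDeriv (range I) (formInChart I a q) (extChartAt I q q) _ _)
      rw [h1, h1, h1, h2, h2, h2]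
      ring
    rw [h4]
    refine mul_ne_zero (pow_ne_zero 2 ?_) h3
    rw [(extChartAt I q).left_inv hz.2]
    exact hf0 q hq

end Reeb

/-! ### A transverse field of line elements consisting of Reeb vectors -/

section ReebElements

variable {H : Type*} [TopologicalSpace H] {I : ModelWithCorners ℝ E3 H}
  {M : Type*} [TopologicalSpace M] [ChartedSpace H M] [IsManifold I ∞ M]

lemma contMDiffAt_form_apply {a : ∀ p : M, TangentSpace I p →L[ℝ] ℝ}
    {v : ∀ p : M, TangentSpace I p} {V V' : Set M} (ha : IsChartSmoothOn a V)
    (hv : IsSmoothVectorFieldOn I v V') (hV' : IsOpen V') {q : M} (hq : q ∈ V) (hq' : q ∈ V') :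
    ContMDiffAt I 𝓘(ℝ, ℝ) ∞ (fun z => a z (v z)) q := by
  have h1 : ContDiffWithinAt ℝ ∞ (fun y => formInChart I a q y (fieldInChart I v q y)) (range I)
      (extChartAt I q q) :=
    (ha q q ⟨hq, mem_extChartAt_source q⟩).clm_apply
      (contDiffWithinAt_fieldInChart (hv.contMDiffAt (hV'.mem_nhds hq')))
  have h2 : ContMDiffAt I 𝓘(ℝ, ℝ) ∞ (fun z => formInChart I a q (extChartAt I q z)
      (fieldInChart I v q (extChartAt I q z))) q :=
    ContMDiffWithinAt.comp (t := range I) q h1.contMDiffWithinAt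
      (contMDiffAt_extChartAt (I := I) (n := ∞)).contMDiffWithinAt fun z _ => mem_range_self _
  refine h2.congr_of_eventuallyEq ?_
  filter_upwards [extChartAt_source_mem_nhds (I := I) q] with z hz
  have h3 : fieldInChart I v q (extChartAt I q z) = tangentCoordChange I z q z (v z) := by
    unfold fieldInChart
    rw [(extChartAt I q).left_inv hz]
  rw [h3]
  exact ((formInChart_tangentCoordChange hz (mem_extChartAt_source z) _).trans
    (formInChart_self z _)).symm

variable {ξ : ∀ p : M, Submodule ℝ (TangentSpace I p)} {a a' : ∀ p : M, TangentSpace I p →L[ℝ] ℝ}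
  {V V' : Set M}

lemma IsContactFormOn.eq_mul (ha : IsContactFormOn ξ a V) (ha' : IsContactFormOn ξ a' V') {q : M}
    (hq : q ∈ V) (hq' : q ∈ V') (w : TangentSpace I q) :
    a' q w = a' q (reebField a q) * a q w := by
  have h1 : w - a q w • reebField a q ∈ ξ q := by
    rw [ha.mem_iff q hq, map_sub, map_smul, ha.apply_reebField hq]
    simp
  rw [ha'.mem_iff q hq', map_sub, map_smul, smul_eq_mul] at h1
  linarith

/-- Any contact structure admits local contact forms which agree up to sign on overlaps. They are
obtained by normalizing arbitrary local contact forms `α i`: each of them is multiplied with the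
square root of the average, by a partition of unity, of the squares of its ratios to all
the others. -/
theorem IsContactStructure.exists_compatible_forms [T2Space M] [SecondCountableTopology M]
    (hξ : IsContactStructure I ξ) :
    ∃ (V : M → Set M) (a : M → ∀ p : M, TangentSpace I p →L[ℝ] ℝ),
      (∀ p, p ∈ V p) ∧ (∀ p, IsContactFormOn ξ (a p) (V p)) ∧
      ∀ p p' q, q ∈ V p → q ∈ V p' →
        ∃ σ : ℝ, (σ = 1 ∨ σ = -1) ∧ ∀ᶠ z in 𝓝 q, a p' z = σ • a p z := by
  choose V α hpV hα using hξ.exists_isContactFormOn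
  have : LocallyCompactSpace H := I.locallyCompactSpace
  have : LocallyCompactSpace M := ChartedSpace.locallyCompactSpace H M
  obtain ⟨ρ, hρ⟩ := SmoothPartitionOfUnity.exists_isSubordinate I isClosed_univ V
    (fun i => (hα i).isOpen) (fun x _ => mem_iUnion.2 ⟨x, hpV x⟩)
  -- the average of the squared ratios
  set m : M → M → ℝ := fun p q => ∑ᶠ i, ρ i q • (α i q (reebField (α p) q)) ^ 2 with hm
  have hρV : ∀ i q, ρ i q ≠ 0 → q ∈ V i := fun i q h => hρ i (subset_tsupport _ h)
  have hms : ∀ p, ∀ q ∈ V p, ContMDiffAt I 𝓘(ℝ, ℝ) ∞ (m p) q := fun p q hq =>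
    ρ.contMDiffAt_finsum fun i hi => (contMDiffAt_form_apply (hα i).smooth
      (hα p).isSmoothVectorFieldOn (hα p).isOpen (hρ i hi) hq).pow 2
  have hk0 : ∀ p p' q, q ∈ V p → q ∈ V p' → α p q (reebField (α p') q) ≠ 0 := by
    intro p p' q hq hq' h0
    exact (hα p').reebField_notMem hq' (((hα p).mem_iff q hq _).2 h0)
  have hmpos : ∀ p, ∀ q ∈ V p, 0 < m p q := by
    intro p q hq
    obtain ⟨i, hi⟩ := ρ.exists_pos_of_mem (mem_univ q)
    have hfin : (Function.support fun i => ρ i q • (α i q (reebField (α p) q)) ^ 2).Finite :=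
      (ρ.locallyFinite.point_finite q).subset fun i hi => by
        intro h0
        apply hi
        simp [h0]
    refine finsum_pos (fun j => ?_) ⟨i, ?_⟩ hfin
    · exact mul_nonneg (ρ.nonneg j q) (sq_nonneg _)
    · exact mul_pos hi (even_two.pow_pos (hk0 i p q (hρV i q hi.ne') hq))
  have hmm : ∀ p p' q, q ∈ V p → q ∈ V p' →
      m p' q = (α p q (reebField (α p') q)) ^ 2 * m p q := by
    intro p p' q hq hq'
    simp only [hm]
    rw [mul_finsum]
    refine finsum_congr fun i => ?_
    by_cases hi : ρ i q = 0
    · simp [hi]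
    · rw [(hα p).eq_mul (hα i) hq (hρV i q hi) (reebField (α p') q)]
      simp only [smul_eq_mul]
      ring
  refine ⟨V, fun p q => √(m p q) • α p q, hpV, fun p => (hα p).smul (fun q hq => ?_) fun q hq => ?_,
    fun p p' q hq hq' => ?_⟩
  · exact (Real.contDiffAt_sqrt (hmpos p q hq).ne').contMDiffAt.comp q (hms p q hq)
  · exact (Real.sqrt_pos.2 (hmpos p q hq)).ne'
  · have hmem : ∀ᶠ z in 𝓝 q, z ∈ V p ∧ z ∈ V p' :=
      ((hα p).isOpen.eventually_mem hq).and ((hα p').isOpen.eventually_mem hq')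
    have hcont : ContinuousAt (fun z => α p z (reebField (α p') z)) q :=
      (contMDiffAt_form_apply (hα p).smooth (hα p').isSmoothVectorFieldOn (hα p').isOpen hq
        hq').continuousAt
    have key : ∀ σ : ℝ, (σ = 1 ∨ σ = -1) → ∀ z, z ∈ V p → z ∈ V p' →
        0 < σ * α p z (reebField (α p') z) → √(m p' z) • α p' z = σ • √(m p z) • α p z := by
      intro σ hσ z hz hz' hpos
      set k := α p z (reebField (α p') z) with hk
      have h1 : √(m p' z) = σ * k * √(m p z) := by
        rw [hmm p p' z hz hz', Real.sqrt_mul (sq_nonneg _), Real.sqrt_sq_eq_abs, ← hk]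
        congr 1
        rcases hσ with rfl | rfl
        · rw [one_mul] at hpos ⊢
          exact abs_of_pos hpos
        · rw [neg_one_mul] at hpos ⊢
          exact abs_of_neg (by linarith)
      ext w
      change √(m p' z) * α p' z w = σ * (√(m p z) * α p z w)
      rw [(hα p').eq_mul (hα p) hz' hz w, h1, ← hk]
      ring
    rcases lt_or_gt_of_ne (hk0 p p' q hq hq') with h | h
    · refine ⟨-1, Or.inr rfl, ?_⟩
      filter_upwards [hmem, hcont.eventually_lt continuousAt_const h] with z hz hz'
      exact key (-1) (Or.inr rfl) z hz.1 hz.2 (by linarith)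
    · refine ⟨1, Or.inl rfl, ?_⟩
      filter_upwards [hmem, (continuousAt_const (y := (0 : ℝ))).eventually_lt hcont h] with z hz hz'
      exact key 1 (Or.inl rfl) z hz.1 hz.2 (by linarith)

/-- The Reeb vectors of compatible contact forms make up a field of line elements. -/
theorem IsContactStructure.exists_reeb_elements [T2Space M] [SecondCountableTopology M]
    (hξ : IsContactStructure I ξ) :
    ∃ (l : LineElementField I M) (V : M → Set M) (a : M → ∀ p : M, TangentSpace I p →L[ℝ] ℝ),
      ∀ p, p ∈ V p ∧ IsContactFormOn ξ (a p) (V p) ∧ IsDirector l (reebField (a p)) (V p) := by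
  obtain ⟨V, a, hpV, ha, hsign⟩ := hξ.exists_compatible_forms
  refine ⟨⟨fun q => {reebField (a q) q, -reebField (a q) q}, fun q => ⟨_, rfl⟩⟩, V, a,
    fun p => ⟨hpV p, ha p, (ha p).isOpen, (ha p).isSmoothVectorFieldOn, fun q hq => ?_,
      fun q hq h0 => (ha p).reebField_notMem hq (by rw [h0]; exact (ξ q).zero_mem)⟩⟩
  obtain ⟨σ, hσ, h⟩ := hsign p q q hq (hpV q)
  have hR := (ha p).reebField_eq_smul hq (by rcases hσ with rfl | rfl <;> norm_num) h
  change {reebField (a q) q, -reebField (a q) q} = _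
  rw [hR]
  rcases hσ with rfl | rfl
  · rw [one_smul]
  · rw [neg_one_smul, neg_neg, pair_comm]

end ReebElements

/-! ### The flow of a Reeb field preserves the contact structure -/

section ReebFlow

variable {H : Type*} [TopologicalSpace H] {I : ModelWithCorners ℝ E3 H}
  {M : Type*} [TopologicalSpace M] [ChartedSpace H M] [IsManifold I ∞ M]

variable {v : ∀ p : M, TangentSpace I p} {U W : Set M} {ε : ℝ} {Φ : M → ℝ → M}

variable (I) in
/-- The expression of the family of maps `Φ` in the preferred charts at `p` and `m`. -/
def flowInChart (Φ : M → ℝ → M) (p m : M) (x : E3 × ℝ) : E3 :=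
  extChartAt I m (Φ ((extChartAt I p).symm x.1) x.2)

lemma flowInChart_self (p m : M) (t : ℝ) :
    flowInChart I Φ p m (extChartAt I p p, t) = extChartAt I m (Φ p t) := by
  unfold flowInChart
  rw [extChartAt_to_inv]

lemma IsLocalFlow.contMDiffAt (hΦ : IsLocalFlow I v U W ε Φ) {p : M} (hp : p ∈ W) {t : ℝ}
    (ht : t ∈ Ioo (-ε) ε) :
    ContMDiffAt (I.prod 𝓘(ℝ, ℝ)) I ∞ (fun x : M × ℝ => Φ x.1 x.2) (p, t) :=
  hΦ.2.2.2.2.2.contMDiffAt ((hΦ.1.prod isOpen_Ioo).mem_nhds ⟨hp, ht⟩)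

lemma IsLocalFlow.contDiffWithinAt_flowInChart (hΦ : IsLocalFlow I v U W ε Φ) {p m : M} (hp : p ∈ W)
    {t : ℝ} (ht : t ∈ Ioo (-ε) ε) (hm : Φ p t ∈ (extChartAt I m).source) :
    ContDiffWithinAt ℝ ∞ (flowInChart I Φ p m) (range I ×ˢ univ) (extChartAt I p p, t) := by
  have h1 : ContMDiffAt (I.prod 𝓘(ℝ, ℝ)) 𝓘(ℝ, E3) ∞
      (fun x : M × ℝ => extChartAt I m (Φ x.1 x.2)) (p, t) :=
    ContMDiffAt.comp (g := extChartAt I m) (p, t)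
      (contMDiffAt_extChartAt' (by rwa [extChartAt_source] at hm)) (hΦ.contMDiffAt hp ht)
  have h2 := (contMDiffAt_iff.1 h1).2
  have h3 : range (I.prod 𝓘(ℝ, ℝ)) = range I ×ˢ (univ : Set ℝ) := by
    change range (Prod.map I (id : ℝ → ℝ)) = _
    rw [range_prodMap, range_id]
  rw [h3] at h2
  exact h2

lemma mfderiv_extChartAt_eq {p q : M} (hq : q ∈ (extChartAt I p).source) (u : TangentSpace I q) :
    mfderiv I 𝓘(ℝ, E3) (extChartAt I p) q u = tangentCoordChange I q p q u := by
  have hq' : q ∈ (chartAt H p).source := by rwa [extChartAt_source] at hq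
  have e1 := TangentBundle.continuousLinearMapAt_trivializationAt (I := I) hq'
  have e2 := TangentBundle.continuousLinearMapAt_trivializationAt_eq_core (I := I) hq'
  rw [e1] at e2
  exact DFunLike.congr_fun e2 u

lemma IsLocalFlow.mdifferentiableAt (hΦ : IsLocalFlow I v U W ε Φ) {p : M} (hp : p ∈ W) {t : ℝ}
    (ht : t ∈ Ioo (-ε) ε) : MDifferentiableAt I I (fun q => Φ q t) p := by
  have h1 : ContMDiffAt I (I.prod 𝓘(ℝ, ℝ)) ∞ (fun q : M => (q, t)) p :=
    contMDiffAt_id.prodMk contMDiffAt_const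
  have h2 : ContMDiffAt I I ∞ (fun q => Φ q t) p :=
    ContMDiffAt.comp (g := fun x : M × ℝ => Φ x.1 x.2) p (hΦ.contMDiffAt hp ht) h1
  exact h2.mdifferentiableAt (by simp)

lemma IsLocalFlow.fderivWithin_flowInChart (hΦ : IsLocalFlow I v U W ε Φ) {p m : M} (hp : p ∈ W)
    {t : ℝ} (ht : t ∈ Ioo (-ε) ε) (hm : Φ p t ∈ (extChartAt I m).source) (w : TangentSpace I p) :
    fderivWithin ℝ (fun y => flowInChart I Φ p m (y, t)) (range I) (extChartAt I p p) w =
      tangentCoordChange I (Φ p t) m (Φ p t) (mfderiv I I (fun q => Φ q t) p w) := by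
  have hm' : Φ p t ∈ (chartAt H m).source := by rwa [extChartAt_source] at hm
  have h1 := HasMFDerivAt.comp p (f := fun q => Φ q t)
    (mdifferentiableAt_extChartAt (I := I) hm').hasMFDerivAt (hΦ.mdifferentiableAt hp ht).hasMFDerivAt
  obtain ⟨A, hA, hAw⟩ : ∃ A : E3 →L[ℝ] E3, HasFDerivWithinAt
      (fun y => flowInChart I Φ p m (y, t)) A (range I) (extChartAt I p p) ∧
      A w = tangentCoordChange I (Φ p t) m (Φ p t) (mfderiv I I (fun q => Φ q t) p w) :=
    ⟨_, h1.2, mfderiv_extChartAt_eq hm _⟩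
  rw [hA.fderivWithin (I.uniqueDiffOn _ (mem_range_self _)), ← hAw]

lemma IsLocalFlow.hasDerivAt_extChartAt (hΦ : IsLocalFlow I v U W ε Φ) {p m : M} (hp : p ∈ W)
    {t : ℝ} (ht : t ∈ Ioo (-ε) ε) (hm : Φ p t ∈ (extChartAt I m).source) :
    HasDerivAt (fun s => extChartAt I m (Φ p s)) (fieldInChart I v m (extChartAt I m (Φ p t))) t := by
  have hm' : Φ p t ∈ (chartAt H m).source := by rwa [extChartAt_source] at hm
  have h1 := (hΦ.2.2.2.2.1 p hp t ht).hasMFDerivAt (isOpen_Ioo.mem_nhds ht)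
  obtain ⟨A, hA, hA1⟩ : ∃ A : ℝ →L[ℝ] E3, HasFDerivAt (fun s => extChartAt I m (Φ p s)) A t ∧
      A 1 = mfderiv I 𝓘(ℝ, E3) (extChartAt I m) (Φ p t) (v (Φ p t)) := by
    refine ⟨_, (HasMFDerivAt.comp t (f := Φ p)
      (mdifferentiableAt_extChartAt (I := I) hm').hasMFDerivAt h1).hasFDerivAt, ?_⟩
    change mfderiv I 𝓘(ℝ, E3) (extChartAt I m) (Φ p t) ((1 : ℝ) • v (Φ p t)) = _
    rw [one_smul]
  rw [← mfderiv_extChartAt_apply v hm, ← hA1]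
  exact hA.hasDerivAt

variable {ξ : ∀ p : M, Submodule ℝ (TangentSpace I p)} {a : ∀ p : M, TangentSpace I p →L[ℝ] ℝ}
  {V : Set M}

/-- Along the flow of a Reeb field, the derivative of the flow satisfies the linearized equation, and
the contact form takes a constant value on it. -/
lemma IsLocalFlow.hasDerivAt_of_reebField (hΦ : IsLocalFlow I v U W ε Φ)
    (ha : IsContactFormOn ξ a V) (hv : ∀ z ∈ V, v z = reebField a z) {p m : M} (hp : p ∈ W) {t : ℝ}
    (ht : t ∈ Ioo (-ε) ε) (hm : Φ p t ∈ V ∩ (extChartAt I m).source) (w : TangentSpace I p) :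
    HasDerivAt (fun s => fderivWithin ℝ (fun y => flowInChart I Φ p m (y, s)) (range I)
        (extChartAt I p p) w)
      (fderivWithin ℝ (fieldInChart I (reebField a) m) (range I) (extChartAt I m (Φ p t))
        (fderivWithin ℝ (fun y => flowInChart I Φ p m (y, t)) (range I) (extChartAt I p p) w)) t ∧
    HasDerivAt (fun s => formInChart I a m (extChartAt I m (Φ p s))
      (fderivWithin ℝ (fun y => flowInChart I Φ p m (y, s)) (range I) (extChartAt I p p) w)) 0 t := by
  have hF := hΦ.contDiffWithinAt_flowInChart hp ht hm.2
  have hF0 := flowInChart_self (I := I) (Φ := Φ) p m t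
  have hFs : ∀ᶠ x in 𝓝[range I ×ˢ univ] (extChartAt I p p, t), flowInChart I Φ p m x ∈ range I :=
    Eventually.of_forall fun x => mem_range_self _
  have hy₀ : extChartAt I p p ∈ range I := mem_range_self _
  have hV : DifferentiableWithinAt ℝ (fieldInChart I (reebField a) m) (range I)
      (flowInChart I Φ p m (extChartAt I p p, t)) := by
    rw [hF0]
    exact (ha.contDiffWithinAt_fieldInChart hm).differentiableWithinAt (by simp)
  have hode : ∀ᶠ x in 𝓝[range I ×ˢ univ] (extChartAt I p p, t),
      HasDerivAt (fun s => flowInChart I Φ p m (x.1, s))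
        (fieldInChart I (reebField a) m (flowInChart I Φ p m x)) x.2 := by
    have h1 : ContinuousAt (fun x : M × ℝ => Φ x.1 x.2) (p, t) := (hΦ.contMDiffAt hp ht).continuousAt
    have h2 : ∀ᶠ x : M × ℝ in 𝓝 (p, t),
        (x.1 ∈ W ∧ x.2 ∈ Ioo (-ε) ε) ∧ Φ x.1 x.2 ∈ V ∩ (extChartAt I m).source :=
      ((hΦ.1.prod isOpen_Ioo).eventually_mem (x := (p, t)) ⟨hp, ht⟩).and
        (h1.eventually ((ha.isOpen.inter (isOpen_extChartAt_source m)).eventually_mem hm))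
    have h3 : ContinuousAt (fun x : E3 × ℝ => ((extChartAt I p).symm x.1, x.2))
        (extChartAt I p p, t) :=
      (ContinuousAt.comp (f := Prod.fst) (continuousAt_extChartAt_symm (I := I) p)
        continuousAt_fst).prodMk continuousAt_snd
    have h4 : ((extChartAt I p).symm (extChartAt I p p), t) = (p, t) := by rw [extChartAt_to_inv]
    have h5 := h3.eventually (h4 ▸ h2)
    filter_upwards [nhdsWithin_le_nhds h5] with x hx
    have h6 := hΦ.hasDerivAt_extChartAt hx.1.1 hx.1.2 hx.2.2
    have h7 : fieldInChart I v m (flowInChart I Φ p m x) =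
        fieldInChart I (reebField a) m (flowInChart I Φ p m x) := by
      unfold fieldInChart flowInChart
      rw [(extChartAt I m).left_inv hx.2.2, hv _ hx.2.1]
    rw [← h7]
    exact h6
  have hvar := hasDerivAt_variation I.uniqueDiffOn range_subset_closure_interior hy₀ hF hFs hV hode w
  have hmem := eventually_mem_of_mem_nhdsWithin_range hm.2 (ha.isOpen.mem_nhds hm.1)
  have hform := hasDerivAt_form_variation (β := formInChart I a m) (c := 1) I.uniqueDiffOn
    range_subset_closure_interior hy₀ hF hFs hV hode
    (by rw [hF0]; exact ha.differentiableWithinAt hm)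
    (by
      rw [hF0]
      filter_upwards [hmem] with y hy
      rw [ha.fieldInChart_reebField hy.1 hy.2]
      refine apply_reebVector ?_
      have := ha.reebDet_ne_zero ⟨hy.2, (extChartAt I m).map_target hy.1⟩
      rwa [(extChartAt I m).right_inv hy.1] at this)
    (by
      rw [hF0]
      intro x
      have h1 := hmem.self_of_nhdsWithin (mem_range_self _)
      have h2 := ha.fieldInChart_reebField h1.1 h1.2
      rw [h2]
      exact skew_reebVector x) w
  rw [hF0] at hvar
  refine ⟨hvar, ?_⟩
  simp only [flowInChart_self] at hform
  exact hform

/-- Along a flow line of a Reeb field, whether the image of a fixed vector under the derivative of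
the flow is zero, and whether it belongs to the contact plane, does not change for a short time. For the zero vector this is uniqueness for the linear variational
equation; for the plane, the contact form takes a constant value at the image vector. -/
lemma IsLocalFlow.eventually_mfderiv_iff (hΦ : IsLocalFlow I v U W ε Φ)
    (ha : IsContactFormOn ξ a V) (hv : ∀ z ∈ V, v z = reebField a z) {p : M} (hp : p ∈ W) {t₀ : ℝ}
    (ht₀ : t₀ ∈ Ioo (-ε) ε) (hV : Φ p t₀ ∈ V) (w : TangentSpace I p) :
    ∀ᶠ t in 𝓝 t₀, (mfderiv I I (fun q => Φ q t) p w ∈ ξ (Φ p t) ↔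
        mfderiv I I (fun q => Φ q t₀) p w ∈ ξ (Φ p t₀)) ∧
      (mfderiv I I (fun q => Φ q t) p w = 0 ↔ mfderiv I I (fun q => Φ q t₀) p w = 0) := by
  set m := Φ p t₀ with hm
  set Z : ℝ → E3 := fun s =>
    fderivWithin ℝ (fun y => flowInChart I Φ p m (y, s)) (range I) (extChartAt I p p) w with hZ
  have hmV : Φ p t₀ ∈ V ∩ (extChartAt I m).source := ⟨hV, mem_extChartAt_source m⟩
  have hcont : ContinuousAt (Φ p) t₀ :=
    (hΦ.2.2.2.2.1 p hp).continuousWithinAt ht₀ |>.continuousAt (isOpen_Ioo.mem_nhds ht₀)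
  have hev : ∀ᶠ t in 𝓝 t₀, t ∈ Ioo (-ε) ε ∧ Φ p t ∈ V ∩ (extChartAt I m).source :=
    (isOpen_Ioo.eventually_mem ht₀).and
      (hcont.eventually ((ha.isOpen.inter (isOpen_extChartAt_source m)).eventually_mem hmV))
  have hZt : ∀ t, t ∈ Ioo (-ε) ε → Φ p t ∈ V ∩ (extChartAt I m).source →
      Z t = tangentCoordChange I (Φ p t) m (Φ p t) (mfderiv I I (fun q => Φ q t) p w) :=
    fun t ht htV => hΦ.fderivWithin_flowInChart hp ht htV.2 w
  have hzero : ∀ t, t ∈ Ioo (-ε) ε → Φ p t ∈ V ∩ (extChartAt I m).source →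
      (mfderiv I I (fun q => Φ q t) p w = 0 ↔ Z t = 0) := by
    intro t ht htV
    rw [hZt t ht htV]
    constructor
    · intro h
      exact (congrArg (tangentCoordChange I (Φ p t) m (Φ p t)) h).trans (map_zero _)
    · intro h
      have h1 := tangentCoordChange_comp (I := I) (w := Φ p t) (x := m) (y := Φ p t) (z := Φ p t)
        (v := mfderiv I I (fun q => Φ q t) p w)
        ⟨⟨mem_extChartAt_source _, htV.2⟩, mem_extChartAt_source _⟩
      rw [h, map_zero] at h1
      exact (h1.trans (tangentCoordChange_self (I := I) (mem_extChartAt_source _))).symm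
  have hplane : ∀ t, t ∈ Ioo (-ε) ε → Φ p t ∈ V ∩ (extChartAt I m).source →
      (mfderiv I I (fun q => Φ q t) p w ∈ ξ (Φ p t) ↔
        formInChart I a m (extChartAt I m (Φ p t)) (Z t) = 0) := by
    intro t ht htV
    rw [ha.mem_iff _ htV.1, hZt t ht htV]
    have h1 := (formInChart_tangentCoordChange (a := a) htV.2 (mem_extChartAt_source (I := I) (Φ p t))
      (mfderiv I I (fun q => Φ q t) p w)).trans (formInChart_self _ _)
    exact (Eq.congr_left h1).symm
  have hder := hev.mono fun t ht => hΦ.hasDerivAt_of_reebField ha hv hp ht.1 ht.2 w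
  have h1 : (fun s => formInChart I a m (extChartAt I m (Φ p s)) (Z s)) =ᶠ[𝓝 t₀]
      fun _ => formInChart I a m (extChartAt I m (Φ p t₀)) (Z t₀) :=
    ODE_solution_unique_of_eventually (K := 0) (v := fun _ _ => 0) (s := fun _ => univ)
      (Eventually.of_forall fun t => (LipschitzWith.const _).lipschitzOnWith)
      (hder.mono fun t ht => ⟨ht.2, mem_univ _⟩)
      (Eventually.of_forall fun t => ⟨hasDerivAt_const _ _, mem_univ _⟩) rfl
  have h2 : Z t₀ = 0 → Z =ᶠ[𝓝 t₀] fun _ => 0 := by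
    intro h0
    set A : ℝ → E3 →L[ℝ] E3 := fun t =>
      fderivWithin ℝ (fieldInChart I (reebField a) m) (range I) (extChartAt I m (Φ p t)) with hA
    have hAc : ContinuousAt A t₀ := by
      have h3 := ((ha.contDiffWithinAt_fieldInChart hmV).fderivWithin_right (m := ∞)
        I.uniqueDiffOn le_rfl (mem_range_self _)).continuousWithinAt
      have h4 : Tendsto (fun t => extChartAt I m (Φ p t)) (𝓝 t₀)
          (𝓝[range I] (extChartAt I m (Φ p t₀))) :=
        tendsto_nhdsWithin_iff.2 ⟨ContinuousAt.comp (g := extChartAt I m)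
          (continuousAt_extChartAt (I := I) m) hcont,
          Eventually.of_forall fun t => mem_range_self _⟩
      exact h3.tendsto.comp h4
    refine ODE_solution_unique_of_eventually (K := ‖A t₀‖₊ + 1) (v := fun t x => A t x)
      (s := fun _ => univ) ?_ (hder.mono fun t ht => ⟨ht.1, mem_univ _⟩)
      (Eventually.of_forall fun t => ⟨?_, mem_univ _⟩) h0
    · filter_upwards [hAc.nnnorm.eventually_lt continuousAt_const
        (show ‖A t₀‖₊ < ‖A t₀‖₊ + 1 from lt_add_one _)] with t ht
      exact ((A t).lipschitz.weaken ht.le).lipschitzOnWith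
    · rw [map_zero]
      exact hasDerivAt_const _ _
  have h3 : ∀ᶠ t in 𝓝 t₀, (Z t = 0 ↔ Z t₀ = 0) := by
    by_cases h0 : Z t₀ = 0
    · filter_upwards [h2 h0] with t ht
      exact ⟨fun _ => h0, fun _ => ht⟩
    · filter_upwards [hder.self_of_nhds.1.continuousAt.eventually_ne h0] with t ht
      exact ⟨fun h => absurd h ht, fun h => absurd h h0⟩
  filter_upwards [hev, h1, h3] with t ht h1t h3t
  have h0 := hev.self_of_nhds
  refine ⟨?_, ?_⟩
  · rw [hplane t ht.1 ht.2, h1t]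
    exact (hplane t₀ h0.1 h0.2).symm
  · rw [hzero t ht.1 ht.2, h3t]
    exact (hzero t₀ h0.1 h0.2).symm

lemma iff_of_eventually_iff {J : Set ℝ} (hJ : IsPreconnected J) {Q : ℝ → Prop}
    (hQ : ∀ t ∈ J, ∀ᶠ s in 𝓝 t, (Q s ↔ Q t)) {s t : ℝ} (hs : s ∈ J) (ht : t ∈ J) : Q s ↔ Q t :=
  hJ.induction₂ (fun s t => Q s ↔ Q t)
    (fun x hx => nhdsWithin_le_nhds ((hQ x hx).mono fun _ h => h.symm))
    (fun _ _ _ _ _ _ h h' => h.trans h') (fun _ _ _ _ h => h.symm) hs ht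

/-- A vector field which locally is the Reeb field of a contact form is a contact vector field. -/
theorem isContactVectorFieldOn_of_reebField (hv : IsSmoothVectorFieldOn I v U)
    (h : ∀ q ∈ U, ∃ V a, q ∈ V ∧ IsContactFormOn ξ a V ∧ ∀ z ∈ V, v z = reebField a z) :
    IsContactVectorFieldOn I ξ v U := by
  refine ⟨hv, fun W ε Φ hΦ p hp t ht => ?_⟩
  have h0 : (0 : ℝ) ∈ Ioo (-ε) ε := ⟨by linarith [hΦ.2.1], hΦ.2.1⟩
  have hloc : ∀ w : TangentSpace I p, ∀ t ∈ Ioo (-ε) ε, ∀ᶠ s in 𝓝 t,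
      (mfderiv I I (fun q => Φ q s) p w ∈ ξ (Φ p s) ↔
        mfderiv I I (fun q => Φ q t) p w ∈ ξ (Φ p t)) ∧
      (mfderiv I I (fun q => Φ q s) p w = 0 ↔ mfderiv I I (fun q => Φ q t) p w = 0) := by
    intro w t ht
    obtain ⟨V, a, hV, ha, hva⟩ := h _ (hΦ.2.2.1 p hp t ht)
    exact hΦ.eventually_mfderiv_iff ha hva hp ht hV w
  have hid : HasMFDerivAt I I (fun q => Φ q 0) p (ContinuousLinearMap.id ℝ (TangentSpace I p)) :=
    (hasMFDerivAt_id p).congr_of_eventuallyEq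
      ((hΦ.1.eventually_mem hp).mono fun q hq => hΦ.2.2.2.1 q hq)
  have hid' : ∀ w : TangentSpace I p, mfderiv I I (fun q => Φ q 0) p w = w := fun w =>
    DFunLike.congr_fun hid.mfderiv w
  have hplane : ∀ w : TangentSpace I p, mfderiv I I (fun q => Φ q t) p w ∈ ξ (Φ p t) ↔ w ∈ ξ p := by
    intro w
    rw [iff_of_eventually_iff (Q := fun s => mfderiv I I (fun q => Φ q s) p w ∈ ξ (Φ p s))
      isPreconnected_Ioo (fun t ht => (hloc w t ht).mono fun s hs => hs.1) ht h0]
    have h1 : Φ p 0 = p := hΦ.2.2.2.1 p hp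
    have h2 : ∀ q, q = p → ((w : E3) ∈ ξ q ↔ w ∈ ξ p) := by
      rintro _ rfl; exact Iff.rfl
    rw [← h2 _ h1]
    exact Eq.to_iff (congrArg (fun x : E3 => x ∈ ξ (Φ p 0)) (hid' w))
  have hinj : ∀ w : E3, mfderiv I I (fun q => Φ q t) p w = 0 → w = 0 := by
    intro w hw
    have := (iff_of_eventually_iff (Q := fun s => mfderiv I I (fun q => Φ q s) p w = 0)
      isPreconnected_Ioo (fun t ht => (hloc w t ht).mono fun s hs => hs.2) ht h0).1 hw
    exact (hid' w).symm.trans this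
  have hsurj : ∀ y : E3, ∃ w : E3, mfderiv I I (fun q => Φ q t) p w = y := by
    have h1 : ∀ f : E3 →ₗ[ℝ] E3, (∀ w, f w = 0 → w = 0) → ∀ y, ∃ w, f w = y := fun f hf =>
      LinearMap.surjective_of_injective ((injective_iff_map_eq_zero f).2 hf)
    exact h1 (mfderiv I I (fun q => Φ q t) p).toLinearMap hinj
  ext y
  rw [Submodule.mem_map]
  constructor
  · rintro ⟨w, hw, rfl⟩
    exact (hplane w).2 hw
  · intro hy
    obtain ⟨w, hw⟩ := hsurj y
    refine ⟨w, (hplane w).1 ?_, hw⟩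
    exact (Eq.to_iff (congrArg (fun x : E3 => x ∈ ξ (Φ p t)) hw)).2 hy

end ReebFlow

/-! ### Choice of signs over a simply connected space -/

section Signs

/-- Over a simply connected space every locally constant cocycle of signs `c` is a coboundary:
the double covering which it defines has a section. -/
theorem exists_sign_of_cocycle {X : Type*} [TopologicalSpace X] [SimplyConnectedSpace X]
    [LocallyPathConnectedSpace X] {V : X → Set X} (hV : ∀ i, IsOpen (V i)) (hmem : ∀ x, x ∈ V x)
    {c : X → X → X → ℤˣ} (hc : ∀ i j x, x ∈ V i → x ∈ V j → ∀ᶠ y in 𝓝 x, c i j y = c i j x)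
    (hself : ∀ i x, x ∈ V i → c i i x = 1)
    (hcomp : ∀ i j k x, x ∈ V i → x ∈ V j → x ∈ V k → c j k x * c i j x = c i k x) :
    ∃ ε : X → ℤˣ, ∀ i x, x ∈ V i → ∀ᶠ y in 𝓝 x, c y i y * ε y = c x i x * ε x := by
  let Z : FiberBundleCore X X ℤˣ :=
    { baseSet := V
      isOpen_baseSet := hV
      indexAt := id
      mem_baseSet_at := hmem
      coordChange := fun i j x u => c i j x * u
      coordChange_self := fun i x hx u => by rw [hself i x hx, one_mul]
      continuousOn_coordChange := fun i j p hp => by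
        refine ContinuousAt.continuousWithinAt ?_
        have h1 : ∀ᶠ y : X × ℤˣ in 𝓝 p, c i j y.1 * y.2 = c i j p.1 * p.2 := by
          have h2 : ∀ᶠ u in 𝓝 p.2, u = p.2 := (isOpen_discrete {p.2}).eventually_mem rfl
          rw [show p = (p.1, p.2) from rfl, nhds_prod_eq]
          filter_upwards [(hc i j p.1 hp.1.1 hp.1.2).prod_mk h2] with y hy
          rw [hy.1, hy.2]
        exact continuousAt_const.congr (h1.mono fun y hy => hy.symm)
      coordChange_comp := fun i j k x hx u => by
        rw [← mul_assoc, hcomp i j k x hx.1.1 hx.1.2 hx.2] }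
  have hcov : IsCoveringMap (π ℤˣ Z.Fiber) := FiberBundle.isCoveringMap
  obtain ⟨x₀⟩ : Nonempty X := inferInstance
  obtain ⟨s, ⟨-, hs⟩, -⟩ := hcov.existsUnique_continuousMap_lifts (ContinuousMap.id X) x₀
    (⟨x₀, (1 : ℤˣ)⟩ : Bundle.TotalSpace ℤˣ Z.Fiber) rfl
  have hsp : ∀ x, (s x).1 = x := fun x => congrFun hs x
  set ε : X → ℤˣ := fun x => (s x).2 with hε
  refine ⟨ε, fun i x hx => ?_⟩
  have h1 : ContinuousAt (fun y => (Z.localTriv i (s y)).2) x := by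
    have h2 : s x ∈ (Z.localTriv i).source := by
      rw [FiberBundleCore.mem_localTriv_source, hsp]
      exact hx
    exact continuousAt_snd.comp (((Z.localTriv i).continuousAt h2).comp s.continuous.continuousAt)
  have h3 : ∀ y, (Z.localTriv i (s y)).2 = c y i y * ε y := by
    intro y
    rw [FiberBundleCore.localTriv_apply]
    change c (s y).1 i (s y).1 * ε y = c y i y * ε y
    rw [hsp]
  have h4 := h1.eventually ((isOpen_discrete {(Z.localTriv i (s x)).2}).eventually_mem rfl)
  filter_upwards [h4] with y hy
  rw [← h3, ← h3]
  exact hy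

end Signs

section Contact

lemma locallyPathConnectedSpace_of_modelWithCorners {H : Type*} [TopologicalSpace H]
    (I : ModelWithCorners ℝ E3 H) (M : Type*) [TopologicalSpace M] [ChartedSpace H M] :
    LocallyPathConnectedSpace M := by
  have h1 : LocallyPathConnectedSpace (range I) := I.convex_range.locallyPathConnectedSpace
  have h2 : LocallyPathConnectedSpace H :=
    I.isClosedEmbedding.isEmbedding.toHomeomorph.isOpenEmbedding.locallyPathConnectedSpace
  exact ChartedSpace.locallyPathConnectedSpace H M

variable {H : Type*} [TopologicalSpace H] {I : ModelWithCorners ℝ E3 H}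
  {M : Type*} [TopologicalSpace M] [ChartedSpace H M] [IsManifold I ∞ M]

variable {ξ : ∀ p : M, Submodule ℝ (TangentSpace I p)} {l : LineElementField I M}
  {V : M → Set M} {a : M → ∀ p : M, TangentSpace I p →L[ℝ] ℝ}

/-- On a simply connected open set, directors of a field of line elements can be multiplied by signs
so that they fit together to a vector field. -/
lemma exists_vectorField_of_directors {v : M → ∀ p : M, TangentSpace I p}
    (hmem : ∀ p, p ∈ V p) (hv : ∀ p, IsDirector l (v p) (V p)) {U : Set M} (hU : IsOpen U)
    (hUs : SimplyConnectedSpace U) :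
    ∃ w : ∀ p : M, TangentSpace I p, ∀ q ∈ U, ∃ σ : ℝ, (σ = 1 ∨ σ = -1) ∧
      ∀ᶠ z in 𝓝 q, w z = σ • v q z := by
  classical
  have : LocallyPathConnectedSpace M := locallyPathConnectedSpace_of_modelWithCorners I M
  have : LocallyPathConnectedSpace U := hU.locallyPathConnectedSpace
  have hrel : ∀ i j q, ∃ c : ℤˣ, relSign (v i) (v j) q = ((c : ℤ) : ℝ) := fun i j q => by
    rcases relSign_eq_or (v i) (v j) q with h | h
    · exact ⟨1, by rw [h]; simp⟩
    · exact ⟨-1, by rw [h]; simp⟩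
  choose c hc using hrel
  have hinj : ∀ {d e : ℤˣ}, ((d : ℤ) : ℝ) = ((e : ℤ) : ℝ) → d = e := fun h =>
    Units.ext (Int.cast_injective h)
  have hvc : ∀ i j q, q ∈ V i → q ∈ V j → v i q = ((c i j q : ℤ) : ℝ) • v j q :=
    fun i j q hi hj => by rw [← hc]; exact (hv i).eq_relSign_smul (hv j) hi hj
  have hsign : ∀ d : ℤˣ, ((d : ℤ) : ℝ) = 1 ∨ ((d : ℤ) : ℝ) = -1 := fun d => by
    rcases Int.units_eq_one_or d with rfl | rfl
    · left; simp
    · right; simp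
  have huniq : ∀ i j q, q ∈ V j → ∀ d : ℤˣ, v i q = ((d : ℤ) : ℝ) • v j q → c i j q = d :=
    fun i j q hj d h => hinj (by
      rw [← hc]; exact relSign_eq ((hv j).ne_zero q hj) (hsign d) h)
  obtain ⟨ε, hε⟩ := exists_sign_of_cocycle (X := U) (V := fun i => Subtype.val ⁻¹' V i)
    (c := fun i j x => c i j x) (fun i => (hv i).isOpen.preimage continuous_subtype_val)
    (fun x => hmem x)
    (fun i j x hi hj => by
      have h1 := (hv i).eventually_relSign_eq (hv j) hi hj
      have h2 := continuous_subtype_val.continuousAt.eventually h1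
      filter_upwards [h2] with y hy
      rw [hc, hc] at hy
      exact hinj hy)
    (fun i x hi => huniq _ _ _ hi 1 (by simp))
    (fun i j k x hi hj hk => by
      symm
      refine huniq _ _ _ hk _ ?_
      rw [hvc i j x hi hj, hvc j k x hj hk, smul_smul]
      push_cast
      rw [mul_comm])
  refine ⟨fun q => if h : q ∈ U then ((ε ⟨q, h⟩ : ℤ) : ℝ) • v q q else 0, fun q hq => ?_⟩
  refine ⟨((c q q q * ε ⟨q, hq⟩ : ℤˣ) : ℤ), hsign _, ?_⟩
  have h1 := hε ⟨q, hq⟩ ⟨q, hq⟩ (hmem q)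
  rw [nhds_subtype_eq_comap, eventually_comap] at h1
  filter_upwards [h1, hU.eventually_mem hq, (hv q).isOpen.eventually_mem (hmem q)] with z hz hzU hzV
  rw [dif_pos hzU, ← hz ⟨z, hzU⟩ rfl, hvc z q z (hmem z) hzV, smul_smul]
  push_cast
  rw [mul_comm]

/-- Line elements which are locally given by Reeb fields are contact: over a simply connected open
set there is a global vector field representing them, it is locally plus or minus a Reeb field, and
the negative of the Reeb field of `a` is the Reeb field of `-a`. -/
theorem isContact_of_reeb_directors
    (h : ∀ p, p ∈ V p ∧ IsContactFormOn ξ (a p) (V p) ∧ IsDirector l (reebField (a p)) (V p)) :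
    l.IsContact ξ := by
  refine ⟨fun p => ⟨V p, (h p).2.1.isOpen, (h p).1, _, (h p).2.2.smooth, (h p).2.2.elem_eq⟩,
    fun U hU hUs => ?_⟩
  obtain ⟨w, hw⟩ := exists_vectorField_of_directors (fun p => (h p).1) (fun p => (h p).2.2) hU hUs
  have key : ∀ q ∈ U, ∃ W b, q ∈ W ∧ W ⊆ V q ∧ IsContactFormOn ξ b W ∧
      ∀ z ∈ W, w z = reebField b z ∧ ∃ σ : ℝ, (σ = 1 ∨ σ = -1) ∧ w z = σ • reebField (a q) z := by
    intro q hq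
    obtain ⟨σ, hσ, hev⟩ := hw q hq
    obtain ⟨W, hW, hWo, hqW⟩ := eventually_nhds_iff.1
      (hev.and ((h q).2.1.isOpen.eventually_mem (h q).1))
    have ha := (h q).2.1.mono hWo fun z hz => (hW z hz).2
    have hσ0 : σ ≠ 0 := by rcases hσ with rfl | rfl <;> norm_num
    have hσσ : σ * σ = 1 := by rcases hσ with rfl | rfl <;> norm_num
    refine ⟨W, fun z => σ • a q z, hqW, fun z hz => (hW z hz).2,
      ha.smul (f := fun _ => σ) (fun z _ => contMDiffAt_const) (fun z _ => hσ0), fun z hz => ?_⟩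
    refine ⟨?_, σ, hσ, (hW z hz).1⟩
    rw [(hW z hz).1]
    exact (ha.reebField_eq_smul hz hσσ (Eventually.of_forall fun _ => rfl)).symm
  refine ⟨w, isContactVectorFieldOn_of_reebField (fun q hq => ?_) (fun q hq => ?_), fun q hq => ?_⟩
  · obtain ⟨W, b, hqW, -, hb, hwb⟩ := key q hq
    have h1 := hb.isSmoothVectorFieldOn.contMDiffAt (hb.isOpen.mem_nhds hqW)
    refine (h1.congr_of_eventuallyEq ?_).contMDiffWithinAt
    filter_upwards [hb.isOpen.mem_nhds hqW] with z hz
    rw [(hwb z hz).1]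
  · obtain ⟨W, b, hqW, -, hb, hwb⟩ := key q hq
    exact ⟨W, b, hqW, hb, fun z hz => (hwb z hz).1⟩
  · obtain ⟨W, b, hqW, -, hb, hwb⟩ := key q hq
    obtain ⟨-, σ, hσ, hwσ⟩ := hwb q hqW
    rw [(h q).2.2.elem_eq q (h q).1, hwσ]
    rcases hσ with rfl | rfl
    · rw [one_smul]
    · rw [neg_one_smul, neg_neg, pair_comm]

theorem isTransverse_of_reeb_directors
    (h : ∀ p, p ∈ V p ∧ IsContactFormOn ξ (a p) (V p) ∧ IsDirector l (reebField (a p)) (V p)) :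
    l.IsTransverse ξ := by
  intro p w hw
  have h1 := (h p).2.1.reebField_notMem (h p).1
  rw [(h p).2.2.elem_eq p (h p).1] at hw
  rcases hw with rfl | rfl
  · exact h1
  · rwa [neg_mem_iff]

end Contact

end RegularNbhd

end

theorem mainTheorem8 {H : Type*} [TopologicalSpace H]
    (I : ModelWithCorners ℝ (EuclideanSpace ℝ (Fin 3)) H)
    {M : Type*} [TopologicalSpace M] [ChartedSpace H M] [IsManifold I ∞ M]
    [T2Space M] [SecondCountableTopology M]
    (ξ : ∀ p : M, Submodule ℝ (TangentSpace I p)) (hξ : RegularNbhd.IsContactStructure I ξ)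
    (L : Set M) (hcompact : IsCompact L) (hL : RegularNbhd.IsLegendrian I ξ L)
    (hint : L ⊆ I.interior M) :
    ∃ U : Set M, RegularNbhd.IsRegularNeighborhood I ξ L U := by
  obtain ⟨l, V, a, h⟩ := hξ.exists_reeb_elements
  have hh : ∀ p ∈ L, RegularNbhd.HasHeight l L p := fun p hp =>
    hL.hasHeight (A := a p p) hp (hint hp) (h p).2.2 (h p).1 ((h p).2.1.mem_iff p (h p).1)
      ((h p).2.1.apply_reebField (h p).1)
  obtain ⟨ι, W, v, N₀, hv, hWi, hN₀, hLN, hLW, hF⟩ :=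
    RegularNbhd.exists_transverseFamily hcompact hh
  obtain ⟨U, S, r, hU, hLU, hr, hS, hSU, hexp⟩ :=
    RegularNbhd.exists_band_neighborhood hv hWi hcompact hN₀ hLN hLW hF
  exact ⟨U, S, l, r, hU, hLU, hr, hS, hSU, RegularNbhd.isContact_of_reeb_directors h,
    RegularNbhd.isTransverse_of_reeb_directors h, hexp⟩
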